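/- \textbf{Setting.} Fix $T>0$, $p\ge 1$ and $\eta$ with $1/p<\eta<1/2$. Let $W_{\eta,p}$ be the fractional Sobolev space on $[0,T]$, the closure of the $C^1$ functions for the norm $$\|f\|_{\eta,p}^p=\int_0^T|f(t)|^p\,dt+\iint_{[0,T]^2}\frac{|f(t)-f(s)|^p}{|t-s|^{1+p\eta}}\,dt\,ds ,$$ whose elements are continuous functions. Let $I_{1,2}$ be the Cameron--Martin space of the functions $h(t)=\int_0^t\dot h(s)\,ds$ with $\dot h\in L^2([0,T])$, with $\langle h,k\rangle_{I_{1,2}}=\langle\dot h,\dot k\rangle_{L^2}$. Let $P$ be the law on $W_{\eta,p}$ of a standard Brownian motion $B$ on $[0,T]$ and let $\delta_B h=\int_0^T\dot h\,dB$ be the It\^o integral. For a cylindrical functional $F=f(\delta_Bh_1,\dots,\delta_Bh_k)$, with $f$ a Schwartz function on $\mathbb R^k$ and $h_i\in I_{1,2}$, put $\nabla F=\sum_j\partial_jf(\delta_Bh_1,\dots)\,h_j$ and $\nabla^{(2)}F=\sum_{j,l}\partial^2_{jl}f(\delta_Bh_1,\dots)\,h_j\otimes h_l$. Let $\mathbb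 D_{2,2}$ be the completion of the cylindrical functionals for the norm $\|F\|_{2,2}^2=\mathbf E F^2+\mathbf E\|\nabla F\|^2_{I_{1,2}}+\mathbf E\|\nabla^{(2)}F\|^2_{I_{1,2}\otimes I_{1,2}}$. A function $F:W_{\eta,p}\to\mathbb R$ belongs to $\Sigma_{\eta,p}$ if it is $1$-Lipschitz for $\|\cdot\|_{\eta,p}$, belongs to $\mathbb D_{2,2}$, and its second gradient has a version with $$\bigl|\langle\nabla^{(2)}F(x)-\nabla^{(2)}F(x+g),\,h\otimes k\rangle_{I_{1,2}\otimes I_{1,2}}\bigr|\le\|g\|_{\eta,p}\,\|h\|_{L^2}\,\|k\|_{L^2}$$ for all $x\in W_{\eta,p}$ and $g,h,k\in I_{1,2}$ (so that the left-hand side extends continuously to $h,k\in L^2$). Let $E$ be a complete separable metric space with a $\sigma$-finite Borel measure $\nu$, and let $N$ be a Poisson random measure on $E$ with intensity (control) measure $\nu$. For deterministic $v\in L^2(\nu)$ let $\delta_\nu v=\int_E v\,(dN-d\nu)$ be the compensated Poisson integral (the $L^2$-limit of the same expression for integrands in $L^1(\nu)\cap L^2(\nu)$). For $n\ge1$ and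 $1\le j\le n$ let $$h_j^n(t)=\sqrt{n/T}\int_0^t\mathbf 1_{[(j-1)T/n,\,jT/n)}(r)\,dr .$$ \textbf{Theorem.} Let $n\ge 1$ and let $(u_k)_{1\le k\le n}$ be an orthogonal family in $L^2(\nu)$. Put $\xi_k^2=\int_E u_k^2\,d\nu$, let $Y_1,\dots,Y_n$ be independent with $Y_k\sim\mathcal N(0,\xi_k^2)$, and let $B_\xi=\sum_{j=1}^nY_j\,h_j^n$ and $\delta_\nu u=\sum_{j=1}^n\delta_\nu u_j\,h_j^n$. Then for every $F\in\Sigma_{\eta,p}$ the variables $F(B_\xi)$ and $F(\delta_\nu u)$ are integrable and $$\bigl|\mathbf E F(B_\xi)-\mathbf E F(\delta_\nu u)\bigr|\le\tfrac12\,\max(1,T)^3\,n^{-3/2+\eta}\sum_{j=1}^n\sum_{k=1}^n\sum_{l=1}^n\int_E|u_j(x)u_k(x)|\,|u_l(x)|\,d\nu(x),$$ where the right-hand side may be $+\infty$. In particular, for $T\le1$ the constant is $\tfrac12$. -/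

import Mathlib

open MeasureTheory ProbabilityTheory Filter Topology
open scoped ENNReal NNReal SchwartzMap

noncomputable section

namespace DiffusiveStein

/-- The time interval `[0, T]`; its `volume` is Lebesgue measure. -/
abbrev TimeI (T : ℝ) : Type := Set.Icc (0 : ℝ) T

instance instMeasureSpaceTimeI (T : ℝ) : MeasureSpace (TimeI T) := Measure.Subtype.measureSpace

instance instIsFiniteMeasureTimeI (T : ℝ) : IsFiniteMeasure (volume : Measure (TimeI T)) := by
  refine ⟨?_⟩
  have h := Measure.Subtype.volume_univ
    (nullMeasurableSet_Icc (a := (0 : ℝ)) (b := T) (μ := volume))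
  rw [h, Real.volume_Icc]
  exact ENNReal.ofReal_lt_top

/-- The space of continuous paths on `[0, T]`, with its Borel sigma-algebra. -/
abbrev Path (T : ℝ) : Type := C(TimeI T, ℝ)

instance instMeasurableSpacePath (T : ℝ) : MeasurableSpace (Path T) := borel (Path T)

instance instBorelSpacePath (T : ℝ) : BorelSpace (Path T) := ⟨rfl⟩

/-! ### Fractional Sobolev space -/

/-- The fractional Sobolev norm: its `p`-th power is
`∫ |f(t)|^p dt + ∬ |f(t) - f(s)|^p / |t - s|^(1 + p η) ds dt`. -/
def sobNorm {T : ℝ} (η p : ℝ) (f : Path T) : ℝ≥0∞ :=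
  ((∫⁻ t : TimeI T, ENNReal.ofReal (|f t| ^ p)) +
    ∫⁻ t : TimeI T, ∫⁻ s : TimeI T,
      ENNReal.ofReal (|f t - f s| ^ p / |(t : ℝ) - (s : ℝ)| ^ (1 + p * η))) ^ (1 / p)

/-- The fractional Sobolev space `W_{η,p}` over `[0, T]`. It is used for `1 / p < η < 1` only,
where each class has a continuous representative and `C¹` functions are dense, so that the space
of functions with finite norm is also the closure of the `C¹` functions. -/
def sobSpace (T η p : ℝ) : Set (Path T) := {f | sobNorm η p f < ∞}

/-! ### Wiener space and the Gross-Sobolev derivative -/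

/-- The law of a standard Brownian motion on `[0, T]`. -/
structure IsWienerMeasure {T : ℝ} (P : Measure (Path T)) : Prop where
  isProbabilityMeasure : IsProbabilityMeasure P
  start_zero : ∀ t : TimeI T, (t : ℝ) = 0 → ∀ᵐ x ∂P, x t = 0
  increments_law : ∀ s t : TimeI T, s ≤ t →
    HasLaw (fun x : Path T => x t - x s) (gaussianReal 0 (Real.toNNReal ((t : ℝ) - s))) P
  indep_increments : HasIndepIncrements (fun (t : TimeI T) (x : Path T) => x t) P

/-- The primitive `I¹_{0+} φ`, that is `t ↦ ∫_0^t φ(s) ds`. -/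
def prim {T : ℝ} (φ : TimeI T → ℝ) (t : TimeI T) : ℝ := ∫ s in Set.Iic t, φ s

/-- The Cameron-Martin space `I_{1,2}`: primitives of square integrable functions. -/
def cameronMartin (T : ℝ) : Set (Path T) :=
  {g | ∃ φ : TimeI T → ℝ, MemLp φ 2 volume ∧ ∀ t, g t = prim φ t}

/-- A step function on `[0, T]`: coefficients `a i` and intervals `(s i, t i]`. -/
structure StepFn (T : ℝ) where
  m : ℕ
  a : Fin m → ℝ
  s : Fin m → TimeI T
  t : Fin m → TimeI T
  s_le_t : ∀ i, s i ≤ t i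

/-- The step function `∑ a_i 1_{(s_i, t_i]}`. -/
def StepFn.toFun {T : ℝ} (σ : StepFn T) (r : TimeI T) : ℝ :=
  ∑ i, (Set.Ioc (σ.s i) (σ.t i)).indicator (fun _ => σ.a i) r

/-- The elementary stochastic integral `∑ a_i (x(t_i) - x(s_i))`. -/
def StepFn.stochInt {T : ℝ} (σ : StepFn T) (x : Path T) : ℝ :=
  ∑ i, σ.a i * (x (σ.t i) - x (σ.s i))

/-- `Z` is the Itô integral `∫ φ(s) dB(s)` of the deterministic function `φ ∈ L²([0,T])` with
respect to the coordinate process under `P`: the `L²(P)` limit of the integrals of step functions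
that converge to `φ` in `L²([0,T])`. -/
def IsWienerIntegral {T : ℝ} (P : Measure (Path T)) (φ : TimeI T → ℝ) (Z : Path T → ℝ) : Prop :=
  MemLp φ 2 volume ∧ MemLp Z 2 P ∧ ∃ σ : ℕ → StepFn T,
    Tendsto (fun m => eLpNorm (fun r => (σ m).toFun r - φ r) 2 volume) atTop (𝓝 0) ∧
    Tendsto (fun m => eLpNorm (fun x => (σ m).stochInt x - Z x) 2 P) atTop (𝓝 0)

/-- A cylindrical functional `f(δ_B h_1, …, δ_B h_k)` with `f` a Schwartz function and
`h_i = I¹_{0+} φ_i` in the Cameron-Martin space; `Z i` is `δ_B h_i`. -/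
structure Cylindrical {T : ℝ} (P : Measure (Path T)) where
  k : ℕ
  f : 𝓢(EuclideanSpace ℝ (Fin k), ℝ)
  φ : Fin k → TimeI T → ℝ
  Z : Fin k → Path T → ℝ
  isWienerIntegral : ∀ i, IsWienerIntegral P (φ i) (Z i)

namespace Cylindrical

variable {T : ℝ} {P : Measure (Path T)}

/-- The vector `(δ_B h_1, …, δ_B h_k)`. -/
def point (c : Cylindrical P) (x : Path T) : EuclideanSpace ℝ (Fin c.k) :=
  WithLp.toLp 2 (fun i => c.Z i x)

/-- The value of the functional. -/
def val (c : Cylindrical P) (x : Path T) : ℝ := c.f (c.point x)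

/-- The density of the gradient, `∑_j ∂_j f(δ_B h) ḣ_j(s)`. -/
def grad (c : Cylindrical P) (x : Path T) (s : TimeI T) : ℝ :=
  ∑ j, fderiv ℝ c.f (c.point x) (EuclideanSpace.single j 1) * c.φ j s

/-- The density of the second gradient, `∑_{j,l} ∂²_{jl} f(δ_B h) ḣ_j(s) ḣ_l(r)`. -/
def hess (c : Cylindrical P) (x : Path T) (q : TimeI T × TimeI T) : ℝ :=
  ∑ j, ∑ l, iteratedFDeriv ℝ 2 c.f (c.point x)
    ![EuclideanSpace.single j 1, EuclideanSpace.single l 1] * c.φ j q.1 * c.φ l q.2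

end Cylindrical

/-- `F` belongs to `𝔻_{2,2}`, the completion of the cylindrical functionals for the norm
`‖F‖² = E F² + E ‖∇F‖² + E ‖∇²F‖²`, with first and second gradients of densities `D1`, `D2`:
under `h ↔ ḣ` the gradients take values in `L²([0,T])` and in `L²([0,T]²)`. -/
def IsGrossSobolev {T : ℝ} (P : Measure (Path T)) (F : Path T → ℝ)
    (D1 : Path T → TimeI T → ℝ) (D2 : Path T → TimeI T × TimeI T → ℝ) : Prop :=
  MemLp F 2 P ∧
  MemLp (fun z : Path T × TimeI T => D1 z.1 z.2) 2 (P.prod volume) ∧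
  MemLp (fun z : Path T × (TimeI T × TimeI T) => D2 z.1 z.2) 2
    (P.prod (volume.prod volume)) ∧
  ∃ c : ℕ → Cylindrical P,
    Tendsto (fun m => eLpNorm (fun x => (c m).val x - F x) 2 P) atTop (𝓝 0) ∧
    Tendsto (fun m => eLpNorm (fun z : Path T × TimeI T => (c m).grad z.1 z.2 - D1 z.1 z.2) 2
      (P.prod volume)) atTop (𝓝 0) ∧
    Tendsto (fun m => eLpNorm (fun z : Path T × (TimeI T × TimeI T) =>
      (c m).hess z.1 z.2 - D2 z.1 z.2) 2 (P.prod (volume.prod volume))) atTop (𝓝 0)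

/-- The pairing `⟨K, h ⊗ k⟩` in `I_{1,2} ⊗ I_{1,2}`, where `K` has density `D` and
`h`, `k` are the primitives of `φ`, `ψ`. -/
def pairing {T : ℝ} (D : TimeI T × TimeI T → ℝ) (φ ψ : TimeI T → ℝ) : ℝ :=
  ∫ q : TimeI T × TimeI T, D q * (φ q.1 * ψ q.2) ∂(volume.prod volume)

/-- The class `Σ_{η,p}` of test functionals, `P` being Wiener measure: `F` is 1-Lipschitz on
`W_{η,p}`, belongs to `𝔻_{2,2}`, and (a version of) its second gradient satisfies
`|⟨∇²F(x) - ∇²F(x+g), h ⊗ k⟩| ≤ ‖g‖_{W_{η,p}} ‖h‖_{L²} ‖k‖_{L²}`. The values of `F` off `W_{η,p}`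
play no role. The last inequality is required on the dense subspace `I_{1,2}` of `L²`,
from which it extends by continuity. -/
def SigmaClass (T η p : ℝ) (P : Measure (Path T)) : Set (Path T → ℝ) :=
  {F | (∀ x ∈ sobSpace T η p, ∀ y ∈ sobSpace T η p,
          ENNReal.ofReal |F x - F y| ≤ sobNorm η p (x - y)) ∧
    ∃ (D1 : Path T → TimeI T → ℝ) (D2 : Path T → TimeI T × TimeI T → ℝ),
      IsGrossSobolev P F D1 D2 ∧
      (∀ x ∈ sobSpace T η p, MemLp (D2 x) 2 (volume.prod volume)) ∧
      ∀ x ∈ sobSpace T η p, ∀ g ∈ sobSpace T η p, g ∈ cameronMartin T →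
        ∀ φ ψ : TimeI T → ℝ, MemLp φ 2 volume → MemLp ψ 2 volume →
          ENNReal.ofReal |pairing (D2 x - D2 (x + g)) φ ψ| ≤
            sobNorm η p g * eLpNorm (prim φ) 2 volume * eLpNorm (prim ψ) 2 volume}

/-! ### The functions `h_i^n` -/

/-- `h_i^n(t) = √(n/T) ∫_0^t 1_{[iT/n, (i+1)T/n)}(r) dr`, for `0 ≤ i ≤ n - 1`. -/
def hFun (T : ℝ) (n i : ℕ) : Path T where
  toFun t := √(n / T) *
    ∫ r in (0 : ℝ)..t, (Set.Ico (i * T / n) ((i + 1) * T / n)).indicator (fun _ => (1 : ℝ)) r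
  continuous_toFun := by
    refine continuous_const.mul (Continuous.comp (g := fun b : ℝ => ∫ r in (0 : ℝ)..b,
      (Set.Ico (i * T / n) ((i + 1) * T / n)).indicator (fun _ => (1 : ℝ)) r) ?_
      continuous_subtype_val)
    refine intervalIntegral.continuous_primitive (fun a b => ?_) 0
    exact intervalIntegrable_const.mono_fun
      ((measurable_const.indicator measurableSet_Ico).aestronglyMeasurable)
      (Eventually.of_forall fun r => norm_indicator_le_norm_self (fun _ => (1 : ℝ)) r)

/-- The path `∑_j y_j h_j^n`. -/
def comb (T : ℝ) {n : ℕ} (y : Fin n → ℝ) : Path T := ∑ j, y j • hFun T n j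

/-! ### Poisson random measures -/

/-- `N` is a Poisson point process (random measure) of control measure `ν` under `Pr`:
`E exp(-∫ ψ dN) = exp(-∫ (1 - e^{-ψ}) dν)` for each measurable `ψ ≥ 0`. -/
structure IsPoissonProcess {Ω E : Type*} [MeasurableSpace Ω] [MeasurableSpace E]
    (N : Ω → Measure E) (ν : Measure E) (Pr : Measure Ω) : Prop where
  measurable : Measurable N
  laplace : ∀ ψ : E → ℝ≥0∞, Measurable ψ →
    ∫⁻ ω, EReal.exp (-((∫⁻ x, ψ x ∂(N ω) : ℝ≥0∞) : EReal)) ∂Pr =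
      EReal.exp (-((∫⁻ x, (1 - EReal.exp (-(ψ x : EReal))) ∂ν : ℝ≥0∞) : EReal))

/-- `Z` is the compensated Poisson integral `δ_ν v = ∫ v (dN - dν)` of the deterministic function
`v ∈ L²(ν)`: the `L²(Pr)` limit of `∫ w_m dN - ∫ w_m dν` for `w_m` in `L¹(ν) ∩ L²(ν)`
that converge to `v` in `L²(ν)`. -/
def IsCompensatedIntegral {Ω E : Type*} [MeasurableSpace Ω] [MeasurableSpace E]
    (N : Ω → Measure E) (ν : Measure E) (Pr : Measure Ω) (v : E → ℝ) (Z : Ω → ℝ) : Prop :=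
  MemLp v 2 ν ∧ MemLp Z 2 Pr ∧ ∃ w : ℕ → E → ℝ,
    (∀ m, MemLp (w m) 1 ν ∧ MemLp (w m) 2 ν) ∧
    Tendsto (fun m => eLpNorm (fun x => w m x - v x) 2 ν) atTop (𝓝 0) ∧
    Tendsto (fun m => eLpNorm (fun ω => (∫ x, w m x ∂(N ω) - ∫ x, w m x ∂ν) - Z ω) 2 Pr)
      atTop (𝓝 0)

end DiffusiveStein

end

noncomputable section

open MeasureTheory ProbabilityTheory Filter Topology
open scoped ENNReal NNReal SchwartzMap

namespace DiffusiveStein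

/-! ### The fractional Sobolev norm as an `L^p` norm -/

section SobNorm

variable {T : ℝ}

/-! Everything reduces to a comparison in `ℝⁿ`. Put `G y = F (comb T y)`. The vectors `Y` and `δu`
are centred with the same diagonal covariance, with entries `ξ_k²`, and two properties of `G`
suffice: a Lipschitz bound for the `ℓ¹` norm, and a bound `|delta3 G| ≤ C |s| |t| ∑ |g_j|` on third
differences along coordinate directions. The order of `C` is that of one Sobolev norm `‖h_j^n‖ ≤ 3
max(1,T) n^{-1/2+η}` (`sobNorm_hFun_le`) times two `L²` norms, each at most `T/√n`
(`eLpNorm_comb_single_le`).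

The third difference bound is the delicate point: the second gradient of `F` is known only as an
`L²` limit along cylindrical functionals, hence almost surely, while the paths `comb T y` form a
null set of Wiener measure. For a cylindrical functional, a third difference is an average of
increments of the second derivative. By Cameron-Martin, a shift by `comb T y` turns closeness in
`L²` into closeness in `L¹` (`IsWienerMeasure.lintegral_comp_add_le`), so Fatou's lemma yields the
bound for `F` at almost every path (`ae_enorm_delta3_le`). Wiener measure charges every Sobolev ball
around `0` (`IsWienerMeasure.measure_sobNorm_lt_pos`), so the bound holds at `x + comb T y` for
arbitrarily small `x`, and the Lipschitz property of `F` removes `x` (`ofReal_abs_delta3_comb_le`).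
Convolution then replaces `G` by a smooth `H` with the same bounds (`exists_smooth_approx`), for
which the second partial derivatives are Lipschitz (`abs_pd_pd_sub_le`).

For such `H` one interpolates along `sin α • δu + cos α • Y`. Gaussian integration by parts is
exact. On the Poisson side the identity `E δ_k K(δ) = ∫ u_k E[K(δ + u) - K(δ)] dν`
(`IsPoissonProcess.stein`) is expanded to first order: the main term involves `∫ u_k u_l dν`, which
orthogonality reduces to `ξ_k²`, and cancels the Gaussian term. The Taylor remainder contributes at
most `1/2 C sin² α cos α ∑_k ∫ |u_k| (∑_l |u_l|)² dν`. Its integral over `[0, π/2]` has the factor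
`1/6`, which with the `3` of the Sobolev norm gives the constant `1/2`.

The Stein identity is a form of Mecke's formula. It is obtained from the Laplace functional by
differentiation (`IsPoissonProcess.mecke_expNeg`), extended to bounded functions of finitely many
integrals by uniqueness of Laplace transforms (`IsPoissonProcess.mecke_map`), then to signed
integrands, and finally to `L²` integrands by approximation. -/

/-- The singular kernel `|t - s|^{-(1 + p η)}`. -/
def sobKernel (T η p : ℝ) (q : TimeI T × TimeI T) : ℝ≥0∞ :=
  ENNReal.ofReal (1 / |(q.1 : ℝ) - (q.2 : ℝ)| ^ (1 + p * η))

/-- The measure for which `sobNorm` is an `L^p` norm. -/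
def sobMeasure (T η p : ℝ) : Measure (Bool × TimeI T × TimeI T) :=
  (volume : Measure (TimeI T)).map (fun t => (false, t, t)) +
    (((volume : Measure (TimeI T)).prod volume).withDensity (sobKernel T η p)).map
      (fun q => (true, q))

instance (T η p : ℝ) : SFinite (sobMeasure T η p) := by
  unfold sobMeasure
  have h := Measure.withDensity.instSFinite (μ := (volume : Measure (TimeI T)).prod volume)
    (f := sobKernel T η p)
  infer_instance

/-- The function and its increments. -/
def sobLift (f : Path T) (z : Bool × TimeI T × TimeI T) : ℝ :=
  if z.1 then f z.2.1 - f z.2.2 else f z.2.1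

lemma sobLift_add (f g : Path T) : sobLift (f + g) = sobLift f + sobLift g := by
  ext z; simp only [sobLift, Pi.add_apply, ContinuousMap.add_apply]; split_ifs <;> ring

lemma sobLift_sub (f g : Path T) : sobLift (f - g) = sobLift f - sobLift g := by
  ext z; simp only [sobLift, Pi.sub_apply, ContinuousMap.sub_apply]; split_ifs <;> ring

lemma sobLift_smul (c : ℝ) (f : Path T) : sobLift (c • f) = c • sobLift f := by
  ext z; simp only [sobLift, Pi.smul_apply, ContinuousMap.smul_apply, smul_eq_mul]
  split_ifs <;> ring

lemma measurable_sobLift (f : Path T) : Measurable (sobLift f) := by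
  unfold sobLift
  refine Measurable.ite (measurable_fst (measurableSet_singleton true)) ?_ ?_ <;>
  · have := f.continuous.measurable
    fun_prop

lemma measurable_sobKernel (T η p : ℝ) : Measurable (sobKernel T η p) := by
  unfold sobKernel
  fun_prop

/-- The function and its increments are placed on two disjoint pieces of one measure space, so that
the triangle inequality, homogeneity and separability are inherited from `L^p`. -/
lemma sobNorm_eq_eLpNorm {η p : ℝ} (hp : 1 ≤ p) (f : Path T) :
    sobNorm η p f = eLpNorm (sobLift f) (ENNReal.ofReal p) (sobMeasure T η p) := by
  have hp0 : 0 < p := by linarith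
  have hm := measurable_sobLift f
  have hk := measurable_sobKernel T η p
  rw [eLpNorm_eq_lintegral_rpow_enorm_toReal (by simpa using hp0) ENNReal.ofReal_ne_top,
    ENNReal.toReal_ofReal hp0.le, sobMeasure, lintegral_add_measure,
    lintegral_map (by fun_prop) (by fun_prop), lintegral_map (by fun_prop) (by fun_prop),
    lintegral_withDensity_eq_lintegral_mul _ hk (by fun_prop)]
  rw [lintegral_prod _ (by fun_prop), sobNorm]
  congr 2
  · refine lintegral_congr fun t => ?_
    simp [sobLift, Real.enorm_eq_ofReal_abs, ENNReal.ofReal_rpow_of_nonneg, hp0.le]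
  · refine lintegral_congr fun t => lintegral_congr fun s => ?_
    simp only [sobLift, Real.enorm_eq_ofReal_abs, Pi.mul_apply, sobKernel, if_true]
    rw [ENNReal.ofReal_rpow_of_nonneg (abs_nonneg _) hp0.le, ← ENNReal.ofReal_mul (by positivity)]
    congr 1; ring

variable {η p : ℝ}

lemma sobNorm_add_le (hp : 1 ≤ p) (f g : Path T) :
    sobNorm η p (f + g) ≤ sobNorm η p f + sobNorm η p g := by
  simp only [sobNorm_eq_eLpNorm hp, sobLift_add]
  exact eLpNorm_add_le (measurable_sobLift f).aestronglyMeasurable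
    (measurable_sobLift g).aestronglyMeasurable (by simpa using ENNReal.ofReal_le_ofReal hp)

lemma sobNorm_smul (hp : 1 ≤ p) (c : ℝ) (f : Path T) :
    sobNorm η p (c • f) = ENNReal.ofReal |c| * sobNorm η p f := by
  simp only [sobNorm_eq_eLpNorm hp, sobLift_smul, eLpNorm_const_smul, Real.enorm_eq_ofReal_abs]

lemma sobNorm_zero (hp : 1 ≤ p) : sobNorm η p (0 : Path T) = 0 := by
  have := sobNorm_smul (η := η) hp 0 (0 : Path T)
  simpa using this

lemma sobNorm_sum_le (hp : 1 ≤ p) {ι : Type*} (s : Finset ι) (f : ι → Path T) :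
    sobNorm η p (∑ i ∈ s, f i) ≤ ∑ i ∈ s, sobNorm η p (f i) := by
  classical
  induction s using Finset.induction_on with
  | empty => simp [sobNorm_zero hp]
  | insert a s ha ih =>
    rw [Finset.sum_insert ha, Finset.sum_insert ha]
    exact (sobNorm_add_le hp _ _).trans (by gcongr)

lemma sobNorm_neg (hp : 1 ≤ p) (f : Path T) : sobNorm η p (-f) = sobNorm η p f := by
  rw [← neg_one_smul ℝ f, sobNorm_smul hp]; simp

lemma add_mem_sobSpace (hp : 1 ≤ p) {f g : Path T} (hf : f ∈ sobSpace T η p)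
    (hg : g ∈ sobSpace T η p) : f + g ∈ sobSpace T η p :=
  (sobNorm_add_le hp f g).trans_lt (ENNReal.add_lt_top.2 ⟨hf, hg⟩)

lemma smul_mem_sobSpace (hp : 1 ≤ p) {f : Path T} (c : ℝ) (hf : f ∈ sobSpace T η p) :
    c • f ∈ sobSpace T η p := by
  show sobNorm η p (c • f) < ∞
  rw [sobNorm_smul hp]
  exact ENNReal.mul_lt_top ENNReal.ofReal_lt_top hf

lemma sum_mem_sobSpace (hp : 1 ≤ p) {ι : Type*} (s : Finset ι) (f : ι → Path T)
    (hf : ∀ i ∈ s, f i ∈ sobSpace T η p) : ∑ i ∈ s, f i ∈ sobSpace T η p :=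
  (sobNorm_sum_le hp s f).trans_lt (ENNReal.sum_lt_top.2 hf)

/-- The space `W_{η,p}` is separable. -/
lemma exists_countable_cover_sobSpace (hp : 1 ≤ p) {ε : ℝ≥0∞} (hε : 0 < ε) :
    ∃ D : Set (Path T), D.Countable ∧ ∀ f ∈ sobSpace T η p, ∃ g ∈ D, sobNorm η p (f - g) < ε := by
  have : Fact (1 ≤ ENNReal.ofReal p) := ⟨by simpa using ENNReal.ofReal_le_ofReal hp⟩
  have : Fact (ENNReal.ofReal p ≠ ∞) := ⟨ENNReal.ofReal_ne_top⟩
  have hmem : ∀ f : sobSpace T η p, MemLp (sobLift f.1) (ENNReal.ofReal p) (sobMeasure T η p) :=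
    fun f => ⟨(measurable_sobLift _).aestronglyMeasurable, by
      rw [← sobNorm_eq_eLpNorm hp]; exact f.2⟩
  let ι : sobSpace T η p → Lp ℝ (ENNReal.ofReal p) (sobMeasure T η p) := fun f => (hmem f).toLp _
  -- Density is taken inside the range of `ι`, so that every centre is the lift of an actual path.
  obtain ⟨D, hD, hd⟩ := TopologicalSpace.exists_countable_dense (α := Set.range ι)
  let pre : Set.range ι → Path T := fun y => (Classical.choose y.2).1
  have hpre : ∀ y : Set.range ι, ι (Classical.choose y.2) = y.1 := fun y => Classical.choose_spec y.2
  refine ⟨pre '' D, hD.image _, fun f hf => ?_⟩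
  obtain ⟨y, hyD, hy⟩ := EMetric.mem_closure_iff.1 (hd ⟨ι ⟨f, hf⟩, Set.mem_range_self _⟩) ε hε
  refine ⟨pre y, ⟨y, hyD, rfl⟩, ?_⟩
  rw [Subtype.edist_eq, ← hpre y, Lp.edist_toLp_toLp] at hy
  rwa [sobNorm_eq_eLpNorm hp, sobLift_sub]

/-- Evaluation is jointly continuous in path and time, so the integrands are jointly measurable and
Tonelli applies. -/
lemma measurable_sobNorm : Measurable (sobNorm η p : Path T → ℝ≥0∞) := by
  have h1 : Measurable fun z : Path T × TimeI T => z.1 z.2 :=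
    (continuous_eval (F := Path T)).measurable
  have h2 : Measurable fun z : (Path T × TimeI T) × TimeI T => z.1.1 z.1.2 :=
    h1.comp measurable_fst
  have h3 : Measurable fun z : (Path T × TimeI T) × TimeI T => z.1.1 z.2 :=
    h1.comp ((measurable_fst.comp measurable_fst).prodMk measurable_snd)
  unfold sobNorm
  refine Measurable.pow_const (Measurable.add ?_ ?_) _
  · refine Measurable.lintegral_prod_right' (f := fun z : Path T × TimeI T =>
      ENNReal.ofReal (|z.1 z.2| ^ p)) ?_
    fun_prop
  · refine Measurable.lintegral_prod_right' (f := fun z : Path T × TimeI T =>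
      ∫⁻ s : TimeI T, ENNReal.ofReal
        (|z.1 z.2 - z.1 s| ^ p / |(z.2 : ℝ) - (s : ℝ)| ^ (1 + p * η))) ?_
    refine Measurable.lintegral_prod_right' (f := fun z : (Path T × TimeI T) × TimeI T =>
      ENNReal.ofReal
        (|z.1.1 z.1.2 - z.1.1 z.2| ^ p / |(z.1.2 : ℝ) - (z.2 : ℝ)| ^ (1 + p * η))) ?_
    fun_prop

lemma measurableSet_sobSpace : MeasurableSet (sobSpace T η p) :=
  measurableSet_lt measurable_sobNorm measurable_const

end SobNorm

/-! ### Sobolev norms of the functions `h_i^n`. -/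

section HFun

variable {T : ℝ}

lemma lintegral_comp_abs_eq (φ : ℝ → ℝ≥0∞) (hφ : Measurable φ) :
    ∫⁻ r : ℝ, φ |r| = 2 * ∫⁻ r in Set.Ioi (0 : ℝ), φ r := by
  have h1 : ∫⁻ r in Set.Ioi (0 : ℝ), φ |r| = ∫⁻ r in Set.Ioi (0 : ℝ), φ r :=
    setLIntegral_congr_fun measurableSet_Ioi fun r hr => by
      simp only [abs_of_pos (Set.mem_Ioi.1 hr)]
  have h2 : ∫⁻ r in Set.Iic (0 : ℝ), φ |r| = ∫⁻ r in Set.Ioi (0 : ℝ), φ |r| := by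
    have h := (Measure.measurePreserving_neg (volume : Measure ℝ)).setLIntegral_comp_preimage
      (s := Set.Iio 0) measurableSet_Iio (f := fun r => φ |r|) (by fun_prop)
    simp only [abs_neg] at h
    rw [← Measure.restrict_congr_set (Iio_ae_eq_Iic (a := (0 : ℝ)) (μ := volume)), ← h]
    congr 2
    ext r; simp
  rw [← lintegral_add_compl _ (measurableSet_Ioi (a := (0 : ℝ))), Set.compl_Ioi, h2, h1, two_mul]

/-- Extending the integral in `s` to the whole line makes the bound independent of `t`; the factor
`2` counts the two sides of `t`. -/
lemma lintegral_timeI_le (φ : ℝ → ℝ≥0∞) (hφ : Measurable φ) (t : TimeI T) :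
    ∫⁻ s : TimeI T, φ |(t : ℝ) - s| ≤ 2 * ∫⁻ r in Set.Ioi (0 : ℝ), φ r := by
  have h1 : ∫⁻ s : TimeI T, φ |(t : ℝ) - s| = ∫⁻ s in Set.Icc 0 T, φ |(t : ℝ) - s| :=
    lintegral_subtype_comap measurableSet_Icc (fun s : ℝ => φ |(t : ℝ) - s|)
  rw [h1, ← lintegral_comp_abs_eq φ hφ, ← lintegral_sub_left_eq_self (fun r => φ |r|) (t : ℝ)]
  exact setLIntegral_le_lintegral _ _

lemma volume_timeI_univ : (volume : Measure (TimeI T)) Set.univ = ENNReal.ofReal T := by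
  have h := Measure.Subtype.volume_univ
    (nullMeasurableSet_Icc (a := (0 : ℝ)) (b := T) (μ := volume))
  rw [h, Real.volume_Icc, sub_zero]

lemma hFun_sub_eq (n i : ℕ) (s t : TimeI T) :
    hFun T n i t - hFun T n i s = √(n / T) *
      ∫ r in (s : ℝ)..t, (Set.Ico (i * T / n) ((i + 1) * T / n)).indicator (fun _ => (1 : ℝ)) r := by
  have hint : ∀ a b : ℝ, IntervalIntegrable
      ((Set.Ico (i * T / n) ((i + 1) * T / n)).indicator (fun _ => (1 : ℝ))) volume a b :=
    fun a b => intervalIntegrable_const.mono_fun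
      ((measurable_const.indicator measurableSet_Ico).aestronglyMeasurable)
      (Eventually.of_forall fun r => norm_indicator_le_norm_self (fun _ => (1 : ℝ)) r)
  simp only [hFun, ContinuousMap.coe_mk]
  rw [← mul_sub, intervalIntegral.integral_interval_sub_left (hint _ _) (hint _ _)]

/-- The slope is at most `√(n/T)` and lives on an interval of length `T/n`, so the total rise is
`√(n/T) · T/n = √(T/n)`. The two bounds meet at distance `T/n`. -/
lemma abs_hFun_sub_le {n : ℕ} (hT : 0 < T) (hn : 0 < n) (i : ℕ) (s t : TimeI T) :
    |hFun T n i t - hFun T n i s| ≤ min (√(n / T) * |(t : ℝ) - s|) (√(T / n)) := by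
  have hn' : (0 : ℝ) < n := by exact_mod_cast hn
  set A := Set.Ico (i * T / (n : ℝ)) ((i + 1) * T / n)
  have hbound : ∀ r, ‖A.indicator (fun _ => (1 : ℝ)) r‖ ≤ 1 := fun r =>
    (norm_indicator_le_norm_self (fun _ => (1 : ℝ)) r).trans (by simp)
  rw [hFun_sub_eq, abs_mul, abs_of_nonneg (Real.sqrt_nonneg _)]
  refine le_min ?_ ?_
  · refine mul_le_mul_of_nonneg_left ?_ (Real.sqrt_nonneg _)
    simpa using intervalIntegral.norm_integral_le_of_norm_le_const
      (a := (s : ℝ)) (b := t) (f := A.indicator (fun _ => (1 : ℝ))) (C := 1) (fun r _ => hbound r)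
  · have h1 : |∫ r in (s : ℝ)..t, A.indicator (fun _ => (1 : ℝ)) r| ≤ T / n := by
      have hintA : Integrable (A.indicator (fun _ => (1 : ℝ))) volume :=
        (integrable_indicator_iff measurableSet_Ico).2 (by
          simp [Real.volume_Ico])
      rw [← Real.norm_eq_abs]
      refine (intervalIntegral.norm_integral_le_integral_norm_uIoc).trans ?_
      refine (setIntegral_le_integral hintA.norm (ae_of_all _ fun _ => norm_nonneg _)).trans ?_
      have : (fun r => ‖A.indicator (fun _ => (1 : ℝ)) r‖) = A.indicator (fun _ => (1 : ℝ)) := by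
        ext r; rw [norm_indicator_eq_indicator_norm]; simp
      rw [this, integral_indicator_const _ measurableSet_Ico, Measure.real, Real.volume_Ico,
        ENNReal.toReal_ofReal (by rw [← sub_div]; apply div_nonneg _ hn'.le; nlinarith)]
      rw [smul_eq_mul, mul_one, ← sub_div]; apply le_of_eq; ring
    have h2 : √(n / T) * (T / n) = √(T / n) := by
      have : √(n / T) = (√(T / n))⁻¹ := by rw [← Real.sqrt_inv, inv_div]
      rw [this]
      nth_rewrite 2 [← Real.mul_self_sqrt (show 0 ≤ T / n by positivity)]
      have : √(T / n) ≠ 0 := (Real.sqrt_pos.2 (by positivity)).ne'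
      field_simp
    rw [← h2]
    gcongr

lemma hFun_zero (n i : ℕ) {t : TimeI T} (ht : (t : ℝ) = 0) : hFun T n i t = 0 := by
  simp [hFun, ht]

lemma abs_hFun_le {n : ℕ} (hT : 0 < T) (hn : 0 < n) (i : ℕ) (t : TimeI T) :
    |hFun T n i t| ≤ √(T / n) := by
  have h := (abs_hFun_sub_le hT hn i ⟨0, le_refl 0, hT.le⟩ t).trans (min_le_right _ _)
  rwa [hFun_zero n i (t := ⟨0, le_refl 0, hT.le⟩) rfl, sub_zero] at h

lemma lintegral_Ioc_rpow_le {δ a : ℝ} (hδ : 0 < δ) (ha : 0 < a) :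
    ∫⁻ r in Set.Ioc 0 δ, ENNReal.ofReal (r ^ (a - 1)) = ENNReal.ofReal (δ ^ a / a) := by
  have hi : IntervalIntegrable (fun r : ℝ => r ^ (a - 1)) volume 0 δ :=
    intervalIntegral.intervalIntegrable_rpow' (by linarith)
  rw [intervalIntegrable_iff_integrableOn_Ioc_of_le hδ.le] at hi
  rw [← ofReal_integral_eq_lintegral_ofReal hi ((ae_restrict_iff' measurableSet_Ioc).2
    (ae_of_all _ fun r hr => Real.rpow_nonneg hr.1.le _)),
    ← intervalIntegral.integral_of_le hδ.le, integral_rpow (Or.inl (by linarith))]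
  congr 1
  rw [sub_add_cancel, Real.zero_rpow ha.ne', sub_zero]

lemma lintegral_Ioi_rpow_le {δ a : ℝ} (hδ : 0 < δ) (ha : 0 < a) :
    ∫⁻ r in Set.Ioi δ, ENNReal.ofReal (r ^ (-(1 + a))) = ENNReal.ofReal (δ ^ (-a) / a) := by
  have hi : IntegrableOn (fun r : ℝ => r ^ (-(1 + a))) (Set.Ioi δ) :=
    integrableOn_Ioi_rpow_of_lt (by linarith) hδ
  rw [← ofReal_integral_eq_lintegral_ofReal hi ((ae_restrict_iff' measurableSet_Ioi).2
    (ae_of_all _ fun r hr => Real.rpow_nonneg (hδ.le.trans (le_of_lt hr)) _)),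
    integral_Ioi_rpow_of_lt (by linarith) hδ]
  congr 1
  rw [show -(1 + a) + 1 = -a by ring, neg_div_neg_eq]

/-- The Sobolev norm of a bounded Lipschitz path. -/
lemma sobNorm_rpow_le_of_abs_sub_le {η p δ : ℝ} (hp : 1 ≤ p) (hηp : 1 / p < η)
    (hη : η < 1 / 2) (hδ : 0 < δ) (f : Path T) (h0 : ∀ t, |f t| ≤ δ ^ (1 / 2 : ℝ))
    (h1 : ∀ s t : TimeI T, |f t - f s| ≤ δ ^ (1 / 2 : ℝ))
    (h2 : ∀ s t : TimeI T, |f t - f s| ≤ δ ^ (-(1 / 2) : ℝ) * |(t : ℝ) - s|) :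
    sobNorm η p f ^ p ≤ ENNReal.ofReal T *
      ENNReal.ofReal (δ ^ (p / 2) + 4 * δ ^ (p / 2 - p * η)) := by
  have hp0 : 0 < p := by linarith
  have hpη : 1 < p * η := by rwa [div_lt_iff₀' hp0] at hηp
  have hpη' : p * η < p / 2 := by nlinarith
  rw [sobNorm, ← ENNReal.rpow_mul, one_div, inv_mul_cancel₀ hp0.ne', ENNReal.rpow_one,
    ENNReal.ofReal_add (by positivity) (by positivity), mul_add]
  have hpow : (δ ^ (1 / 2 : ℝ)) ^ p = δ ^ (p / 2) := by
    rw [← Real.rpow_mul hδ.le]; congr 1; ring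
  have hpow' : (δ ^ (-(1 / 2) : ℝ)) ^ p = δ ^ (-(p / 2)) := by
    rw [← Real.rpow_mul hδ.le]; congr 1; ring
  gcongr
  · calc ∫⁻ t : TimeI T, ENNReal.ofReal (|f t| ^ p)
        ≤ ∫⁻ t : TimeI T, ENNReal.ofReal (δ ^ (p / 2)) := by
          refine lintegral_mono fun t => ENNReal.ofReal_le_ofReal ?_
          rw [← hpow]
          exact Real.rpow_le_rpow (abs_nonneg _) (h0 t) hp0.le
      _ = _ := by rw [lintegral_const, volume_timeI_univ, mul_comm]
  -- The majorant depends on the distance `r = |t - s|` only. For `r ≤ δ` the Lipschitz bound leaves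
  -- `r^{p - pη - 1}`, integrable at `0`; for `r > δ` the uniform bound leaves `r^{-(1 + pη)}`,
  -- integrable at infinity.
  · set φ : ℝ → ℝ≥0∞ := fun r =>
      (Set.Ioc 0 δ).indicator (fun r => ENNReal.ofReal (δ ^ (-(p / 2))) *
        ENNReal.ofReal (r ^ ((p - p * η) - 1))) r +
      (Set.Ioi δ).indicator (fun r => ENNReal.ofReal (δ ^ (p / 2)) *
        ENNReal.ofReal (r ^ (-(1 + p * η)))) r with hφ
    have hφm : Measurable φ := by
      refine Measurable.add (Measurable.indicator ?_ measurableSet_Ioc)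
        (Measurable.indicator ?_ measurableSet_Ioi) <;> fun_prop
    have hle : ∀ t s : TimeI T,
        ENNReal.ofReal (|f t - f s| ^ p / |(t : ℝ) - (s : ℝ)| ^ (1 + p * η)) ≤
          φ |(t : ℝ) - s| := by
      intro t s
      rcases (abs_nonneg ((t : ℝ) - s)).eq_or_lt with h | h
      · have : t = s := Subtype.ext (sub_eq_zero.1 (abs_eq_zero.1 h.symm))
        subst this
        simp [Real.zero_rpow hp0.ne']
      · set r := |(t : ℝ) - s| with hr
        by_cases hrδ : r ≤ δ
        · have hmem : r ∈ Set.Ioc 0 δ := ⟨h, hrδ⟩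
          refine le_trans ?_ (le_add_right le_rfl)
          rw [Set.indicator_of_mem hmem, ← ENNReal.ofReal_mul (by positivity)]
          refine ENNReal.ofReal_le_ofReal ?_
          rw [div_le_iff₀ (by positivity), mul_assoc, ← Real.rpow_add h,
            show p - p * η - 1 + (1 + p * η) = p by ring, ← hpow',
            ← Real.mul_rpow (by positivity) h.le]
          exact Real.rpow_le_rpow (abs_nonneg _) (h2 s t) hp0.le
        · have hmem : r ∈ Set.Ioi δ := not_le.1 hrδ
          refine le_trans ?_ (le_add_left le_rfl)
          rw [Set.indicator_of_mem hmem, ← ENNReal.ofReal_mul (by positivity)]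
          refine ENNReal.ofReal_le_ofReal ?_
          rw [div_le_iff₀ (by positivity), mul_assoc, ← Real.rpow_add h, neg_add_cancel,
            Real.rpow_zero, mul_one, ← hpow]
          exact Real.rpow_le_rpow (abs_nonneg _) (h1 s t) hp0.le
    have hφint : ∫⁻ r in Set.Ioi (0 : ℝ), φ r ≤ ENNReal.ofReal (2 * δ ^ (p / 2 - p * η)) := by
      calc ∫⁻ r in Set.Ioi (0 : ℝ), φ r ≤ ∫⁻ r, φ r := setLIntegral_le_lintegral _ _
        _ = ENNReal.ofReal (δ ^ (-(p / 2)) * (δ ^ (p - p * η) / (p - p * η))) +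
            ENNReal.ofReal (δ ^ (p / 2) * (δ ^ (-(p * η)) / (p * η))) := by
          rw [hφ, lintegral_add_left (Measurable.indicator (by fun_prop) measurableSet_Ioc),
            lintegral_indicator measurableSet_Ioc, lintegral_indicator measurableSet_Ioi,
            lintegral_const_mul _ (by fun_prop), lintegral_const_mul _ (by fun_prop),
            lintegral_Ioc_rpow_le hδ (by linarith), lintegral_Ioi_rpow_le hδ (by linarith),
            ENNReal.ofReal_mul (by positivity), ENNReal.ofReal_mul (by positivity)]
        _ ≤ _ := by
          have hq : 0 < p - p * η := by linarith
          rw [← ENNReal.ofReal_add (by positivity) (by positivity)]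
          refine ENNReal.ofReal_le_ofReal ?_
          rw [← mul_div_assoc, ← mul_div_assoc, ← Real.rpow_add hδ, ← Real.rpow_add hδ, two_mul,
            show -(p / 2) + (p - p * η) = p / 2 - p * η by ring,
            show p / 2 + -(p * η) = p / 2 - p * η by ring]
          -- Both denominators `p - pη` and `pη` exceed `1`, because `1 < pη < p/2`.
          gcongr <;> exact div_le_self (by positivity) (by linarith)
    calc _ ≤ ∫⁻ t : TimeI T, ∫⁻ s : TimeI T, φ |(t : ℝ) - s| :=
          lintegral_mono fun t => lintegral_mono fun s => hle t s
      _ ≤ ∫⁻ t : TimeI T, ENNReal.ofReal (4 * δ ^ (p / 2 - p * η)) := by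
          refine lintegral_mono fun t => (lintegral_timeI_le φ hφm t).trans ?_
          rw [show (4 : ℝ) * δ ^ (p / 2 - p * η) = 2 * (2 * δ ^ (p / 2 - p * η)) by ring,
            ENNReal.ofReal_mul zero_le_two]
          gcongr
          simp
      _ = _ := by rw [lintegral_const, volume_timeI_univ, mul_comm]

/-- `‖h_i^n‖_{η,p} ≤ 3 max(1,T) n^{-1/2+η}`. -/
lemma sobNorm_hFun_le {η p : ℝ} (hT : 0 < T) (hp : 1 ≤ p) (hηp : 1 / p < η)
    (hη : η < 1 / 2) {n : ℕ} (hn : 0 < n) (i : ℕ) :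
    sobNorm η p (hFun T n i) ≤ ENNReal.ofReal (3 * max 1 T * (n : ℝ) ^ (-(1 / 2 : ℝ) + η)) := by
  have hn' : (0 : ℝ) < n := by exact_mod_cast hn
  have hn1 : (1 : ℝ) ≤ n := by exact_mod_cast hn
  have hp0 : 0 < p := by linarith
  have hpη : 1 < p * η := by rwa [div_lt_iff₀' hp0] at hηp
  have hpη' : p * η < p / 2 := by nlinarith
  have hδ : 0 < T / n := by positivity
  have key := sobNorm_rpow_le_of_abs_sub_le hp hηp hη hδ (hFun T n i)
    (fun t => by rw [← Real.sqrt_eq_rpow]; exact abs_hFun_le hT hn i t)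
    (fun s t => by
      rw [← Real.sqrt_eq_rpow]; exact (abs_hFun_sub_le hT hn i s t).trans (min_le_right _ _))
    (fun s t => by
      rw [Real.rpow_neg hδ.le, ← Real.sqrt_eq_rpow, ← Real.sqrt_inv, inv_div]
      exact (abs_hFun_sub_le hT hn i s t).trans (min_le_left _ _))
  set m := max 1 T with hm
  have hm1 : 1 ≤ m := le_max_left _ _
  have hTm : T ≤ m := le_max_right _ _
  have hfin : ENNReal.ofReal T * ENNReal.ofReal ((T / n) ^ (p / 2) +
      4 * (T / n) ^ (p / 2 - p * η)) ≤
      ENNReal.ofReal (3 * m * (n : ℝ) ^ (-(1 / 2 : ℝ) + η)) ^ p := by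
    rw [← ENNReal.ofReal_mul hT.le, ENNReal.ofReal_rpow_of_nonneg (by positivity) hp0.le]
    refine ENNReal.ofReal_le_ofReal ?_
    have hN : ((n : ℝ) ^ (-(1 / 2 : ℝ) + η)) ^ p = (n : ℝ) ^ (-(p / 2) + p * η) := by
      rw [← Real.rpow_mul hn'.le]; congr 1; ring
    rw [Real.mul_rpow (by positivity) (by positivity), Real.mul_rpow (by positivity) (by positivity),
      hN]
    -- The power of `T` is `1 + a ≤ p`, which holds as `a ≤ p/2` and `p > 2`; the latter follows
    -- from `1/p < η < 1/2`.
    have hmain : ∀ a : ℝ, 0 ≤ a → a ≤ p / 2 → p / 2 - p * η ≤ a →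
        T * (T / n) ^ a ≤ m ^ p * (n : ℝ) ^ (-(p / 2) + p * η) := by
      intro a ha ha2 ha3
      rw [Real.div_rpow hT.le hn'.le, div_eq_mul_inv, ← Real.rpow_neg hn'.le, ← mul_assoc]
      refine mul_le_mul ?_ (Real.rpow_le_rpow_of_exponent_le hn1 (by linarith)) (by positivity)
        (by positivity)
      calc T * T ^ a ≤ m * m ^ a := by gcongr
        _ = m ^ (1 + a) := by rw [Real.rpow_add (by positivity), Real.rpow_one]
        _ ≤ m ^ p := Real.rpow_le_rpow_of_exponent_le hm1 (by linarith)
    -- This fixes the constant `3`: the two terms have total weight `1 + 4 = 5`, and `5 ≤ 3² ≤ 3^p`.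
    have h9 : (5 : ℝ) ≤ 3 ^ p := by
      calc (5 : ℝ) ≤ 3 ^ (2 : ℝ) := by norm_num
        _ ≤ 3 ^ p := Real.rpow_le_rpow_of_exponent_le (by norm_num) (by linarith)
    have e1 := hmain (p / 2) (by positivity) le_rfl (by linarith)
    have e2 := hmain (p / 2 - p * η) (by linarith) (by linarith) le_rfl
    have e3 : 0 ≤ m ^ p * (n : ℝ) ^ (-(p / 2) + p * η) := by positivity
    nlinarith
  exact (ENNReal.rpow_le_rpow_iff hp0).1 (key.trans hfin)

lemma hFun_mem_sobSpace {η p : ℝ} (hT : 0 < T) (hp : 1 ≤ p) (hηp : 1 / p < η)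
    (hη : η < 1 / 2) {n : ℕ} (hn : 0 < n) (i : ℕ) : hFun T n i ∈ sobSpace T η p :=
  (sobNorm_hFun_le hT hp hηp hη hn i).trans_lt ENNReal.ofReal_lt_top

lemma comb_mem_sobSpace {η p : ℝ} (hT : 0 < T) (hp : 1 ≤ p) (hηp : 1 / p < η)
    (hη : η < 1 / 2) {n : ℕ} (hn : 0 < n) (y : Fin n → ℝ) : comb T y ∈ sobSpace T η p :=
  sum_mem_sobSpace hp _ _ fun j _ => smul_mem_sobSpace hp _ (hFun_mem_sobSpace hT hp hηp hη hn j)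

end HFun

/-! ### Finite-dimensional functionals of a path -/

section Lin

variable {T : ℝ}

/-- The linear functional `∑ θ_t x(t)` of a path, for a finitely supported `θ`. -/
def lin (θ : TimeI T →₀ ℝ) (x : Path T) : ℝ := Finsupp.linearCombination ℝ (fun t => x t) θ

lemma lin_eq_sum (θ : TimeI T →₀ ℝ) (x : Path T) : lin θ x = ∑ t ∈ θ.support, θ t * x t := rfl

lemma lin_add (θ θ' : TimeI T →₀ ℝ) (x : Path T) : lin (θ + θ') x = lin θ x + lin θ' x :=
  map_add _ _ _

lemma lin_sub (θ θ' : TimeI T →₀ ℝ) (x : Path T) : lin (θ - θ') x = lin θ x - lin θ' x :=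
  map_sub _ _ _

lemma lin_smul (c : ℝ) (θ : TimeI T →₀ ℝ) (x : Path T) : lin (c • θ) x = c * lin θ x :=
  map_smul (Finsupp.linearCombination ℝ (fun t => x t)) _ _

lemma lin_sum {ι : Type*} (s : Finset ι) (θ : ι → TimeI T →₀ ℝ) (x : Path T) :
    lin (∑ i ∈ s, θ i) x = ∑ i ∈ s, lin (θ i) x := map_sum _ _ _

lemma lin_single (t : TimeI T) (c : ℝ) (x : Path T) : lin (Finsupp.single t c) x = c * x t := by
  simp [lin]

lemma lin_path_add (θ : TimeI T →₀ ℝ) (x y : Path T) : lin θ (x + y) = lin θ x + lin θ y := by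
  simp [lin_eq_sum, mul_add, Finset.sum_add_distrib]

lemma lin_path_sub (θ : TimeI T →₀ ℝ) (x y : Path T) : lin θ (x - y) = lin θ x - lin θ y := by
  simp [lin_eq_sum, mul_sub, Finset.sum_sub_distrib]

lemma lin_path_smul (θ : TimeI T →₀ ℝ) (c : ℝ) (x : Path T) : lin θ (c • x) = c * lin θ x := by
  simp only [lin_eq_sum, Finset.mul_sum, ContinuousMap.smul_apply, smul_eq_mul]
  exact Finset.sum_congr rfl fun t _ => by ring

lemma continuous_lin (θ : TimeI T →₀ ℝ) : Continuous (lin θ : Path T → ℝ) := by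
  simp only [funext (lin_eq_sum θ)]
  exact continuous_finsetSum _ fun t _ => continuous_const.mul (continuous_eval_const t)

@[fun_prop]
lemma measurable_lin (θ : TimeI T →₀ ℝ) : Measurable (lin θ : Path T → ℝ) :=
  (continuous_lin θ).measurable

/-- A finite measure on paths is determined by the characteristic functions of its
finite-dimensional laws. -/
lemma path_measure_ext {P Q : Measure (Path T)} [IsFiniteMeasure P] [IsFiniteMeasure Q]
    (h : ∀ θ : TimeI T →₀ ℝ, ∫ x, Complex.exp (lin θ x * Complex.I) ∂P =
      ∫ x, Complex.exp (lin θ x * Complex.I) ∂Q) : P = Q := by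
  -- With the discrete topology on the coefficients, joint continuity of the pairing reduces to
  -- continuity of each `lin θ`.
  let _ : TopologicalSpace (TimeI T →₀ ℝ) := ⊥
  have : DiscreteTopology (TimeI T →₀ ℝ) := ⟨rfl⟩
  let L : Path T →ₗ[ℝ] (TimeI T →₀ ℝ) →ₗ[ℝ] ℝ :=
    LinearMap.mk₂ ℝ (fun x θ => lin θ x) (fun x y θ => lin_path_add θ x y)
      (fun c x θ => lin_path_smul θ c x) (fun x θ θ' => lin_add θ θ' x)
      (fun c x θ => lin_smul c θ x)
  refine ext_of_integral_char_eq (L := L) (e := Real.probChar)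
    Real.continuous_probChar Real.probChar_ne_one ?_ ?_ ?_
  · intro x hx h0
    refine hx (ContinuousMap.ext fun t => ?_)
    have := congrArg (fun l => l (Finsupp.single t 1)) h0
    simpa [L, lin_single] using this
  · exact continuous_prod_of_discrete_right.2 fun θ => continuous_lin θ
  · intro θ
    simpa [BoundedContinuousFunction.char, L, Real.probChar] using h θ

end Lin

/-! ### Gaussian computations under Wiener measure -/

namespace IsWienerMeasure

variable {T : ℝ} {P : Measure (Path T)}

lemma isProb (hP : IsWienerMeasure P) : IsProbabilityMeasure P := hP.isProbabilityMeasure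

lemma hasLaw_eval (hP : IsWienerMeasure P) (hT : 0 ≤ T) (t : TimeI T) :
    HasLaw (fun x : Path T => x t) (gaussianReal 0 (Real.toNNReal t)) P := by
  have h := hP.increments_law ⟨0, le_refl 0, hT⟩ t t.2.1
  simp only [sub_zero] at h
  refine h.congr ?_
  filter_upwards [hP.start_zero ⟨0, le_refl 0, hT⟩ rfl] with x hx
  simp [hx]

lemma isGaussianProcess_eval (hP : IsWienerMeasure P) (hT : 0 ≤ T) :
    IsGaussianProcess (fun (t : TimeI T) (x : Path T) => x t) P := by
  have : Fact ((0 : ℝ) ≤ T) := ⟨hT⟩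
  exact hP.indep_increments.isGaussianProcess (fun t => (hP.hasLaw_eval hT t).hasGaussianLaw)
    (hP.start_zero _ rfl)

/-- On the union of the two supports both functionals are linear in the same Gaussian vector. Joint
Gaussianity is what later turns zero covariance into independence. -/
lemma hasGaussianLaw_lin_prodMk (hP : IsWienerMeasure P) (hT : 0 ≤ T) (θ θ' : TimeI T →₀ ℝ) :
    HasGaussianLaw (fun x : Path T => (lin θ x, lin θ' x)) P := by
  classical
  set I := θ.support ∪ θ'.support
  have e : ∀ θ'' : TimeI T →₀ ℝ, θ''.support ⊆ I → ∀ x : Path T,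
      lin θ'' x = ∑ t : I, θ'' t * x t := fun θ'' h x => by
    rw [lin_eq_sum, Finset.sum_coe_sort I fun t => θ'' t * x t]
    exact Finset.sum_subset h fun t _ ht => by rw [Finsupp.notMem_support_iff.1 ht, zero_mul]
  set L : (I → ℝ) →L[ℝ] ℝ × ℝ := (∑ t : I, θ t • ContinuousLinearMap.proj t).prod
    (∑ t : I, θ' t • ContinuousLinearMap.proj t) with hL
  have h := ((hP.isGaussianProcess_eval hT).hasGaussianLaw I).map L
  have e2 : (fun x : Path T => (lin θ x, lin θ' x)) = L ∘ fun x => I.restrict fun t => x t := by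
    funext x
    rw [e θ Finset.subset_union_left, e θ' Finset.subset_union_right]
    simp [hL]
  rw [e2]
  exact h

lemma hasGaussianLaw_lin (hP : IsWienerMeasure P) (hT : 0 ≤ T) (θ : TimeI T →₀ ℝ) :
    HasGaussianLaw (lin θ) P :=
  (hP.hasGaussianLaw_lin_prodMk hT θ θ).fst

lemma memLp_lin (hP : IsWienerMeasure P) (hT : 0 ≤ T) (θ : TimeI T →₀ ℝ) : MemLp (lin θ) 2 P :=
  (hP.hasGaussianLaw_lin hT θ).memLp_two

lemma integral_lin (hP : IsWienerMeasure P) (hT : 0 ≤ T) (θ : TimeI T →₀ ℝ) :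
    ∫ x, lin θ x ∂P = 0 := by
  have := hP.isProb
  have hint : ∀ t : TimeI T, Integrable (fun x : Path T => x t) P := fun t =>
    (hP.hasLaw_eval hT t).hasGaussianLaw.integrable
  simp only [lin_eq_sum]
  rw [integral_finsetSum _ fun t _ => (hint t).const_mul _]
  refine Finset.sum_eq_zero fun t _ => ?_
  rw [integral_const_mul, (hP.hasLaw_eval hT t).integral_eq, integral_id_gaussianReal, mul_zero]

lemma hasLaw_lin (hP : IsWienerMeasure P) (hT : 0 ≤ T) (θ : TimeI T →₀ ℝ) :
    HasLaw (lin θ) (gaussianReal 0 (Var[lin θ; P]).toNNReal) P := by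
  refine ⟨(measurable_lin θ).aemeasurable, ?_⟩
  rw [(hP.hasGaussianLaw_lin hT θ).map_eq_gaussianReal,
    hP.integral_lin hT]

lemma integral_cexp_lin (hP : IsWienerMeasure P) (hT : 0 ≤ T) (θ : TimeI T →₀ ℝ) (z : ℂ) :
    ∫ x, Complex.exp (z * lin θ x) ∂P = Complex.exp (Var[lin θ; P] * z ^ 2 / 2) := by
  have h := complexMGF_gaussianReal (hP.hasLaw_lin hT θ).map_eq z
  rw [complexMGF] at h
  rw [h]
  simp [Real.coe_toNNReal _ (variance_nonneg _ _)]

/-- A rotation of two independent Brownian motions gives a Brownian motion. -/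
lemma map_rotation (hP : IsWienerMeasure P) (hT : 0 ≤ T) :
    (P.prod P).map (fun z : Path T × Path T => (√2)⁻¹ • (z.1 - z.2)) = P := by
  have := hP.isProb
  have hm : Measurable fun z : Path T × Path T => (√2)⁻¹ • (z.1 - z.2) :=
    (Continuous.measurable (by fun_prop))
  have := Measure.isProbabilityMeasure_map (μ := P.prod P) hm.aemeasurable
  refine path_measure_ext fun θ => ?_
  rw [integral_map hm.aemeasurable (by fun_prop)]
  have h1 : ∀ z : Path T × Path T, Complex.exp (lin θ ((√2)⁻¹ • (z.1 - z.2)) * Complex.I) =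
      Complex.exp (((√2 : ℝ) : ℂ)⁻¹ * Complex.I * lin θ z.1) *
        Complex.exp (-(((√2 : ℝ) : ℂ)⁻¹ * Complex.I) * lin θ z.2) := by
    intro z
    rw [← Complex.exp_add, lin_path_smul, lin_path_sub]
    congr 1; push_cast; ring
  simp only [h1]
  rw [integral_prod_mul (fun x => Complex.exp (((√2 : ℝ) : ℂ)⁻¹ * Complex.I * lin θ x))
    (fun x => Complex.exp (-(((√2 : ℝ) : ℂ)⁻¹ * Complex.I) * lin θ x)),
    hP.integral_cexp_lin hT, hP.integral_cexp_lin hT, ← Complex.exp_add]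
  have h2 : ∫ x, Complex.exp (lin θ x * Complex.I) ∂P =
      Complex.exp (Var[lin θ; P] * Complex.I ^ 2 / 2) := by
    rw [← hP.integral_cexp_lin hT]; simp only [mul_comm]
  rw [h2]
  congr 1
  -- The two independent copies each contribute half of the variance.
  have h3 : (((√2 : ℝ) : ℂ)⁻¹) ^ 2 = 1 / 2 := by
    rw [inv_pow, ← Complex.ofReal_pow, Real.sq_sqrt (by norm_num)]; norm_num
  linear_combination (Var[lin θ; P] : ℂ) * Complex.I ^ 2 * h3

/-- Covariance of two finite-dimensional functionals. -/
def cov (P : Measure (Path T)) (θ θ' : TimeI T →₀ ℝ) : ℝ := ∫ x, lin θ x * lin θ' x ∂P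

lemma variance_lin (hP : IsWienerMeasure P) (hT : 0 ≤ T) (θ : TimeI T →₀ ℝ) :
    Var[lin θ; P] = cov P θ θ := by
  have := hP.isProb
  rw [variance_of_integral_eq_zero (measurable_lin θ).aemeasurable (hP.integral_lin hT θ), cov]
  simp only [sq]

lemma integrable_lin_mul (hP : IsWienerMeasure P) (hT : 0 ≤ T) (θ θ' : TimeI T →₀ ℝ) :
    Integrable (fun x => lin θ x * lin θ' x) P :=
  (hP.memLp_lin hT θ).integrable_mul (hP.memLp_lin hT θ')

lemma cov_sub_smul_left (hP : IsWienerMeasure P) (hT : 0 ≤ T) (θ θ' θ'' : TimeI T →₀ ℝ) (c : ℝ) :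
    cov P (θ - c • θ') θ'' = cov P θ θ'' - c * cov P θ' θ'' := by
  rw [cov, cov, cov, ← integral_const_mul, ← integral_sub (hP.integrable_lin_mul hT _ _)
    ((hP.integrable_lin_mul hT _ _).const_mul _)]
  congr 1; ext x; rw [lin_sub, lin_smul]; ring

lemma cov_comm (θ θ' : TimeI T →₀ ℝ) : cov P θ θ' = cov P θ' θ := by
  simp only [cov, mul_comm]

/-- The regression coefficient of `lin θ` on `lin θ₀`. When the variance of `lin θ₀` vanishes, this
functional is almost surely zero and so is the covariance. -/
lemma exists_cov_eq_mul (hP : IsWienerMeasure P) (hT : 0 ≤ T) (θ θ₀ : TimeI T →₀ ℝ) :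
    ∃ c, cov P θ θ₀ = c * cov P θ₀ θ₀ := by
  by_cases hv : cov P θ₀ θ₀ = 0
  · refine ⟨0, ?_⟩
    have h0 : (fun x => lin θ₀ x * lin θ₀ x) =ᵐ[P] 0 :=
      (integral_eq_zero_iff_of_nonneg (fun x => mul_self_nonneg _)
        (hP.integrable_lin_mul hT _ _)).1 hv
    rw [zero_mul, cov]
    refine integral_eq_zero_of_ae ?_
    filter_upwards [h0] with x hx
    simp only [Pi.zero_apply, mul_self_eq_zero] at hx
    simp [hx]
  · exact ⟨cov P θ θ₀ / cov P θ₀ θ₀, (div_mul_cancel₀ _ hv).symm⟩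

/-- Joint Laplace-Fourier transform of two finite-dimensional functionals. -/
lemma integral_cexp_lin_add (hP : IsWienerMeasure P) (hT : 0 ≤ T) (θ θ₀ : TimeI T →₀ ℝ) :
    ∫ x, Complex.exp (lin θ x * Complex.I + lin θ₀ x) ∂P =
      Complex.exp (-(cov P θ θ) / 2 + cov P θ θ₀ * Complex.I + cov P θ₀ θ₀ / 2) := by
  have := hP.isProb
  obtain ⟨c, hc⟩ := hP.exists_cov_eq_mul hT θ θ₀
  -- The residual of the regression on `θ₀` is uncorrelated with `lin θ₀`, hence independent of it,
  -- and the joint transform factorises.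
  set θ' := θ - c • θ₀ with hθ'
  have hcov0 : cov P θ' θ₀ = 0 := by rw [hP.cov_sub_smul_left hT, hc]; ring
  have hcov1 : cov P θ' θ' = cov P θ θ - c ^ 2 * cov P θ₀ θ₀ := by
    rw [hθ', hP.cov_sub_smul_left hT, cov_comm, hP.cov_sub_smul_left hT, cov_comm θ₀ (θ - c • θ₀),
      hP.cov_sub_smul_left hT, cov_comm θ₀ θ, hc]; ring
  have hind : IndepFun (lin θ') (lin θ₀) P := by
    refine HasGaussianLaw.indepFun_of_covariance_eq_zero
      (hP.hasGaussianLaw_lin_prodMk hT _ _) ?_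
    rw [covariance_eq_sub (hP.memLp_lin hT _) (hP.memLp_lin hT _), hP.integral_lin hT,
      zero_mul, sub_zero]
    exact hcov0
  have h1 : ∀ x, Complex.exp (lin θ x * Complex.I + lin θ₀ x) =
      Complex.exp (Complex.I * lin θ' x) * Complex.exp ((1 + c * Complex.I) * lin θ₀ x) := by
    intro x
    rw [← Complex.exp_add, hθ', lin_sub, lin_smul]
    congr 1; push_cast; ring
  simp only [h1]
  have hind' : IndepFun (fun x => Complex.exp (Complex.I * lin θ' x))
      (fun x => Complex.exp ((1 + c * Complex.I) * lin θ₀ x)) P :=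
    hind.comp (φ := fun r : ℝ => Complex.exp (Complex.I * r))
      (ψ := fun r : ℝ => Complex.exp ((1 + c * Complex.I) * r)) (by fun_prop) (by fun_prop)
  rw [hind'.integral_fun_mul_eq_mul_integral (by fun_prop) (by fun_prop),
    hP.integral_cexp_lin hT, hP.integral_cexp_lin hT, ← Complex.exp_add, hP.variance_lin hT,
    hP.variance_lin hT, hcov1, hc]
  congr 1
  push_cast
  linear_combination ((cov P θ θ : ℂ) / 2) * Complex.I_sq

lemma lintegral_exp_lin (hP : IsWienerMeasure P) (hT : 0 ≤ T) (θ : TimeI T →₀ ℝ) (s : ℝ) :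
    ∫⁻ x, ENNReal.ofReal (Real.exp (s * lin θ x)) ∂P =
      ENNReal.ofReal (Real.exp (cov P θ θ * s ^ 2 / 2)) := by
  have := hP.isProb
  have hl := hP.hasLaw_lin hT θ
  have hint : Integrable (fun x => Real.exp (s * lin θ x)) P := by
    have h := integrable_exp_mul_gaussianReal (μ := 0) (v := (Var[lin θ; P]).toNNReal) s
    rw [← hl.map_eq] at h
    exact h.comp_measurable (measurable_lin θ)
  rw [← ofReal_integral_eq_lintegral_ofReal hint (ae_of_all _ fun _ => (Real.exp_pos _).le)]
  have h := mgf_gaussianReal hl.map_eq s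
  rw [mgf] at h
  rw [h, Real.coe_toNNReal _ (variance_nonneg _ _), hP.variance_lin hT]
  simp

/-- The Cameron-Martin theorem for a path `g` represented by a finite-dimensional functional. -/
lemma map_add_eq_withDensity (hP : IsWienerMeasure P) (hT : 0 ≤ T) (θ₀ : TimeI T →₀ ℝ)
    (g : Path T) (hg : ∀ t, g t = cov P (Finsupp.single t 1) θ₀) :
    P.map (fun x => x + g) = P.withDensity
      (fun x => ENNReal.ofReal (Real.exp (lin θ₀ x - cov P θ₀ θ₀ / 2))) := by
  have := hP.isProb
  have hgc : ∀ θ, lin θ g = cov P θ θ₀ := by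
    intro θ
    rw [lin_eq_sum]
    simp only [hg, cov, ← integral_const_mul]
    rw [← integral_finsetSum]
    · congr 1; ext x
      simp only [lin_single, lin_eq_sum θ, Finset.sum_mul, one_mul, mul_assoc]
    · exact fun t _ => (hP.integrable_lin_mul hT _ _).const_mul _
  have hm : Measurable fun x : Path T => x + g := (Continuous.measurable (by fun_prop))
  have := Measure.isProbabilityMeasure_map (μ := P) hm.aemeasurable
  have hfin : ∫⁻ x, ENNReal.ofReal (Real.exp (lin θ₀ x - cov P θ₀ θ₀ / 2)) ∂P ≠ ∞ := by
    have : ∀ x : Path T, ENNReal.ofReal (Real.exp (lin θ₀ x - cov P θ₀ θ₀ / 2)) =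
        ENNReal.ofReal (Real.exp (1 * lin θ₀ x)) *
          ENNReal.ofReal (Real.exp (-(cov P θ₀ θ₀ / 2))) := fun x => by
      rw [← ENNReal.ofReal_mul (Real.exp_pos _).le, ← Real.exp_add]; congr 2; ring
    simp only [this]
    rw [lintegral_mul_const _ (by fun_prop), hP.lintegral_exp_lin hT]
    exact ENNReal.mul_ne_top ENNReal.ofReal_ne_top ENNReal.ofReal_ne_top
  have := isFiniteMeasure_withDensity hfin
  refine path_measure_ext fun θ => ?_
  rw [integral_map hm.aemeasurable (by fun_prop), integral_withDensity_eq_integral_toReal_smul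
    (by fun_prop) (ae_of_all _ fun _ => ENNReal.ofReal_lt_top)]
  have h1 : ∀ x, Complex.exp (lin θ (x + g) * Complex.I) =
      Complex.exp (Complex.I * lin θ x) * Complex.exp (cov P θ θ₀ * Complex.I) := by
    intro x; rw [lin_path_add, hgc, ← Complex.exp_add]; congr 1; push_cast; ring
  have h2 : ∀ x, (ENNReal.ofReal (Real.exp (lin θ₀ x - cov P θ₀ θ₀ / 2))).toReal •
      Complex.exp (lin θ x * Complex.I) =
      Complex.exp (lin θ x * Complex.I + lin θ₀ x) * Complex.exp (-(cov P θ₀ θ₀ / 2)) := by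
    intro x
    rw [ENNReal.toReal_ofReal (Real.exp_pos _).le, Complex.real_smul, Complex.ofReal_exp,
      ← Complex.exp_add, ← Complex.exp_add]
    congr 1; push_cast; ring
  simp only [h1, h2]
  rw [integral_mul_const, integral_mul_const, hP.integral_cexp_lin hT, hP.integral_cexp_lin_add hT,
    ← Complex.exp_add, ← Complex.exp_add, hP.variance_lin hT]
  congr 1
  linear_combination ((cov P θ θ : ℂ) / 2) * Complex.I_sq

/-- The Cameron-Martin shift maps `L²` functions to `L¹` functions. -/
lemma lintegral_comp_add_le (hP : IsWienerMeasure P) (hT : 0 ≤ T) (θ₀ : TimeI T →₀ ℝ)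
    (g : Path T) (hg : ∀ t, g t = cov P (Finsupp.single t 1) θ₀) (Φ : Path T → ℝ≥0∞)
    (hΦ : Measurable Φ) :
    ∫⁻ x, Φ (x + g) ∂P ≤ ENNReal.ofReal (Real.exp (cov P θ₀ θ₀ / 2)) *
      (∫⁻ x, Φ x ^ (2 : ℝ) ∂P) ^ (1 / 2 : ℝ) := by
  have := hP.isProb
  have hm : Measurable fun x : Path T => x + g := (Continuous.measurable (by fun_prop))
  rw [← lintegral_map hΦ hm, hP.map_add_eq_withDensity hT θ₀ g hg,
    lintegral_withDensity_eq_lintegral_mul _ (by fun_prop) hΦ]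
  -- Cauchy-Schwarz against the Cameron-Martin density, whose second moment is `exp (cov P θ₀ θ₀)`.
  refine (ENNReal.lintegral_mul_le_Lp_mul_Lq P (Real.HolderConjugate.two_two)
    (by fun_prop) (by fun_prop)).trans ?_
  gcongr
  have h : ∀ x : Path T, ENNReal.ofReal (Real.exp (lin θ₀ x - cov P θ₀ θ₀ / 2)) ^ (2 : ℝ) =
      ENNReal.ofReal (Real.exp (2 * lin θ₀ x)) * ENNReal.ofReal (Real.exp (-cov P θ₀ θ₀)) := by
    intro x
    rw [ENNReal.ofReal_rpow_of_nonneg (Real.exp_pos _).le (by norm_num),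
      ← ENNReal.ofReal_mul (Real.exp_pos _).le, ← Real.exp_add, ← Real.exp_mul]
    congr 2; ring
  simp only [h]
  rw [lintegral_mul_const _ (by fun_prop), hP.lintegral_exp_lin hT,
    ← ENNReal.ofReal_mul (Real.exp_pos _).le, ENNReal.ofReal_rpow_of_nonneg (by positivity)
    (by norm_num), ← Real.exp_add, ← Real.exp_mul]
  apply le_of_eq; congr 2; ring

end IsWienerMeasure

/-! ### Combinations of the `h_j^n` and their representing functionals. -/

section Comb

variable {T : ℝ} {n : ℕ}

lemma comb_apply (y : Fin n → ℝ) (t : TimeI T) : comb T y t = ∑ j, y j * hFun T n j t := by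
  simp [comb, ContinuousMap.sum_apply]

lemma comb_add (y z : Fin n → ℝ) : comb T (y + z) = comb T y + comb T z := by
  simp [comb, add_smul, Finset.sum_add_distrib]

lemma comb_sub (y z : Fin n → ℝ) : comb T (y - z) = comb T y - comb T z := by
  simp [comb, sub_smul, Finset.sum_sub_distrib]

lemma comb_single (j : Fin n) (c : ℝ) : comb T (Pi.single j c) = c • hFun T n j := by
  classical
  rw [comb, Finset.sum_eq_single j]
  · simp
  · intro i _ hi; simp [Pi.single_eq_of_ne hi]
  · simp

end Comb

/-- The difference of minima is the form in which Brownian covariances appear, which is why the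
integral is written this way. -/
lemma intervalIntegral_indicator_Ico {a b t : ℝ} (ha : 0 ≤ a) (hab : a ≤ b) (ht : 0 ≤ t) :
    ∫ r in (0 : ℝ)..t, (Set.Ico a b).indicator (fun _ => (1 : ℝ)) r = min t b - min t a := by
  rw [intervalIntegral.integral_of_le ht, ← integral_Ico_eq_integral_Ioc,
    setIntegral_indicator measurableSet_Ico, setIntegral_const, Set.Ico_inter_Ico,
    Measure.real, Real.volume_Ico, smul_eq_mul, mul_one, sup_eq_right.2 ha]
  rcases le_total t a with h | h
  · rw [min_eq_left h, min_eq_left (h.trans hab), sub_self,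
      ENNReal.ofReal_of_nonpos (by linarith), ENNReal.toReal_zero]
  · rw [min_eq_right h, ENNReal.toReal_ofReal (sub_nonneg.2 (le_inf h hab))]

/-- The grid point `iT/n`. -/
def gridPt (T : ℝ) (n i : ℕ) (hT : 0 ≤ T) (hi : i ≤ n) : TimeI T :=
  ⟨i * T / n, by positivity, by
    rcases Nat.eq_zero_or_pos n with h | h
    · simp [h, hT]
    · have : (0 : ℝ) < n := by exact_mod_cast h
      rw [div_le_iff₀ this, mul_comm]
      have : (i : ℝ) ≤ n := by exact_mod_cast hi
      gcongr⟩

/-- The finite-dimensional functional that represents `comb T y` in Wiener space. -/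
def combDual (T : ℝ) (hT : 0 ≤ T) {n : ℕ} (y : Fin n → ℝ) : TimeI T →₀ ℝ :=
  ∑ j : Fin n, y j • (√(n / T) • (Finsupp.single (gridPt T n (j + 1) hT j.2) 1 -
    Finsupp.single (gridPt T n j hT j.2.le) 1))

namespace IsWienerMeasure

variable {T : ℝ} {P : Measure (Path T)}

lemma cov_sum_right (hP : IsWienerMeasure P) (hT : 0 ≤ T) {ι : Type*} (s : Finset ι)
    (θ : TimeI T →₀ ℝ) (a : ι → ℝ) (θ' : ι → TimeI T →₀ ℝ) :
    cov P θ (∑ i ∈ s, a i • θ' i) = ∑ i ∈ s, a i * cov P θ (θ' i) := by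
  simp only [cov, ← integral_const_mul]
  rw [← integral_finsetSum _ fun i _ => (hP.integrable_lin_mul hT _ _).const_mul _]
  congr 1; ext x
  rw [lin_sum, Finset.mul_sum]
  exact Finset.sum_congr rfl fun i _ => by rw [lin_smul]; ring

/-- The increment `x t - x s` is independent of `x s`, so the covariance with `x t` is the variance
of `x s`. -/
lemma cov_single_of_le (hP : IsWienerMeasure P) (hT : 0 ≤ T) {s t : TimeI T} (hst : s ≤ t) :
    cov P (Finsupp.single s 1) (Finsupp.single t 1) = s := by
  have := hP.isProb
  have hmem : ∀ t : TimeI T, MemLp (fun x : Path T => x t) 2 P := fun t =>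
    (hP.hasLaw_eval hT t).hasGaussianLaw.memLp_two
  have hmean : ∀ t : TimeI T, ∫ x : Path T, x t ∂P = 0 := fun t => by
    rw [(hP.hasLaw_eval hT t).integral_eq, integral_id_gaussianReal]
  have hind := hP.indep_increments.indepFun_eval_sub (r := ⟨0, le_refl 0, hT⟩) s.2.1 hst
    (hP.start_zero _ rfl)
  have h0 := hind.covariance_eq_zero (hmem s) ((hmem t).sub (hmem s))
  rw [covariance_sub_right (hmem s) (hmem t) (hmem s), covariance_self (hmem s).aemeasurable,
    (hP.hasLaw_eval hT s).variance_eq, variance_id_gaussianReal,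
    covariance_eq_sub (hmem s) (hmem t), hmean, zero_mul, sub_zero,
    Real.coe_toNNReal _ s.2.1, sub_eq_zero] at h0
  rw [cov, ← h0]
  simp [lin_single]

lemma cov_single (hP : IsWienerMeasure P) (hT : 0 ≤ T) (s t : TimeI T) :
    cov P (Finsupp.single s 1) (Finsupp.single t 1) = min (s : ℝ) t := by
  rcases le_total s t with h | h
  · rw [hP.cov_single_of_le hT h, min_eq_left (by exact_mod_cast h)]
  · rw [cov_comm, hP.cov_single_of_le hT h, min_eq_right (by exact_mod_cast h)]

/-- The covariance of `x t` with the increment over `[a, b]` is `min t b - min t a`, the primitive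
of the indicator of `[a, b)`. The paths `comb T y` are thus represented by finitely many evaluations
at grid points, and the finite-dimensional Cameron-Martin theorem covers them. -/
lemma comb_eq_cov (hP : IsWienerMeasure P) (hT : 0 ≤ T) {n : ℕ} (y : Fin n → ℝ) (t : TimeI T) :
    comb T y t = cov P (Finsupp.single t 1) (combDual T hT y) := by
  rw [comb_apply, combDual, hP.cov_sum_right hT]
  refine Finset.sum_congr rfl fun j _ => ?_
  congr 1
  have h1 : √(n / T) • (Finsupp.single (gridPt T n (j + 1) hT j.2) (1 : ℝ) -
      Finsupp.single (gridPt T n j hT j.2.le) 1) =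
      ∑ i : Fin 2, ![√(n / T), -√(n / T)] i • ![Finsupp.single (gridPt T n (j + 1) hT j.2) (1 : ℝ),
        Finsupp.single (gridPt T n j hT j.2.le) 1] i := by
    simp [Fin.sum_univ_two, sub_eq_add_neg]
  rw [h1, hP.cov_sum_right hT, Fin.sum_univ_two]
  simp only [Matrix.cons_val_zero, Matrix.cons_val_one, hP.cov_single hT]
  simp only [hFun, ContinuousMap.coe_mk, gridPt]
  rw [intervalIntegral_indicator_Ico (by positivity) (by gcongr; linarith) t.2.1]
  push_cast
  ring

/-- Shifts by `comb T y` map bounded sets of `L²(P)` to bounded sets of `L¹(P)`, uniformly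
for bounded `y`. -/
lemma exists_lintegral_shift_le (hP : IsWienerMeasure P) (hT : 0 ≤ T) (n : ℕ) (R : ℝ) :
    ∃ C : ℝ≥0∞, C ≠ ∞ ∧ ∀ y : Fin n → ℝ, (∀ j, |y j| ≤ R) → ∀ Φ : Path T → ℝ≥0∞, Measurable Φ →
      ∫⁻ x, Φ (x + comb T y) ∂P ≤ C * (∫⁻ x, Φ x ^ (2 : ℝ) ∂P) ^ (1 / 2 : ℝ) := by
  set e : Fin n → TimeI T →₀ ℝ := fun j => √(n / T) •
    (Finsupp.single (gridPt T n (j + 1) hT j.2) 1 - Finsupp.single (gridPt T n j hT j.2.le) 1)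
    with he
  -- Bound for the variance of `lin (combDual T hT y)` over all `y` with coordinates at most `R` in
  -- absolute value.
  set K : ℝ := ∑ j, ∑ k, R * (R * |cov P (e j) (e k)|)
  refine ⟨ENNReal.ofReal (Real.exp (K / 2)), ENNReal.ofReal_ne_top, fun y hy Φ hΦ => ?_⟩
  refine (hP.lintegral_comp_add_le hT (combDual T hT y) (comb T y) (hP.comb_eq_cov hT y)
    Φ hΦ).trans ?_
  gcongr
  have h : cov P (combDual T hT y) (combDual T hT y) =
      ∑ j, ∑ k, y j * (y k * cov P (e j) (e k)) := by
    have h1 : combDual T hT y = ∑ j, y j • e j := rfl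
    rw [h1, hP.cov_sum_right hT]
    refine Finset.sum_congr rfl fun j _ => ?_
    rw [cov_comm, hP.cov_sum_right hT, Finset.mul_sum]
  rw [h]
  refine Finset.sum_le_sum fun j _ => Finset.sum_le_sum fun k _ => ?_
  refine (le_abs_self _).trans ?_
  rw [abs_mul, abs_mul]
  have hR : 0 ≤ R := (abs_nonneg _).trans (hy j)
  gcongr
  · exact hy j
  · exact hy k

/-- Statements valid at almost every `x` remain valid at `x + comb T y`. All almost sure identities
at shifted paths rest on this. -/
lemma quasiMeasurePreserving_add_comb (hP : IsWienerMeasure P) (hT : 0 ≤ T) {n : ℕ}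
    (y : Fin n → ℝ) : Measure.QuasiMeasurePreserving (fun x => x + comb T y) P P := by
  have hm : Measurable fun x : Path T => x + comb T y := (Continuous.measurable (by fun_prop))
  refine ⟨hm, ?_⟩
  rw [hP.map_add_eq_withDensity hT _ _ (hP.comb_eq_cov hT y)]
  exact withDensity_absolutelyContinuous _ _

/-! ### Sobolev regularity and small balls -/

/-- Brownian scaling: the increment has the law of `√(t - s)` times a standard Gaussian variable. -/
lemma lintegral_abs_sub_rpow (hP : IsWienerMeasure P) (p : ℝ) {s t : TimeI T}
    (hst : s ≤ t) :
    ∫⁻ x : Path T, ENNReal.ofReal (|x t - x s| ^ p) ∂P =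
      ENNReal.ofReal (((t : ℝ) - s) ^ (p / 2)) *
        ∫⁻ z, ENNReal.ofReal (|z| ^ p) ∂(gaussianReal 0 1) := by
  have hts : 0 ≤ (t : ℝ) - s := sub_nonneg.2 (by exact_mod_cast hst)
  have hl := hP.increments_law s t hst
  have hg : gaussianReal 0 (Real.toNNReal ((t : ℝ) - s)) =
      (gaussianReal 0 1).map (fun z => √((t : ℝ) - s) * z) := by
    rw [gaussianReal_map_const_mul, mul_zero, mul_one]
    congr 1
    apply NNReal.eq
    simp [Real.sq_sqrt hts, hts]
  have hm : Measurable fun z : ℝ => ENNReal.ofReal (|z| ^ p) := by fun_prop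
  have e : ∫⁻ x : Path T, ENNReal.ofReal (|x t - x s| ^ p) ∂P =
      ∫⁻ z, ENNReal.ofReal (|z| ^ p) ∂(P.map fun x : Path T => x t - x s) :=
    (lintegral_map' hm.aemeasurable hl.aemeasurable).symm
  rw [e, hl.map_eq, hg, lintegral_map hm (by fun_prop),
    ← lintegral_const_mul _ hm]
  refine lintegral_congr fun z => ?_
  rw [← ENNReal.ofReal_mul (by positivity), abs_mul, abs_of_nonneg (Real.sqrt_nonneg _),
    Real.mul_rpow (by positivity) (by positivity), Real.sqrt_eq_rpow, ← Real.rpow_mul hts]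
  congr 3; ring

lemma lintegral_abs_sub_rpow' (hP : IsWienerMeasure P) (p : ℝ) (s t : TimeI T) :
    ∫⁻ x : Path T, ENNReal.ofReal (|x t - x s| ^ p) ∂P =
      ENNReal.ofReal (|(t : ℝ) - s| ^ (p / 2)) *
        ∫⁻ z, ENNReal.ofReal (|z| ^ p) ∂(gaussianReal 0 1) := by
  rcases le_total s t with h | h
  · rw [hP.lintegral_abs_sub_rpow p h, abs_of_nonneg (sub_nonneg.2 (by exact_mod_cast h))]
  · have := hP.lintegral_abs_sub_rpow p h
    rw [abs_sub_comm, abs_of_nonneg (sub_nonneg.2 (by exact_mod_cast h)), ← this]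
    simp only [abs_sub_comm]

lemma lintegral_gaussian_abs_rpow_lt_top {p : ℝ} (hp : 0 < p) :
    ∫⁻ z, ENNReal.ofReal (|z| ^ p) ∂(gaussianReal 0 1) < ∞ := by
  have h := (memLp_id_gaussianReal' (μ := 0) (v := 1) (ENNReal.ofReal p) ENNReal.ofReal_ne_top).2
  rw [eLpNorm_lt_top_iff_lintegral_rpow_enorm_lt_top (by simpa using hp) ENNReal.ofReal_ne_top,
    ENNReal.toReal_ofReal hp.le] at h
  convert h using 3 with z
  simp [Real.enorm_eq_ofReal_abs, ENNReal.ofReal_rpow_of_nonneg, hp.le]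

/-- Brownian paths belong to the fractional Sobolev space. -/
lemma ae_mem_sobSpace (hP : IsWienerMeasure P) (hT : 0 < T) {η p : ℝ} (hp : 1 ≤ p)
    (hη : η < 1 / 2) : ∀ᵐ x ∂P, x ∈ sobSpace T η p := by
  have := hP.isProb
  have hp0 : 0 < p := by linarith
  have hpη' : 0 < p / 2 - p * η := by nlinarith
  set M := ∫⁻ z, ENNReal.ofReal (|z| ^ p) ∂(gaussianReal 0 1) with hM
  have hMtop : M < ∞ := lintegral_gaussian_abs_rpow_lt_top hp0
  have h1 : Measurable fun z : Path T × TimeI T => z.1 z.2 :=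
    (continuous_eval (F := Path T)).measurable
  have h2 : Measurable fun z : Path T × TimeI T × TimeI T => z.1 z.2.1 :=
    h1.comp (measurable_fst.prodMk (measurable_fst.comp measurable_snd))
  have h3 : Measurable fun z : Path T × TimeI T × TimeI T => z.1 z.2.2 :=
    h1.comp (measurable_fst.prodMk (measurable_snd.comp measurable_snd))
  set A : Path T → ℝ≥0∞ := fun x => ∫⁻ t : TimeI T, ENNReal.ofReal (|x t| ^ p) with hA
  set D : Path T → ℝ≥0∞ := fun x => ∫⁻ q : TimeI T × TimeI T,
    ENNReal.ofReal (|x q.1 - x q.2| ^ p / |(q.1 : ℝ) - (q.2 : ℝ)| ^ (1 + p * η))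
      ∂(volume.prod volume) with hD
  have hAm : Measurable A := Measurable.lintegral_prod_right'
    (f := fun z : Path T × TimeI T => ENNReal.ofReal (|z.1 z.2| ^ p)) (by fun_prop)
  have hmD : Measurable fun z : Path T × TimeI T × TimeI T => ENNReal.ofReal
      (|z.1 z.2.1 - z.1 z.2.2| ^ p / |(z.2.1 : ℝ) - (z.2.2 : ℝ)| ^ (1 + p * η)) := by fun_prop
  have hDm : Measurable D := Measurable.lintegral_prod_right' hmD
  have hAfin : ∫⁻ x, A x ∂P < ∞ := by
    rw [hA, lintegral_lintegral_swap (by fun_prop)]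
    have hb : ∀ t : TimeI T, ∫⁻ x : Path T, ENNReal.ofReal (|x t| ^ p) ∂P ≤
        ENNReal.ofReal (T ^ (p / 2)) * M := by
      intro t
      set o : TimeI T := ⟨0, le_refl 0, hT.le⟩ with ho
      have := hP.lintegral_abs_sub_rpow' p o t
      have e : ∫⁻ x : Path T, ENNReal.ofReal (|x t| ^ p) ∂P =
          ∫⁻ x : Path T, ENNReal.ofReal (|x t - x o| ^ p) ∂P := by
        refine lintegral_congr_ae ?_
        filter_upwards [hP.start_zero o rfl] with x hx
        rw [hx, sub_zero]
      rw [e, this]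
      gcongr
      simp only [ho, sub_zero]
      rw [abs_of_nonneg t.2.1]; exact t.2.2
    refine (lintegral_mono hb).trans_lt ?_
    rw [lintegral_const]
    exact ENNReal.mul_lt_top (ENNReal.mul_lt_top ENNReal.ofReal_lt_top hMtop) (measure_lt_top _ _)
  have hDfin : ∫⁻ x, D x ∂P < ∞ := by
    rw [hD, lintegral_lintegral_swap hmD.aemeasurable]
    -- The expected integrand at distance `r` is `M r^{p/2 - pη - 1}`, integrable at `0` since `η <
    -- 1/2`.
    set φ : ℝ → ℝ≥0∞ := fun r => (Set.Ioc 0 T).indicator (fun r => M *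
        ENNReal.ofReal (r ^ ((p / 2 - p * η) - 1))) r with hφ
    have hφm : Measurable φ := Measurable.indicator (by fun_prop) measurableSet_Ioc
    have hb : ∀ q : TimeI T × TimeI T, ∫⁻ x : Path T, ENNReal.ofReal
        (|x q.1 - x q.2| ^ p / |(q.1 : ℝ) - (q.2 : ℝ)| ^ (1 + p * η)) ∂P ≤
          φ |(q.1 : ℝ) - q.2| := by
      rintro ⟨t, s⟩
      simp only
      rcases (abs_nonneg ((t : ℝ) - s)).eq_or_lt with h | h
      · have : t = s := Subtype.ext (sub_eq_zero.1 (abs_eq_zero.1 h.symm))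
        subst this
        simp [Real.zero_rpow hp0.ne']
      · set r := |(t : ℝ) - s| with hr
        have hmem : r ∈ Set.Ioc 0 T := ⟨h, abs_le.2 ⟨by linarith [t.2.1, s.2.2],
          by linarith [t.2.2, s.2.1]⟩⟩
        simp only [hφ, Set.indicator_of_mem hmem]
        have e : ∀ x : Path T, ENNReal.ofReal (|x t - x s| ^ p / r ^ (1 + p * η)) =
            ENNReal.ofReal (|x t - x s| ^ p) * ENNReal.ofReal (r ^ (-(1 + p * η))) := by
          intro x
          rw [← ENNReal.ofReal_mul (by positivity), Real.rpow_neg h.le, div_eq_mul_inv]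
        simp only [e]
        rw [lintegral_mul_const _ (by fun_prop), hP.lintegral_abs_sub_rpow' p, ← hr,
          mul_right_comm, ← ENNReal.ofReal_mul (by positivity), ← Real.rpow_add h, mul_comm]
        apply le_of_eq; congr 3; ring
    calc _ ≤ ∫⁻ q : TimeI T × TimeI T, φ |(q.1 : ℝ) - q.2| ∂(volume.prod volume) :=
          lintegral_mono hb
      _ = ∫⁻ t : TimeI T, ∫⁻ s : TimeI T, φ |(t : ℝ) - s| := by
          rw [lintegral_prod _ (by fun_prop)]
      _ ≤ ∫⁻ t : TimeI T, 2 * ∫⁻ r in Set.Ioi (0 : ℝ), φ r :=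
          lintegral_mono fun t => lintegral_timeI_le φ hφm t
      _ < ∞ := by
          rw [lintegral_const]
          refine ENNReal.mul_lt_top (ENNReal.mul_lt_top (by simp) ?_) (measure_lt_top _ _)
          refine (setLIntegral_le_lintegral _ _).trans_lt ?_
          rw [hφ, lintegral_indicator measurableSet_Ioc, lintegral_const_mul _ (by fun_prop),
            lintegral_Ioc_rpow_le hT hpη']
          exact ENNReal.mul_lt_top hMtop ENNReal.ofReal_lt_top
  filter_upwards [ae_lt_top hAm hAfin.ne, ae_lt_top hDm hDfin.ne] with x hx1 hx2
  refine ENNReal.rpow_lt_top_of_nonneg (by positivity) (ENNReal.add_lt_top.2 ⟨hx1, ?_⟩).ne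
  refine lt_of_eq_of_lt ?_ hx2
  rw [hD]
  exact (lintegral_prod _ (hmD.comp measurable_prodMk_left).aemeasurable).symm

/-- Wiener measure charges every ball of `W_{η,p}` around the origin. -/
lemma measure_sobNorm_lt_pos (hP : IsWienerMeasure P) (hT : 0 < T) {η p : ℝ} (hp : 1 ≤ p)
    (hη : η < 1 / 2) {ε : ℝ≥0∞} (hε : 0 < ε) : 0 < P {x | sobNorm η p x < ε} := by
  have := hP.isProb
  obtain ⟨D, hD, hcov⟩ := exists_countable_cover_sobSpace (T := T) (η := η) hp
    (ENNReal.half_pos hε.ne')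
  -- Countably many balls of radius `ε/2` cover the Sobolev space, which has full measure, so one of
  -- them is charged.
  have hpos : ∃ g ∈ D, P {x | sobNorm η p (x - g) < ε / 2} ≠ 0 := by
    by_contra! h0
    have h1 : P (⋃ g ∈ D, {x | sobNorm η p (x - g) < ε / 2}) = 0 :=
      (measure_biUnion_null_iff hD).2 h0
    have h2 : (sobSpace T η p) ⊆ ⋃ g ∈ D, {x | sobNorm η p (x - g) < ε / 2} := fun x hx => by
      obtain ⟨g, hg, hxg⟩ := hcov x hx
      exact Set.mem_biUnion hg hxg
    have h3 : P (sobSpace T η p) = 1 := by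
      rw [prob_compl_eq_zero_iff measurableSet_sobSpace |>.1]
      exact hP.ae_mem_sobSpace hT hp hη
    rw [measure_mono_null h2 h1] at h3
    exact zero_ne_one h3
  obtain ⟨g, -, hg⟩ := hpos
  set B := {x : Path T | sobNorm η p (x - g) < ε / 2} with hB
  have hm : Measurable fun z : Path T × Path T => (√2)⁻¹ • (z.1 - z.2) :=
    (Continuous.measurable (by fun_prop))
  have hms : MeasurableSet {x : Path T | sobNorm η p x < ε} :=
    measurableSet_lt measurable_sobNorm measurable_const
  -- Two independent paths in the charged ball differ by less than `ε`, and `(x - y)/√2` is again a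
  -- Brownian path. This moves the positive mass from the unknown centre `g` to the origin.
  have hsub : B ×ˢ B ⊆ (fun z : Path T × Path T => (√2)⁻¹ • (z.1 - z.2)) ⁻¹'
      {x | sobNorm η p x < ε} := by
    rintro ⟨x, y⟩ ⟨hx, hy⟩
    simp only [hB, Set.mem_ofPred_eq] at hx hy
    simp only [Set.mem_preimage, Set.mem_ofPred_eq]
    rw [sobNorm_smul hp]
    have h4 : ENNReal.ofReal |(√2)⁻¹| ≤ 1 := by
      rw [ENNReal.ofReal_le_one, abs_of_nonneg (by positivity)]
      exact inv_le_one_of_one_le₀ (Real.one_le_sqrt.2 (by norm_num))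
    have h5 : x - y = (x - g) + -(y - g) := by abel
    calc _ ≤ 1 * sobNorm η p (x - y) := by gcongr
      _ ≤ sobNorm η p (x - g) + sobNorm η p (y - g) := by
          rw [one_mul, h5, ← sobNorm_neg hp (y - g)]
          exact sobNorm_add_le hp _ _
      _ < ε / 2 + ε / 2 := ENNReal.add_lt_add hx hy
      _ = ε := ENNReal.add_halves ε
  rw [← hP.map_rotation hT.le, Measure.map_apply hm hms]
  refine lt_of_lt_of_le ?_ (measure_mono hsub)
  rw [Measure.prod_prod]
  exact ENNReal.mul_pos hg hg

end IsWienerMeasure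

/-! ### Third order differences -/

/-- The third order difference of `f` at `x` in the directions `a`, `b`, `c`. -/
def delta3 {E : Type*} [Add E] (f : E → ℝ) (x a b c : E) : ℝ :=
  (f (x + (c + a + b)) - f (x + (c + a)) - f (x + (c + b)) + f (x + c)) -
    (f (x + (a + b)) - f (x + a) - f (x + b) + f x)

section Taylor

variable {E : Type*} [NormedAddCommGroup E] [NormedSpace ℝ E]

lemma hasDerivAt_comp_line {F : Type*} [NormedAddCommGroup F] [NormedSpace ℝ F] {k : E → F}
    (hk : Differentiable ℝ k) (z v : E) (s : ℝ) :
    HasDerivAt (fun s : ℝ => k (z + s • v)) (fderiv ℝ k (z + s • v) v) s := by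
  have h1 : HasDerivAt (fun s : ℝ => z + s • v) v s := by
    simpa using ((hasDerivAt_id s).smul_const v).const_add z
  exact (hk _).hasFDerivAt.comp_hasDerivAt s h1

lemma integral_fderiv_line {k : E → ℝ} (hk : ContDiff ℝ 1 k) (z v : E) :
    ∫ s in (0 : ℝ)..1, fderiv ℝ k (z + s • v) v = k (z + v) - k z := by
  have h := intervalIntegral.integral_eq_sub_of_hasDerivAt (a := 0) (b := 1)
    (f := fun s : ℝ => k (z + s • v))
    (fun s _ => hasDerivAt_comp_line (hk.differentiable one_ne_zero) z v s) ?_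
  · simpa using h
  · have := hk.continuous_fderiv one_ne_zero
    exact Continuous.intervalIntegrable (by fun_prop) _ _

lemma contDiff_fderiv_apply {k : E → ℝ} {m : ℕ} (hk : ContDiff ℝ (m + 1) k) (v : E) :
    ContDiff ℝ m (fun z => fderiv ℝ k z v) :=
  (hk.fderiv_right le_rfl).clm_apply contDiff_const

lemma fderiv_fderiv_apply {k : E → ℝ} (hk : ContDiff ℝ 2 k) (z v w : E) :
    fderiv ℝ (fun z => fderiv ℝ k z v) z w = fderiv ℝ (fderiv ℝ k) z w v := by
  have h : DifferentiableAt ℝ (fderiv ℝ k) z :=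
    (hk.fderiv_right (m := 1) le_rfl).differentiable one_ne_zero z
  rw [fderiv_clm_apply h (differentiableAt_const v)]
  simp

/-- The fundamental theorem of calculus along `a`, applied to the derivative in direction `b`, and
then along `b`. -/
lemma integral_integral_fderiv_fderiv {k : E → ℝ} (hk : ContDiff ℝ 2 k) (z a b : E) :
    ∫ s in (0 : ℝ)..1, ∫ r in (0 : ℝ)..1, fderiv ℝ (fderiv ℝ k) (z + (r • a + s • b)) a b =
      k (z + (a + b)) - k (z + a) - k (z + b) + k z := by
  have hc1 : ContDiff ℝ 1 k := hk.of_le one_le_two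
  have h1 : ∀ s : ℝ, ∫ r in (0 : ℝ)..1, fderiv ℝ (fderiv ℝ k) (z + (r • a + s • b)) a b =
      fderiv ℝ k (z + a + s • b) b - fderiv ℝ k (z + s • b) b := by
    intro s
    have h := integral_fderiv_line (contDiff_fderiv_apply (m := 1) hk b) (z + s • b) a
    simp only [fderiv_fderiv_apply hk] at h
    rw [show z + a + s • b = z + s • b + a by abel, ← h]
    congr 1; ext r
    rw [show z + (r • a + s • b) = z + s • b + r • a by abel]
  have hcont := hc1.continuous_fderiv one_ne_zero
  simp only [h1]
  rw [intervalIntegral.integral_sub (Continuous.intervalIntegrable (by fun_prop) _ _)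
    (Continuous.intervalIntegrable (by fun_prop) _ _), integral_fderiv_line hc1,
    integral_fderiv_line hc1, add_assoc]
  ring

lemma enorm_intervalIntegral_le (g : ℝ → ℝ) :
    ‖∫ r in (0 : ℝ)..1, g r‖ₑ ≤ ∫⁻ r in Set.Ioc (0 : ℝ) 1, ‖g r‖ₑ := by
  rw [intervalIntegral.integral_of_le zero_le_one]
  exact enorm_integral_le_lintegral_enorm _

/-- A third order difference is controlled by the oscillation of the second derivative. -/
lemma enorm_delta3_le {f : E → ℝ} (hf : ContDiff ℝ 2 f) (z a b c : E) :
    ‖delta3 f z a b c‖ₑ ≤ ∫⁻ s in Set.Ioc (0 : ℝ) 1, ∫⁻ r in Set.Ioc (0 : ℝ) 1,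
      ‖fderiv ℝ (fderiv ℝ f) (z + (c + (r • a + s • b))) a b -
        fderiv ℝ (fderiv ℝ f) (z + (r • a + s • b)) a b‖ₑ := by
  have hcont : Continuous fun z => fderiv ℝ (fderiv ℝ f) z a b :=
    ((hf.fderiv_right (m := 1) le_rfl).continuous_fderiv one_ne_zero).clm_apply
      continuous_const |>.clm_apply continuous_const
  have h1 := integral_integral_fderiv_fderiv hf z a b
  have h2 := integral_integral_fderiv_fderiv hf (z + c) a b
  have h3 : delta3 f z a b c = ∫ s in (0 : ℝ)..1, ∫ r in (0 : ℝ)..1,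
      (fderiv ℝ (fderiv ℝ f) (z + (c + (r • a + s • b))) a b -
        fderiv ℝ (fderiv ℝ f) (z + (r • a + s • b)) a b) := by
    have hi : ∀ w : E, ∀ s : ℝ, IntervalIntegrable (fun r : ℝ =>
        fderiv ℝ (fderiv ℝ f) (w + (r • a + s • b)) a b) volume 0 1 := fun w s =>
      Continuous.intervalIntegrable (hcont.comp (by fun_prop)) _ _
    have hi' : ∀ w : E, IntervalIntegrable (fun s : ℝ => ∫ r in (0 : ℝ)..1,
        fderiv ℝ (fderiv ℝ f) (w + (r • a + s • b)) a b) volume 0 1 := fun w => by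
      refine Continuous.intervalIntegrable ?_ _ _
      exact intervalIntegral.continuous_parametric_intervalIntegral_of_continuous'
        (f := fun s r : ℝ => fderiv ℝ (fderiv ℝ f) (w + (r • a + s • b)) a b)
        (hcont.comp (by fun_prop)) 0 1
    simp only [← add_assoc z c] at *
    simp only [intervalIntegral.integral_sub (hi _ _) (hi _ _)]
    rw [intervalIntegral.integral_sub (hi' _) (hi' _), h1, h2, delta3]
    simp only [add_assoc]
  rw [h3]
  refine (enorm_intervalIntegral_le _).trans (lintegral_mono fun s => ?_)
  exact enorm_intervalIntegral_le _

end Taylor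

/-! ### Shifts of Wiener integrals -/

section Shift

variable {T : ℝ} {n : ℕ}

/-- The derivative of `comb T y`. -/
def combDeriv (T : ℝ) {n : ℕ} (y : Fin n → ℝ) (s : TimeI T) : ℝ :=
  ∑ j : Fin n, y j * (√(n / T) * (Set.Ico ((j : ℕ) * T / n) (((j : ℕ) + 1) * T / n)).indicator
    (fun _ => (1 : ℝ)) (s : ℝ))

lemma measurable_combDeriv (y : Fin n → ℝ) : Measurable (combDeriv T y) := by
  unfold combDeriv
  refine Finset.measurable_fun_sum _ fun j _ => ?_
  have : Measurable ((Set.Ico ((j : ℕ) * T / (n : ℝ)) (((j : ℕ) + 1) * T / n)).indicator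
    (fun _ => (1 : ℝ))) := measurable_const.indicator measurableSet_Ico
  fun_prop

lemma abs_combDeriv_le (y : Fin n → ℝ) (s : TimeI T) :
    |combDeriv T y s| ≤ ∑ j, |y j| * √(n / T) := by
  refine (Finset.abs_sum_le_sum_abs _ _).trans (Finset.sum_le_sum fun j _ => ?_)
  rw [abs_mul, abs_mul, abs_of_nonneg (Real.sqrt_nonneg _)]
  gcongr
  refine mul_le_of_le_one_right (Real.sqrt_nonneg _) ?_
  exact (norm_indicator_le_norm_self (fun _ => (1 : ℝ)) _).trans (by simp)

lemma memLp_combDeriv (y : Fin n → ℝ) : MemLp (combDeriv T y) 2 volume :=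
  MemLp.of_bound (measurable_combDeriv y).aestronglyMeasurable _
    (ae_of_all _ fun s => abs_combDeriv_le y s)

lemma integrable_combDeriv (y : Fin n → ℝ) : Integrable (combDeriv T y) volume :=
  (memLp_combDeriv y).integrable one_le_two

lemma combDeriv_add (y z : Fin n → ℝ) (s : TimeI T) :
    combDeriv T (y + z) s = combDeriv T y s + combDeriv T z s := by
  simp [combDeriv, add_mul, Finset.sum_add_distrib]

lemma combDeriv_smul (c : ℝ) (y : Fin n → ℝ) (s : TimeI T) :
    combDeriv T (c • y) s = c * combDeriv T y s := by
  simp [combDeriv, mul_assoc, Finset.mul_sum]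

lemma setIntegral_Iic_timeI (g : ℝ → ℝ) (t : TimeI T) :
    ∫ s in Set.Iic t, g s = ∫ r in (0 : ℝ)..t, g r := by
  rw [intervalIntegral.integral_of_le t.2.1, ← integral_Icc_eq_integral_Ioc]
  have e : MeasurableEmbedding (Subtype.val : TimeI T → ℝ) :=
    MeasurableEmbedding.subtype_coe measurableSet_Icc
  have h : (volume : Measure (TimeI T)).map Subtype.val = volume.restrict (Set.Icc 0 T) :=
    map_comap_subtype_coe measurableSet_Icc _
  have h2 := e.setIntegral_map (μ := (volume : Measure (TimeI T))) g (Set.Iic (t : ℝ))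
  rw [h, Measure.restrict_restrict measurableSet_Iic] at h2
  have h3 : Set.Iic (t : ℝ) ∩ Set.Icc 0 T = Set.Icc 0 (t : ℝ) := by
    ext r; simp only [Set.mem_inter_iff, Set.mem_Iic, Set.mem_Icc]
    exact ⟨fun h => ⟨h.2.1, h.1⟩, fun h => ⟨h.2, h.1, h.2.trans t.2.2⟩⟩
  rw [h3] at h2
  rw [h2]
  rfl

lemma prim_combDeriv (y : Fin n → ℝ) (t : TimeI T) : prim (combDeriv T y) t = comb T y t := by
  rw [prim, comb_apply]
  simp only [combDeriv]
  rw [integral_finsetSum]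
  · refine Finset.sum_congr rfl fun j _ => ?_
    rw [integral_const_mul, integral_const_mul, setIntegral_Iic_timeI
      ((Set.Ico ((j : ℕ) * T / (n : ℝ)) (((j : ℕ) + 1) * T / n)).indicator (fun _ => (1 : ℝ)))]
    rfl
  · intro j _
    have h := (integrable_combDeriv (T := T) (Pi.single j (1 : ℝ) : Fin n → ℝ)).const_mul (y j)
    refine h.integrableOn.congr (ae_of_all _ fun s => ?_)
    classical
    simp only [combDeriv]
    rw [Finset.sum_eq_single j (fun i _ hi => by rw [Pi.single_eq_of_ne hi, zero_mul]) (by simp),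
      Pi.single_eq_same, one_mul]

lemma comb_mem_cameronMartin (y : Fin n → ℝ) : comb T y ∈ cameronMartin T :=
  ⟨combDeriv T y, memLp_combDeriv y, fun t => (prim_combDeriv y t).symm⟩

lemma StepFn.stochInt_add (σ : StepFn T) (x g : Path T) :
    σ.stochInt (x + g) = σ.stochInt x + σ.stochInt g := by
  simp only [StepFn.stochInt, ContinuousMap.add_apply, ← Finset.sum_add_distrib]
  exact Finset.sum_congr rfl fun i _ => by ring

lemma StepFn.measurable_toFun (σ : StepFn T) : Measurable σ.toFun := by
  unfold StepFn.toFun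
  exact Finset.measurable_fun_sum _ fun i _ => measurable_const.indicator measurableSet_Ioc

lemma StepFn.measurable_stochInt (σ : StepFn T) : Measurable σ.stochInt := by
  unfold StepFn.stochInt
  refine Finset.measurable_fun_sum _ fun i _ => ?_
  have h : ∀ t : TimeI T, Measurable fun x : Path T => x t := fun t =>
    (continuous_eval_const t).measurable
  exact ((h _).sub (h _)).const_mul _

lemma StepFn.stochInt_comb (σ : StepFn T) (y : Fin n → ℝ) :
    σ.stochInt (comb T y) = ∫ s, σ.toFun s * combDeriv T y s := by
  simp only [StepFn.stochInt, StepFn.toFun, Finset.sum_mul]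
  have hI := integrable_combDeriv (T := T) y
  have h1 : ∀ i, (fun s => (Set.Ioc (σ.s i) (σ.t i)).indicator (fun _ => σ.a i) s *
      combDeriv T y s) = (Set.Ioc (σ.s i) (σ.t i)).indicator
        (fun s => σ.a i * combDeriv T y s) := by
    intro i; ext s
    by_cases hs : s ∈ Set.Ioc (σ.s i) (σ.t i) <;> simp [hs]
  rw [integral_finsetSum]
  · refine Finset.sum_congr rfl fun i _ => ?_
    rw [h1, integral_indicator measurableSet_Ioc, integral_const_mul]
    congr 1
    have h2 : Set.Ioc (σ.s i) (σ.t i) = Set.Iic (σ.t i) \ Set.Iic (σ.s i) := by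
      ext s; simp
    rw [← prim_combDeriv, ← prim_combDeriv, prim, prim, h2, setIntegral_sdiff measurableSet_Iic hI.integrableOn
        (Set.Iic_subset_Iic.2 (σ.s_le_t i))]
  · intro i _
    rw [h1]
    exact (hI.const_mul _).indicator measurableSet_Ioc

lemma tendsto_integral_mul_of_eLpNorm {X : Type*} [MeasurableSpace X] {μ : Measure X}
    {f : ℕ → X → ℝ} {g w : X → ℝ} (hf : ∀ m, MemLp (f m) 2 μ) (hg : MemLp g 2 μ)
    (hw : MemLp w 2 μ) (h : Tendsto (fun m => eLpNorm (fun x => f m x - g x) 2 μ) atTop (𝓝 0)) :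
    Tendsto (fun m => ∫ x, f m x * w x ∂μ) atTop (𝓝 (∫ x, g x * w x ∂μ)) := by
  refine tendsto_integral_of_L1 _ (hg.integrable_mul hw).1
    (Eventually.of_forall fun m => (hf m).integrable_mul hw) ?_
  have h2 : Tendsto (fun m => eLpNorm (fun x => f m x - g x) 2 μ * eLpNorm w 2 μ) atTop
      (𝓝 0) := by
    have := ENNReal.Tendsto.mul_const h (Or.inr hw.2.ne)
    simpa using this
  refine tendsto_of_tendsto_of_tendsto_of_le_of_le tendsto_const_nhds h2 (fun _ => zero_le)
    fun m => ?_
  have h3 := eLpNorm_smul_le_mul_eLpNorm (p := 2) (q := 2) (r := 1) hw.1 ((hf m).sub hg).1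
  refine le_trans (le_of_eq ?_) h3
  rw [eLpNorm_one_eq_lintegral_enorm]
  refine lintegral_congr fun x => ?_
  simp [sub_mul]

lemma tendstoInMeasure_of_eLpNorm_two {X : Type*} [MeasurableSpace X] {μ : Measure X}
    {f : ℕ → X → ℝ} {g : X → ℝ} (hf : ∀ m, AEStronglyMeasurable (f m) μ)
    (hg : AEStronglyMeasurable g μ)
    (h : Tendsto (fun m => eLpNorm (fun x => f m x - g x) 2 μ) atTop (𝓝 0)) :
    TendstoInMeasure μ f atTop g :=
  tendstoInMeasure_of_tendsto_eLpNorm two_ne_zero hf hg h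

/-- `δ_B h (x + g) = δ_B h (x) + ⟨h, g⟩` for `g = comb T y`. -/
lemma IsWienerIntegral.ae_comp_add {P : Measure (Path T)} (hP : IsWienerMeasure P) (hT : 0 ≤ T)
    {φ : TimeI T → ℝ} {Z : Path T → ℝ} (hZ : IsWienerIntegral P φ Z) (y : Fin n → ℝ) :
    ∀ᵐ x ∂P, Z (x + comb T y) = Z x + ∫ s, φ s * combDeriv T y s := by
  obtain ⟨hφ, hZ2, σ, hσ1, hσ2⟩ := hZ
  have hmem : ∀ m, MemLp (σ m).toFun 2 (volume : Measure (TimeI T)) := fun m => by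
    refine MemLp.of_bound (σ m).measurable_toFun.aestronglyMeasurable (∑ i, ‖(σ m).a i‖)
      (ae_of_all _ fun s => ?_)
    exact (norm_sum_le _ _).trans (Finset.sum_le_sum fun i _ =>
      norm_indicator_le_norm_self (fun _ => (σ m).a i) s)
  have hdet : Tendsto (fun m => (σ m).stochInt (comb T y)) atTop
      (𝓝 (∫ s, φ s * combDeriv T y s)) := by
    simp only [StepFn.stochInt_comb]
    exact tendsto_integral_mul_of_eLpNorm hmem hφ (memLp_combDeriv y) hσ1
  obtain ⟨ns, hns, hae⟩ := (tendstoInMeasure_of_eLpNorm_two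
    (fun m => (σ m).measurable_stochInt.aestronglyMeasurable) hZ2.1 hσ2).exists_seq_tendsto_ae
  -- The identity is exact for step functions. The subsequence converges almost surely both at `x`
  -- and, by quasi-invariance, at the shifted path, so the limits can be compared.
  filter_upwards [hae, (hP.quasiMeasurePreserving_add_comb hT y).ae hae] with x hx1 hx2
  refine tendsto_nhds_unique hx2 ?_
  simp only [StepFn.stochInt_add]
  exact hx1.add (hdet.comp hns.tendsto_atTop)

end Shift

/-! ### Second gradients of cylindrical functionals and third differences of `F`. -/

section Malliavin

variable {T : ℝ} {n : ℕ} {P : Measure (Path T)}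

namespace Cylindrical

/-- The increment of the point `(δ_B h_1, …, δ_B h_k)` under the shift by `comb T y`. -/
def shiftVec (c : Cylindrical P) (y : Fin n → ℝ) : EuclideanSpace ℝ (Fin c.k) :=
  WithLp.toLp 2 (fun i => ∫ s, c.φ i s * combDeriv T y s)

lemma integrable_mul_combDeriv (c : Cylindrical P) (i : Fin c.k) (y : Fin n → ℝ) :
    Integrable (fun s => c.φ i s * combDeriv T y s) volume :=
  (c.isWienerIntegral i).1.integrable_mul (memLp_combDeriv y)

lemma shiftVec_add (c : Cylindrical P) (y z : Fin n → ℝ) :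
    c.shiftVec (y + z) = c.shiftVec y + c.shiftVec z := by
  ext i
  simp only [shiftVec, PiLp.add_apply, combDeriv_add, mul_add]
  exact integral_add (c.integrable_mul_combDeriv i y) (c.integrable_mul_combDeriv i z)

lemma shiftVec_smul (c : Cylindrical P) (r : ℝ) (y : Fin n → ℝ) :
    c.shiftVec (r • y) = r • c.shiftVec y := by
  ext i
  simp only [shiftVec, PiLp.smul_apply, combDeriv_smul, smul_eq_mul, ← integral_const_mul]
  congr 1; ext s; ring

lemma ae_point_add (c : Cylindrical P) (hP : IsWienerMeasure P) (hT : 0 ≤ T) (y : Fin n → ℝ) :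
    ∀ᵐ x ∂P, c.point (x + comb T y) = c.point x + c.shiftVec y := by
  filter_upwards [ae_all_iff.2 fun i => (c.isWienerIntegral i).ae_comp_add hP hT y] with x hx
  ext i
  simp [point, shiftVec, hx i]

lemma aemeasurable_point (c : Cylindrical P) : AEMeasurable c.point P := by
  have h : AEMeasurable (fun x i => c.Z i x) P :=
    aemeasurable_pi_lambda _ fun i => (c.isWienerIntegral i).2.1.1.aemeasurable
  exact (WithLp.measurable_toLp 2 _).comp_aemeasurable h

lemma contDiff_f (c : Cylindrical P) (m : ℕ) : ContDiff ℝ m c.f := (c.f.smooth m)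

lemma continuous_fderiv_fderiv (c : Cylindrical P) (a b : EuclideanSpace ℝ (Fin c.k)) :
    Continuous fun z => fderiv ℝ (fderiv ℝ c.f) z a b :=
  ((((c.contDiff_f 2).fderiv_right (m := 1) le_rfl).continuous_fderiv one_ne_zero).clm_apply
      continuous_const).clm_apply continuous_const

lemma aemeasurable_val (c : Cylindrical P) : AEMeasurable c.val P :=
  c.f.continuous.measurable.comp_aemeasurable c.aemeasurable_point

lemma hess_eq (c : Cylindrical P) (x : Path T) (q : TimeI T × TimeI T) :
    c.hess x q = ∑ j, ∑ l, fderiv ℝ (fderiv ℝ c.f) (c.point x) (EuclideanSpace.single j 1)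
      (EuclideanSpace.single l 1) * (c.φ j q.1 * c.φ l q.2) := by
  simp only [hess, iteratedFDeriv_two_apply, Matrix.cons_val_zero, Matrix.cons_val_one, mul_assoc]

lemma integrable_mul_prod (c : Cylindrical P) (j l : Fin c.k) (a b : Fin n → ℝ) :
    Integrable (fun q : TimeI T × TimeI T => (c.φ j q.1 * c.φ l q.2) *
      (combDeriv T a q.1 * combDeriv T b q.2)) (volume.prod volume) := by
  refine ((c.integrable_mul_combDeriv j a).mul_prod (c.integrable_mul_combDeriv l b)).congr
    (ae_of_all _ fun q => ?_)
  simp only; ring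

lemma integrable_hess_mul (c : Cylindrical P) (x : Path T) (a b : Fin n → ℝ) :
    Integrable (fun q => c.hess x q * (combDeriv T a q.1 * combDeriv T b q.2))
      (volume.prod volume) := by
  simp only [hess_eq, Finset.sum_mul, mul_assoc]
  refine integrable_finsetSum _ fun j _ => integrable_finsetSum _ fun l _ => ?_
  have := (c.integrable_mul_prod j l a b).const_mul (fderiv ℝ (fderiv ℝ c.f) (c.point x)
    (EuclideanSpace.single j 1) (EuclideanSpace.single l 1))
  simpa only [mul_assoc] using this

lemma shiftVec_eq_sum (c : Cylindrical P) (a : Fin n → ℝ) :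
    c.shiftVec a = ∑ j, (∫ s, c.φ j s * combDeriv T a s) • EuclideanSpace.single j (1 : ℝ) := by
  ext i
  simp [shiftVec, Finset.sum_apply, Pi.single_apply]

/-- By Fubini each term of the density pairs to a product of two integrals, and bilinearity
reassembles these into the vectors `shiftVec`. The pairing is thus a genuine second derivative, to
which Taylor's formula applies. -/
lemma pairing_hess (c : Cylindrical P) (x : Path T) (a b : Fin n → ℝ) :
    pairing (c.hess x) (combDeriv T a) (combDeriv T b) =
      fderiv ℝ (fderiv ℝ c.f) (c.point x) (c.shiftVec a) (c.shiftVec b) := by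
  have hi : ∀ j l, Integrable (fun q : TimeI T × TimeI T => fderiv ℝ (fderiv ℝ c.f) (c.point x)
      (EuclideanSpace.single j 1) (EuclideanSpace.single l 1) * (c.φ j q.1 * (c.φ l q.2 *
        (combDeriv T a q.1 * combDeriv T b q.2)))) (volume.prod volume) := fun j l => by
    simpa only [mul_assoc] using (c.integrable_mul_prod j l a b).const_mul
      (fderiv ℝ (fderiv ℝ c.f) (c.point x) (EuclideanSpace.single j 1) (EuclideanSpace.single l 1))
  rw [pairing, c.shiftVec_eq_sum a, c.shiftVec_eq_sum b]
  simp only [hess_eq, Finset.sum_mul, mul_assoc, map_sum, map_smul, sum_apply,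
    smul_apply, smul_eq_mul, Finset.mul_sum]
  conv_rhs => rw [Finset.sum_comm]
  rw [integral_finsetSum _ fun j _ => integrable_finsetSum _ fun l _ => hi j l]
  refine Finset.sum_congr rfl fun j _ => ?_
  rw [integral_finsetSum _ fun l _ => hi j l]
  refine Finset.sum_congr rfl fun l _ => ?_
  rw [integral_const_mul]
  have h : ∫ q : TimeI T × TimeI T, c.φ j q.1 * (c.φ l q.2 * (combDeriv T a q.1 *
      combDeriv T b q.2)) ∂(volume.prod volume) =
      (∫ s, c.φ j s * combDeriv T a s) * ∫ s, c.φ l s * combDeriv T b s := by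
    rw [← integral_prod_mul]
    congr 1; ext q; ring
  rw [h]; ring

lemma aemeasurable_hess [SFinite P] (c : Cylindrical P) :
    AEMeasurable (fun z : Path T × TimeI T × TimeI T => c.hess z.1 z.2)
      (P.prod (volume.prod volume)) := by
  simp only [hess_eq]
  have hφ : ∀ j, AEMeasurable (c.φ j) volume := fun j =>
    (c.isWienerIntegral j).1.1.aemeasurable
  refine Finset.aemeasurable_fun_sum _ fun j _ => Finset.aemeasurable_fun_sum _ fun l _ => ?_
  refine AEMeasurable.mul ?_ (AEMeasurable.mul ?_ ?_)
  · exact ((c.continuous_fderiv_fderiv _ _).measurable.comp_aemeasurable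
      c.aemeasurable_point).comp_quasiMeasurePreserving Measure.quasiMeasurePreserving_fst
  · exact (hφ j).comp_quasiMeasurePreserving
      (Measure.quasiMeasurePreserving_fst.comp Measure.quasiMeasurePreserving_snd)
  · exact (hφ l).comp_quasiMeasurePreserving
      (Measure.quasiMeasurePreserving_snd.comp Measure.quasiMeasurePreserving_snd)

lemma ae_val_add (c : Cylindrical P) (hP : IsWienerMeasure P) (hT : 0 ≤ T) (y : Fin n → ℝ) :
    ∀ᵐ x ∂P, c.val (x + comb T y) = c.f (c.point x + c.shiftVec y) := by
  filter_upwards [c.ae_point_add hP hT y] with x hx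
  rw [val, hx]

/-- The seven nontrivial shifts each act on `point` by a translation off a null set, which transfers
the third difference from path space to a Euclidean space. -/
lemma ae_delta3_val (c : Cylindrical P) (hP : IsWienerMeasure P) (hT : 0 ≤ T)
    (a b g : Fin n → ℝ) :
    ∀ᵐ x ∂P, delta3 c.val x (comb T a) (comb T b) (comb T g) =
      delta3 c.f (c.point x) (c.shiftVec a) (c.shiftVec b) (c.shiftVec g) := by
  have h := fun y : Fin n → ℝ => c.ae_val_add hP hT y
  filter_upwards [h (g + a + b), h (g + a), h (g + b), h g, h (a + b), h a, h b]
    with x h1 h2 h3 h4 h5 h6 h7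
  simp only [comb_add, shiftVec_add] at h1 h2 h3 h5
  simp only [delta3, h1, h2, h3, h4, h5, h6, h7]
  rfl

/-- The second derivative of a cylindrical functional along `comb T a` and `comb T b`, at the
point shifted by `comb T y`. -/
def hessShift (c : Cylindrical P) (a b : Fin n → ℝ) (z : EuclideanSpace ℝ (Fin c.k))
    (y : Fin n → ℝ) : ℝ :=
  fderiv ℝ (fderiv ℝ c.f) (z + c.shiftVec y) (c.shiftVec a) (c.shiftVec b)

/-- Along the path, the increment of the cylindrical second derivative is that of `h`, at most `B`,
plus the errors at the two shifted points. Hypothesis `hC` controls the `L¹` norms of these errors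
by the unshifted `L²` error. Keeping only the excess over `B` makes this bound tend to zero with the
error. -/
lemma lintegral_hessShift_sub_le (c : Cylindrical P) (hP : IsWienerMeasure P) (hT : 0 ≤ T)
    (a b g y : Fin n → ℝ) {C B : ℝ≥0∞}
    (hC : ∀ z ∈ ({y, g + y} : Set (Fin n → ℝ)), ∀ Φ : Path T → ℝ≥0∞, Measurable Φ →
      ∫⁻ x, Φ (x + comb T z) ∂P ≤ C * (∫⁻ x, Φ x ^ (2 : ℝ) ∂P) ^ (1 / 2 : ℝ))
    {h : Path T → ℝ} (hh : AEMeasurable h P)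
    (hB : ∀ᵐ x ∂P, ‖h (x + comb T (g + y)) - h (x + comb T y)‖ₑ ≤ B) :
    ∫⁻ x, (‖c.hessShift a b (c.point x) (g + y) - c.hessShift a b (c.point x) y‖ₑ - B) ∂P ≤
      2 * (C * (∫⁻ x, ‖pairing (c.hess x) (combDeriv T a) (combDeriv T b) - h x‖ₑ ^ (2 : ℝ) ∂P)
        ^ (1 / 2 : ℝ)) := by
  set H : Path T → ℝ := fun x => pairing (c.hess x) (combDeriv T a) (combDeriv T b) with hH
  have hJH : ∀ y : Fin n → ℝ, ∀ᵐ x ∂P, c.hessShift a b (c.point x) y = H (x + comb T y) :=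
    fun y => by
      filter_upwards [c.ae_point_add hP hT y] with x hx
      simp only [hessShift, hH, pairing_hess, hx]
  have hHm : AEMeasurable H P := by
    simp only [hH, pairing_hess]
    exact (c.continuous_fderiv_fderiv _ _).measurable.comp_aemeasurable c.aemeasurable_point
  obtain ⟨Φ, hΦm, hΦ⟩ : AEMeasurable (fun x => ‖H x - h x‖ₑ) P := (hHm.sub hh).enorm
  have hΦ2 : ∫⁻ x, Φ x ^ (2 : ℝ) ∂P = ∫⁻ x, ‖H x - h x‖ₑ ^ (2 : ℝ) ∂P :=
    lintegral_congr_ae (hΦ.mono fun x hx => by simp only [hx])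
  rw [← hΦ2, two_mul]
  refine le_trans ?_ (add_le_add (hC (g + y) (by simp) Φ hΦm) (hC y (by simp) Φ hΦm))
  have hm : Measurable fun x => Φ (x + comb T (g + y)) :=
    hΦm.comp (hP.quasiMeasurePreserving_add_comb hT _).measurable
  rw [← lintegral_add_left hm]
  refine lintegral_mono_ae ?_
  filter_upwards [hJH (g + y), hJH y, hB,
    (hP.quasiMeasurePreserving_add_comb hT (g + y)).ae hΦ,
    (hP.quasiMeasurePreserving_add_comb hT y).ae hΦ] with x h1 h2 h3 h4 h5
  rw [h1, h2, ← h4, ← h5, tsub_le_iff_right]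
  set A1 := x + comb T (g + y)
  set A2 := x + comb T y
  calc ‖H A1 - H A2‖ₑ = ‖(H A1 - h A1) - (H A2 - h A2) + (h A1 - h A2)‖ₑ := by
        congr 1; ring
    _ ≤ ‖(H A1 - h A1) - (H A2 - h A2)‖ₑ + ‖h A1 - h A2‖ₑ := enorm_add_le _ _
    _ ≤ _ := by gcongr; exact enorm_sub_le

lemma continuous_hessShift (c : Cylindrical P) (a b : Fin n → ℝ) (g u v : Fin n → ℝ) :
    Continuous fun q : (EuclideanSpace ℝ (Fin c.k) × ℝ) × ℝ =>
      c.hessShift a b q.1.1 (g + (q.2 • u + q.1.2 • v)) := by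
  simp only [hessShift, shiftVec_add, shiftVec_smul]
  exact (c.continuous_fderiv_fderiv _ _).comp (by fun_prop)

end Cylindrical

/-- Jensen's inequality for the convex function `x ↦ (x - B)₊` on an interval of length one. -/
lemma lintegral_unit_sub_le (G : ℝ → ℝ≥0∞) (B : ℝ≥0∞) :
    (∫⁻ r in Set.Ioc (0 : ℝ) 1, G r) - B ≤ ∫⁻ r in Set.Ioc (0 : ℝ) 1, (G r - B) := by
  rw [tsub_le_iff_right]
  calc ∫⁻ r in Set.Ioc (0 : ℝ) 1, G r ≤ ∫⁻ r in Set.Ioc (0 : ℝ) 1, ((G r - B) + B) :=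
        lintegral_mono fun r => le_tsub_add
    _ = _ := by rw [lintegral_add_right _ measurable_const]; simp

/-- All intermediate points of the double integral lie in one box, so a single shift constant serves
every `r` and `s`. -/
lemma abs_combination_le (a b g : Fin n → ℝ) {r s : ℝ} (hr : r ∈ Set.Ioc (0 : ℝ) 1)
    (hs : s ∈ Set.Ioc (0 : ℝ) 1) (j : Fin n) :
    |(r • a + s • b) j| ≤ ∑ i, (|a i| + |b i| + |g i|) ∧
      |(g + (r • a + s • b)) j| ≤ ∑ i, (|a i| + |b i| + |g i|) := by
  have e : |a j| + |b j| + |g j| ≤ ∑ i, (|a i| + |b i| + |g i|) :=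
    Finset.single_le_sum (f := fun i => |a i| + |b i| + |g i|) (fun i _ => by positivity)
      (Finset.mem_univ j)
  have e1 : |r * a j| ≤ |a j| := by
    rw [abs_mul, abs_of_pos hr.1]; exact mul_le_of_le_one_left (abs_nonneg _) hr.2
  have e2 : |s * b j| ≤ |b j| := by
    rw [abs_mul, abs_of_pos hs.1]; exact mul_le_of_le_one_left (abs_nonneg _) hs.2
  simp only [Pi.add_apply, Pi.smul_apply, smul_eq_mul]
  have h1 := abs_add_le (r * a j) (s * b j)
  have h2 := abs_add_le (g j) (r * a j + s * b j)
  have h3 := abs_nonneg (g j)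
  constructor <;> linarith

/-- The excess over `B` of the third differences of a cylindrical functional, when its second
gradient is close to one whose increments are bounded by `B`. -/
lemma Cylindrical.lintegral_delta3_sub_le (c : Cylindrical P) (hP : IsWienerMeasure P)
    (hT : 0 ≤ T) (a b g : Fin n → ℝ) {C B : ℝ≥0∞}
    (hC : ∀ y : Fin n → ℝ, (∀ j, |y j| ≤ ∑ i, (|a i| + |b i| + |g i|)) →
      ∀ Φ : Path T → ℝ≥0∞, Measurable Φ →
      ∫⁻ x, Φ (x + comb T y) ∂P ≤ C * (∫⁻ x, Φ x ^ (2 : ℝ) ∂P) ^ (1 / 2 : ℝ))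
    {h : Path T → ℝ} (hh : AEMeasurable h P)
    (hB : ∀ y : Fin n → ℝ, ∀ᵐ x ∂P, ‖h (x + comb T (g + y)) - h (x + comb T y)‖ₑ ≤ B) :
    ∫⁻ x, (‖delta3 c.val x (comb T a) (comb T b) (comb T g)‖ₑ - B) ∂P ≤
      2 * (C * (∫⁻ x, ‖pairing (c.hess x) (combDeriv T a) (combDeriv T b) - h x‖ₑ ^ (2 : ℝ) ∂P)
        ^ (1 / 2 : ℝ)) := by
  have := hP.isProb
  set W := 2 * (C * (∫⁻ x, ‖pairing (c.hess x) (combDeriv T a) (combDeriv T b) - h x‖ₑ ^ (2 : ℝ)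
    ∂P) ^ (1 / 2 : ℝ)) with hW
  set Ψ : EuclideanSpace ℝ (Fin c.k) → ℝ → ℝ → ℝ≥0∞ := fun z s r =>
    ‖c.hessShift a b z (g + (r • a + s • b)) - c.hessShift a b z (r • a + s • b)‖ₑ - B with hΨ
  have key : ∀ r ∈ Set.Ioc (0 : ℝ) 1, ∀ s ∈ Set.Ioc (0 : ℝ) 1,
      ∫⁻ x, Ψ (c.point x) s r ∂P ≤ W := by
    intro r hr s hs
    refine c.lintegral_hessShift_sub_le hP hT a b g (r • a + s • b) ?_ hh (hB _)
    rintro z (rfl | rfl)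
    · exact hC _ fun j => (abs_combination_le a b g hr hs j).1
    · exact hC _ fun j => (abs_combination_le a b g hr hs j).2
  have hΨm : Measurable fun q : (EuclideanSpace ℝ (Fin c.k) × ℝ) × ℝ => Ψ q.1.1 q.1.2 q.2 := by
    have h0 := c.continuous_hessShift a b 0 a b
    simp only [zero_add] at h0
    exact (((c.continuous_hessShift a b g a b).sub h0).measurable.enorm).sub measurable_const
  clear_value Ψ
  -- Joint measurability in the point and in `r`, `s` is available on the Euclidean space, so
  -- Tonelli is applied under the law of `point`.
  set κ := P.map c.point with hκ
  have hκp : IsProbabilityMeasure κ := Measure.isProbabilityMeasure_map c.aemeasurable_point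
  have hm2 : Measurable fun q : EuclideanSpace ℝ (Fin c.k) × ℝ =>
      ∫⁻ r in Set.Ioc (0 : ℝ) 1, Ψ q.1 q.2 r := Measurable.lintegral_prod_right' hΨm
  have hm3 : Measurable fun z : EuclideanSpace ℝ (Fin c.k) =>
      ∫⁻ s in Set.Ioc (0 : ℝ) 1, ∫⁻ r in Set.Ioc (0 : ℝ) 1, Ψ z s r :=
    Measurable.lintegral_prod_right' hm2
  calc ∫⁻ x, (‖delta3 c.val x (comb T a) (comb T b) (comb T g)‖ₑ - B) ∂P
      ≤ ∫⁻ x, (∫⁻ s in Set.Ioc (0 : ℝ) 1, ∫⁻ r in Set.Ioc (0 : ℝ) 1, Ψ (c.point x) s r) ∂P := by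
        refine lintegral_mono_ae ?_
        filter_upwards [c.ae_delta3_val hP hT a b g] with x hx
        rw [hx]
        refine (tsub_le_tsub_right (enorm_delta3_le (c.contDiff_f 2) _ _ _ _) B).trans ?_
        refine (lintegral_unit_sub_le _ _).trans (lintegral_mono fun s =>
          (lintegral_unit_sub_le _ _).trans (le_of_eq ?_))
        refine lintegral_congr fun r => ?_
        simp only [hΨ, hessShift, shiftVec_add, shiftVec_smul]
    _ = ∫⁻ z, (∫⁻ s in Set.Ioc (0 : ℝ) 1, ∫⁻ r in Set.Ioc (0 : ℝ) 1, Ψ z s r) ∂κ := by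
        rw [hκ, lintegral_map' hm3.aemeasurable c.aemeasurable_point]
    _ = ∫⁻ s in Set.Ioc (0 : ℝ) 1, ∫⁻ r in Set.Ioc (0 : ℝ) 1, ∫⁻ z, Ψ z s r ∂κ := by
        rw [lintegral_lintegral_swap hm2.aemeasurable]
        refine lintegral_congr fun s => ?_
        rw [lintegral_lintegral_swap]
        have hq : Measurable fun q : EuclideanSpace ℝ (Fin c.k) × ℝ => ((q.1, s), q.2) := by
          fun_prop
        exact (hΨm.comp hq).aemeasurable
    _ ≤ ∫⁻ s in Set.Ioc (0 : ℝ) 1, ∫⁻ r in Set.Ioc (0 : ℝ) 1, W := by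
        refine setLIntegral_mono' measurableSet_Ioc fun s hs =>
          setLIntegral_mono' measurableSet_Ioc fun r hr => ?_
        have hq : Measurable fun z : EuclideanSpace ℝ (Fin c.k) => ((z, s), r) := by fun_prop
        have hm : Measurable fun z => Ψ z s r := hΨm.comp hq
        rw [hκ, lintegral_map' hm.aemeasurable c.aemeasurable_point]
        exact key r hr s hs
    _ = W := by simp

/-- The pairing of the second gradient depends continuously on the second gradient in `L²`. -/
lemma lintegral_pairing_sub_le [SFinite P] {D2 : Path T → TimeI T × TimeI T → ℝ}
    (hD2 : AEMeasurable (fun z : Path T × (TimeI T × TimeI T) => D2 z.1 z.2)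
      (P.prod (volume.prod volume)))
    (hD2x : ∀ᵐ x ∂P, MemLp (D2 x) 2 (volume.prod volume)) (c : Cylindrical P) (a b : Fin n → ℝ) :
    ∫⁻ x, ‖pairing (c.hess x) (combDeriv T a) (combDeriv T b) -
        pairing (D2 x) (combDeriv T a) (combDeriv T b)‖ₑ ^ (2 : ℝ) ∂P ≤
      (∫⁻ q : TimeI T × TimeI T, ‖combDeriv T a q.1 * combDeriv T b q.2‖ₑ ^ (2 : ℝ)
        ∂(volume.prod volume)) *
      eLpNorm (fun z : Path T × (TimeI T × TimeI T) => c.hess z.1 z.2 - D2 z.1 z.2) 2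
        (P.prod (volume.prod volume)) ^ (2 : ℝ) := by
  set w : TimeI T × TimeI T → ℝ := fun q => combDeriv T a q.1 * combDeriv T b q.2 with hw
  have hwm : Measurable w := by
    have h1 := measurable_combDeriv (T := T) a
    have h2 := measurable_combDeriv (T := T) b
    fun_prop
  have hwL : MemLp w 2 (volume.prod volume) := by
    refine MemLp.of_bound hwm.aestronglyMeasurable
      ((∑ j, |a j| * √(n / T)) * (∑ j, |b j| * √(n / T))) (ae_of_all _ fun q => ?_)
    rw [hw, Real.norm_eq_abs, abs_mul]
    exact mul_le_mul (abs_combDeriv_le a _) (abs_combDeriv_le b _) (abs_nonneg _) (by positivity)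
  have hdiff : AEMeasurable (fun z : Path T × (TimeI T × TimeI T) => c.hess z.1 z.2 - D2 z.1 z.2)
      (P.prod (volume.prod volume)) := c.aemeasurable_hess.sub hD2
  have hsec : ∀ᵐ x ∂P, AEMeasurable (fun q => c.hess x q - D2 x q) (volume.prod volume) := by
    have := hdiff.aestronglyMeasurable.prodMk_left
    filter_upwards [this] with x hx using hx.aemeasurable
  calc ∫⁻ x, ‖pairing (c.hess x) (combDeriv T a) (combDeriv T b) -
        pairing (D2 x) (combDeriv T a) (combDeriv T b)‖ₑ ^ (2 : ℝ) ∂P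
      ≤ ∫⁻ x, (∫⁻ q, ‖w q‖ₑ ^ (2 : ℝ) ∂(volume.prod volume)) *
          ∫⁻ q, ‖c.hess x q - D2 x q‖ₑ ^ (2 : ℝ) ∂(volume.prod volume) ∂P := by
        refine lintegral_mono_ae ?_
        filter_upwards [hD2x, hsec] with x hx hxm
        have e : pairing (c.hess x) (combDeriv T a) (combDeriv T b) -
            pairing (D2 x) (combDeriv T a) (combDeriv T b) =
            ∫ q, (w q * (c.hess x q - D2 x q)) ∂(volume.prod volume) := by
          have hi : Integrable (fun q => D2 x q * (combDeriv T a q.1 * combDeriv T b q.2))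
            (volume.prod volume) := hx.integrable_mul hwL
          rw [pairing, pairing, ← integral_sub (c.integrable_hess_mul x a b) hi]
          congr 1; ext q; simp only [hw]; ring
        rw [e]
        have h1 : ‖∫ q, (w q * (c.hess x q - D2 x q)) ∂(volume.prod volume)‖ₑ ≤
            (∫⁻ q, ‖w q‖ₑ ^ (2 : ℝ) ∂(volume.prod volume)) ^ (1 / 2 : ℝ) *
            (∫⁻ q, ‖c.hess x q - D2 x q‖ₑ ^ (2 : ℝ) ∂(volume.prod volume)) ^ (1 / 2 : ℝ) := by
          refine (enorm_integral_le_lintegral_enorm _).trans ?_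
          simp only [enorm_mul]
          -- Cauchy-Schwarz in the two time variables, for almost every fixed path.
          exact ENNReal.lintegral_mul_le_Lp_mul_Lq _ Real.HolderConjugate.two_two
            hwm.enorm.aemeasurable hxm.enorm
        refine (ENNReal.rpow_le_rpow h1 zero_le_two).trans (le_of_eq ?_)
        rw [ENNReal.mul_rpow_of_nonneg _ _ zero_le_two, ← ENNReal.rpow_mul, ← ENNReal.rpow_mul]
        norm_num
    _ = _ := by
        have hfin : ∫⁻ q, ‖w q‖ₑ ^ (2 : ℝ) ∂(volume.prod volume) ≠ ∞ := by
          have := (eLpNorm_lt_top_iff_lintegral_rpow_enorm_lt_top two_ne_zero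
            ENNReal.ofNat_ne_top).1 hwL.2
          simpa using this.ne
        rw [lintegral_const_mul' _ _ hfin]
        congr 1
        rw [eLpNorm_eq_lintegral_rpow_enorm_toReal two_ne_zero ENNReal.ofNat_ne_top,
          ENNReal.toReal_ofNat, ← ENNReal.rpow_mul,
          lintegral_prod _ (hdiff.enorm.pow_const _)]
        norm_num

/-- The almost sure bound on third order differences of a functional of class `Σ_{η,p}`. -/
lemma ae_enorm_delta3_le (hP : IsWienerMeasure P) (hT : 0 < T) {η p : ℝ} (hp : 1 ≤ p)
    (hηp : 1 / p < η) (hη : η < 1 / 2) (hn : 0 < n) {F : Path T → ℝ}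
    {D1 : Path T → TimeI T → ℝ} {D2 : Path T → TimeI T × TimeI T → ℝ}
    (hF : IsGrossSobolev P F D1 D2)
    (hD2 : ∀ x ∈ sobSpace T η p, MemLp (D2 x) 2 (volume.prod volume))
    (hB : ∀ x ∈ sobSpace T η p, ∀ g ∈ sobSpace T η p, g ∈ cameronMartin T →
        ∀ φ ψ : TimeI T → ℝ, MemLp φ 2 volume → MemLp ψ 2 volume →
          ENNReal.ofReal |pairing (D2 x - D2 (x + g)) φ ψ| ≤
            sobNorm η p g * eLpNorm (prim φ) 2 volume * eLpNorm (prim ψ) 2 volume)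
    (a b g : Fin n → ℝ) :
    ∀ᵐ x ∂P, ‖delta3 F x (comb T a) (comb T b) (comb T g)‖ₑ ≤
      sobNorm η p (comb T g) * eLpNorm (comb T a) 2 volume * eLpNorm (comb T b) 2 volume := by
  have := hP.isProb
  obtain ⟨hF2, -, hD22, c, hc1, -, hc3⟩ := hF
  have hmem : ∀ y : Fin n → ℝ, comb T y ∈ sobSpace T η p := comb_mem_sobSpace hT hp hηp hη hn
  have hae := hP.ae_mem_sobSpace hT hp hη
  have hD2x : ∀ᵐ x ∂P, MemLp (D2 x) 2 (volume.prod volume) := hae.mono fun x hx => hD2 x hx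
  have hwL : MemLp (fun q : TimeI T × TimeI T => combDeriv T a q.1 * combDeriv T b q.2) 2
      (volume.prod volume) := by
    have h1 := measurable_combDeriv (T := T) a
    have h2 := measurable_combDeriv (T := T) b
    refine MemLp.of_bound (Measurable.aestronglyMeasurable (by fun_prop))
      ((∑ j, |a j| * √(n / T)) * (∑ j, |b j| * √(n / T))) (ae_of_all _ fun q => ?_)
    rw [Real.norm_eq_abs, abs_mul]
    exact mul_le_mul (abs_combDeriv_le a _) (abs_combDeriv_le b _) (abs_nonneg _) (by positivity)
  set h : Path T → ℝ := fun x => pairing (D2 x) (combDeriv T a) (combDeriv T b) with hh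
  have hhm : AEMeasurable h P := by
    refine AEStronglyMeasurable.aemeasurable ?_
    refine AEStronglyMeasurable.integral_prod_right' (f := fun z : Path T × (TimeI T × TimeI T) =>
      D2 z.1 z.2 * (combDeriv T a z.2.1 * combDeriv T b z.2.2)) ?_
    refine hD22.1.mul (Measurable.aestronglyMeasurable ?_)
    have h1 := measurable_combDeriv (T := T) a
    have h2 := measurable_combDeriv (T := T) b
    fun_prop
  set B := sobNorm η p (comb T g) * eLpNorm (comb T a) 2 volume *
    eLpNorm (comb T b) 2 volume with hBdef
  have hprim : ∀ y : Fin n → ℝ, prim (combDeriv T y) = comb T y := fun y =>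
    funext fun t => prim_combDeriv y t
  -- Every `y` is needed, because the increment by `comb T g` is taken at all intermediate points of
  -- the double integral.
  have hBh : ∀ y : Fin n → ℝ, ∀ᵐ x ∂P, ‖h (x + comb T (g + y)) - h (x + comb T y)‖ₑ ≤ B := by
    intro y
    filter_upwards [hae] with x hx
    have hx1 : x + comb T y ∈ sobSpace T η p := add_mem_sobSpace hp hx (hmem y)
    have hx2 : x + comb T y + comb T g ∈ sobSpace T η p := add_mem_sobSpace hp hx1 (hmem g)
    have e := hB _ hx1 _ (hmem g) (comb_mem_cameronMartin g) _ _ (memLp_combDeriv a)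
      (memLp_combDeriv b)
    rw [hprim, hprim] at e
    refine le_trans (le_of_eq ?_) e
    rw [Real.enorm_eq_ofReal_abs, abs_sub_comm]
    congr 2
    have e2 : x + comb T (g + y) = x + comb T y + comb T g := by rw [comb_add]; abel
    rw [e2, hh]
    simp only [pairing]
    have hi : ∀ z ∈ sobSpace T η p, Integrable (fun q => D2 z q *
        (combDeriv T a q.1 * combDeriv T b q.2)) (volume.prod volume) :=
      fun z hz => (hD2 z hz).integrable_mul hwL
    rw [← integral_sub (hi _ hx1) (hi _ hx2)]
    congr 1; ext q; simp only [Pi.sub_apply]; ring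
  obtain ⟨C, hC, hCb⟩ := hP.exists_lintegral_shift_le hT.le n (∑ i, (|a i| + |b i| + |g i|))
  set K := ∫⁻ q : TimeI T × TimeI T, ‖combDeriv T a q.1 * combDeriv T b q.2‖ₑ ^ (2 : ℝ)
        ∂(volume.prod volume) with hK
  have hKtop : K ≠ ∞ := by
    have := (eLpNorm_lt_top_iff_lintegral_rpow_enorm_lt_top two_ne_zero
      ENNReal.ofNat_ne_top).1 hwL.2
    simp only [ENNReal.toReal_ofNat] at this
    exact this.ne
  set N : ℕ → ℝ≥0∞ := fun m => eLpNorm (fun z : Path T × (TimeI T × TimeI T) =>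
      (c m).hess z.1 z.2 - D2 z.1 z.2) 2 (P.prod (volume.prod volume)) with hN
  have hexc : ∀ m, ∫⁻ x, (‖delta3 (c m).val x (comb T a) (comb T b) (comb T g)‖ₑ - B) ∂P ≤
      2 * (C * (K * N m ^ (2 : ℝ)) ^ (1 / 2 : ℝ)) := fun m => by
    refine ((c m).lintegral_delta3_sub_le hP hT.le a b g hCb hhm hBh).trans ?_
    gcongr
    exact lintegral_pairing_sub_le hD22.1.aemeasurable hD2x (c m) a b
  have hlim0 : Tendsto (fun m => 2 * (C * (K * N m ^ (2 : ℝ)) ^ (1 / 2 : ℝ))) atTop (𝓝 0) := by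
    have t1 : Tendsto (fun m => N m ^ (2 : ℝ)) atTop (𝓝 0) := by
      simpa using hc3.ennrpow_const 2
    have t2 : Tendsto (fun m => K * N m ^ (2 : ℝ)) atTop (𝓝 0) := by
      simpa using ENNReal.Tendsto.const_mul t1 (Or.inr hKtop)
    have t3 : Tendsto (fun m => (K * N m ^ (2 : ℝ)) ^ (1 / 2 : ℝ)) atTop (𝓝 0) := by
      simpa using t2.ennrpow_const (1 / 2)
    have t4 : Tendsto (fun m => C * (K * N m ^ (2 : ℝ)) ^ (1 / 2 : ℝ)) atTop (𝓝 0) := by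
      simpa using ENNReal.Tendsto.const_mul t3 (Or.inr hC)
    simpa using ENNReal.Tendsto.const_mul t4 (Or.inr ENNReal.ofNat_ne_top)
  obtain ⟨ns, hns, hns2⟩ := (tendstoInMeasure_of_eLpNorm_two
    (fun m => (c m).aemeasurable_val.aestronglyMeasurable) hF2.1 hc1).exists_seq_tendsto_ae
  have hshift : ∀ y : Fin n → ℝ, ∀ᵐ x ∂P, Tendsto (fun i => (c (ns i)).val (x + comb T y)) atTop
      (𝓝 (F (x + comb T y))) := fun y => (hP.quasiMeasurePreserving_add_comb hT.le y).ae hns2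
  have hconv : ∀ᵐ x ∂P, Tendsto (fun i =>
      ‖delta3 (c (ns i)).val x (comb T a) (comb T b) (comb T g)‖ₑ - B) atTop
      (𝓝 (‖delta3 F x (comb T a) (comb T b) (comb T g)‖ₑ - B)) := by
    filter_upwards [hshift (g + a + b), hshift (g + a), hshift (g + b), hshift g,
      hshift (a + b), hshift a, hshift b, hns2] with x h1 h2 h3 h4 h5 h6 h7 h8
    simp only [comb_add] at h1 h2 h3 h5
    refine ENNReal.Tendsto.sub (Tendsto.enorm ?_) tendsto_const_nhds (Or.inl enorm_ne_top)
    exact (((h1.sub h2).sub h3).add h4).sub (((h5.sub h6).sub h7).add h8)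
  have hmeas : ∀ V : Path T → ℝ, AEMeasurable V P → AEMeasurable
      (fun x => ‖delta3 V x (comb T a) (comb T b) (comb T g)‖ₑ - B) P := by
    intro V hV
    have hs : ∀ y : Fin n → ℝ, AEMeasurable (fun x => V (x + comb T y)) P := fun y =>
      hV.comp_quasiMeasurePreserving (hP.quasiMeasurePreserving_add_comb hT.le y)
    refine AEMeasurable.sub (AEMeasurable.enorm ?_) aemeasurable_const
    have h1 := hs (g + a + b)
    have h2 := hs (g + a)
    have h3 := hs (g + b)
    have h5 := hs (a + b)
    simp only [comb_add] at h1 h2 h3 h5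
    exact (((h1.sub h2).sub h3).add (hs g)).sub (((h5.sub (hs a)).sub (hs b)).add hV)
  -- Fatou's lemma along an almost surely convergent subsequence: the excess over `B` of the limit
  -- is bounded by the limit of the excesses, which is `0`.
  have hzero : ∫⁻ x, (‖delta3 F x (comb T a) (comb T b) (comb T g)‖ₑ - B) ∂P = 0 := by
    have h1 : ∫⁻ x, (‖delta3 F x (comb T a) (comb T b) (comb T g)‖ₑ - B) ∂P ≤
        liminf (fun i => ∫⁻ x, (‖delta3 (c (ns i)).val x (comb T a) (comb T b) (comb T g)‖ₑ - B)
          ∂P) atTop := by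
      refine le_trans (le_of_eq ?_) (lintegral_liminf_le' fun i => hmeas _
        (c (ns i)).aemeasurable_val)
      refine lintegral_congr_ae ?_
      filter_upwards [hconv] with x hx
      exact hx.liminf_eq.symm
    have h2 : Tendsto (fun i => ∫⁻ x, (‖delta3 (c (ns i)).val x (comb T a) (comb T b)
        (comb T g)‖ₑ - B) ∂P) atTop (𝓝 0) :=
      tendsto_of_tendsto_of_tendsto_of_le_of_le tendsto_const_nhds
        (hlim0.comp hns.tendsto_atTop) (fun _ => zero_le) fun i => hexc (ns i)
    rw [h2.liminf_eq] at h1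
    exact le_antisymm h1 zero_le
  rw [lintegral_eq_zero_iff' (hmeas F hF2.1.aemeasurable)] at hzero
  filter_upwards [hzero] with x hx
  simpa [tsub_eq_zero_iff_le] using hx

/-- A third difference evaluates the function at eight points. -/
lemma abs_delta3_sub_le {E : Type*} [Add E] {f f' : E → ℝ} {x a b c : E} {ε : ℝ}
    (h : ∀ z, |f z - f' z| ≤ ε) : |delta3 f x a b c - delta3 f' x a b c| ≤ 8 * ε := by
  have h1 := h (x + (c + a + b))
  have h2 := h (x + (c + a))
  have h3 := h (x + (c + b))
  have h4 := h (x + c)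
  have h5 := h (x + (a + b))
  have h6 := h (x + a)
  have h7 := h (x + b)
  have h8 := h x
  simp only [delta3]
  rw [abs_le] at *
  constructor <;> linarith [h1.1, h1.2, h2.1, h2.2, h3.1, h3.2, h4.1, h4.2, h5.1, h5.2, h6.1,
    h6.2, h7.1, h7.2, h8.1, h8.2]

/-- Third order differences of `y ↦ F (comb y)` for `F` of class `Σ_{η,p}`. -/
lemma ofReal_abs_delta3_comb_le (hP : IsWienerMeasure P) (hT : 0 < T) {η p : ℝ} (hp : 1 ≤ p)
    (hηp : 1 / p < η) (hη : η < 1 / 2) (hn : 0 < n) {F : Path T → ℝ}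
    (hF : F ∈ SigmaClass T η p P) (y a b g : Fin n → ℝ) :
    ENNReal.ofReal |delta3 (fun z => F (comb T z)) y a b g| ≤
      sobNorm η p (comb T g) * eLpNorm (comb T a) 2 volume * eLpNorm (comb T b) 2 volume := by
  obtain ⟨hLip, D1, D2, hGS, hD2, hB⟩ := hF
  set B := sobNorm η p (comb T g) * eLpNorm (comb T a) 2 volume *
    eLpNorm (comb T b) 2 volume with hBdef
  have hmem : ∀ y : Fin n → ℝ, comb T y ∈ sobSpace T η p := comb_mem_sobSpace hT hp hηp hη hn
  have hae := (hP.quasiMeasurePreserving_add_comb hT.le y).ae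
    (ae_enorm_delta3_le hP hT hp hηp hη hn hGS hD2 hB a b g)
  refine ENNReal.le_of_forall_pos_le_add fun ε hε _ => ?_
  have hε8 : (0 : ℝ≥0∞) < (ε / 8 : ℝ≥0) := by
    rw [ENNReal.coe_pos]; positivity
  have hpos := hP.measure_sobNorm_lt_pos hT hp hη hε8
  -- A set of positive measure meets a set of full measure: some path of norm below `ε/8` also
  -- satisfies the almost sure bound. The eight evaluations then cost at most `ε`.
  obtain ⟨x, hx1, hx2⟩ : ∃ x : Path T, sobNorm η p x < (ε / 8 : ℝ≥0) ∧
      ‖delta3 F (x + comb T y) (comb T a) (comb T b) (comb T g)‖ₑ ≤ B := by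
    by_contra! hcon
    have : ∀ᵐ x ∂P, ¬ sobNorm η p x < (ε / 8 : ℝ≥0) := by
      filter_upwards [hae] with x hx hlt
      exact absurd hx (not_le.2 (hcon x hlt))
    rw [ae_iff] at this
    simp only [not_not] at this
    exact hpos.ne' this
  have hxs : x ∈ sobSpace T η p := hx1.trans ENNReal.coe_lt_top
  have hdiff : ∀ z : Fin n → ℝ, |F (comb T z) - F (x + comb T z)| ≤ ε / 8 := by
    intro z
    have h := hLip _ (hmem z) _ (add_mem_sobSpace hp hxs (hmem z))
    have e : comb T z - (x + comb T z) = -x := by abel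
    rw [e, sobNorm_neg hp] at h
    have h' := h.trans hx1.le
    rw [← ENNReal.ofReal_coe_nnreal, ENNReal.ofReal_le_ofReal_iff (by positivity)] at h'
    simpa using h'
  have h3 := abs_delta3_sub_le (x := y) (a := a) (b := b) (c := g) hdiff
  have h4 : delta3 (fun z => F (x + comb T z)) y a b g =
      delta3 F (x + comb T y) (comb T a) (comb T b) (comb T g) := by
    simp only [delta3, comb_add, add_assoc]
  rw [h4] at h3
  set A := delta3 (fun z => F (comb T z)) y a b g
  set A' := delta3 F (x + comb T y) (comb T a) (comb T b) (comb T g)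
  calc ENNReal.ofReal |A| ≤ ENNReal.ofReal (|A'| + ε) := by
        refine ENNReal.ofReal_le_ofReal ?_
        have := abs_sub_abs_le_abs_sub A A'
        linarith
    _ = ‖A'‖ₑ + ε := by
        rw [ENNReal.ofReal_add (abs_nonneg _) ε.coe_nonneg, Real.enorm_eq_ofReal_abs,
          ENNReal.ofReal_coe_nnreal]
    _ ≤ B + ε := by gcongr

end Malliavin

/-! ### Laplace functionals -/

/-- The function `x ↦ e^{-x}` on `[0, ∞]`. -/
def expNeg (x : ℝ≥0∞) : ℝ≥0∞ := EReal.exp (-(x : EReal))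

lemma expNeg_top : expNeg ∞ = 0 := by simp [expNeg]

lemma expNeg_zero : expNeg 0 = 1 := by simp [expNeg]

lemma expNeg_ofReal {x : ℝ} (hx : 0 ≤ x) :
    expNeg (ENNReal.ofReal x) = ENNReal.ofReal (Real.exp (-x)) := by
  rw [expNeg, EReal.coe_ennreal_ofReal, max_eq_left hx, ← EReal.coe_neg, EReal.exp_coe]

lemma expNeg_coe (x : ℝ≥0) : expNeg x = ENNReal.ofReal (Real.exp (-x)) := by
  have h := expNeg_ofReal x.coe_nonneg
  rwa [ENNReal.ofReal_coe_nnreal] at h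

lemma expNeg_add (x y : ℝ≥0∞) : expNeg (x + y) = expNeg x * expNeg y := by
  induction x with
  | top => simp [expNeg_top]
  | coe x =>
    induction y with
    | top => simp [expNeg_top]
    | coe y =>
      rw [← ENNReal.coe_add, expNeg_coe, expNeg_coe, expNeg_coe,
        ← ENNReal.ofReal_mul (Real.exp_pos _).le, ← Real.exp_add]
      congr 2; push_cast; ring

lemma expNeg_le_one (x : ℝ≥0∞) : expNeg x ≤ 1 := by
  induction x with
  | top => simp [expNeg_top]
  | coe x =>
    rw [expNeg_coe, ENNReal.ofReal_le_one, Real.exp_le_one_iff]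
    simp

lemma expNeg_ne_top (x : ℝ≥0∞) : expNeg x ≠ ∞ := ((expNeg_le_one x).trans_lt ENNReal.one_lt_top).ne

@[fun_prop]
lemma measurable_expNeg : Measurable expNeg := by
  unfold expNeg; fun_prop

/-- This is `1 - e^{-x} ≤ x` after scaling by `m + 1`. These difference quotients differentiate a
Laplace functional inside `[0, ∞]`, where no integrability has to be tracked. -/
lemma mul_one_sub_expNeg_le (m : ℕ) (d : ℝ≥0∞) :
    ((m + 1 : ℕ) : ℝ≥0∞) * (1 - expNeg (d / ((m + 1 : ℕ) : ℝ≥0∞))) ≤ d := by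
  have hm : (0 : ℝ) < (m + 1 : ℕ) := by positivity
  induction d with
  | top => simp
  | coe d =>
    have e1 : (d : ℝ≥0∞) / ((m + 1 : ℕ) : ℝ≥0∞) = ENNReal.ofReal (d / (m + 1 : ℕ)) := by
      rw [ENNReal.ofReal_div_of_pos hm, ENNReal.ofReal_natCast, ENNReal.ofReal_coe_nnreal]
    rw [e1, expNeg_ofReal (by positivity), ← ENNReal.ofReal_one,
      ← ENNReal.ofReal_sub _ (Real.exp_pos _).le, ← ENNReal.ofReal_natCast,
      ← ENNReal.ofReal_mul hm.le, ← ENNReal.ofReal_coe_nnreal]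
    refine ENNReal.ofReal_le_ofReal ?_
    have := Real.add_one_le_exp (-((d : ℝ) / (m + 1 : ℕ)))
    calc ((m + 1 : ℕ) : ℝ) * (1 - Real.exp (-((d : ℝ) / (m + 1 : ℕ))))
        ≤ (m + 1 : ℕ) * ((d : ℝ) / (m + 1 : ℕ)) := by gcongr; linarith
      _ = d := by field_simp

/-- From `e^{-x} ≤ 1/(1 + x)`. This explicit lower bound allows `d` to vary with `m` in the limit.
-/
lemma le_mul_one_sub_expNeg (m : ℕ) (d : ℝ≥0) :
    ENNReal.ofReal (d / (1 + d / (m + 1 : ℕ))) ≤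
      ((m + 1 : ℕ) : ℝ≥0∞) * (1 - expNeg (d / ((m + 1 : ℕ) : ℝ≥0∞))) := by
  have hm : (0 : ℝ) < (m + 1 : ℕ) := by positivity
  have e1 : (d : ℝ≥0∞) / ((m + 1 : ℕ) : ℝ≥0∞) = ENNReal.ofReal (d / (m + 1 : ℕ)) := by
    rw [ENNReal.ofReal_div_of_pos hm, ENNReal.ofReal_natCast, ENNReal.ofReal_coe_nnreal]
  rw [e1, expNeg_ofReal (by positivity), ← ENNReal.ofReal_one,
    ← ENNReal.ofReal_sub _ (Real.exp_pos _).le, ← ENNReal.ofReal_natCast,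
    ← ENNReal.ofReal_mul hm.le]
  refine ENNReal.ofReal_le_ofReal ?_
  set x : ℝ := (d : ℝ) / (m + 1 : ℕ) with hx
  have hx0 : 0 ≤ x := by positivity
  have hd : (d : ℝ) = (m + 1 : ℕ) * x := by rw [hx]; field_simp
  have h1 : Real.exp (-x) ≤ 1 / (1 + x) := by
    rw [Real.exp_neg, ← one_div]
    exact one_div_le_one_div_of_le (by linarith) (by linarith [Real.add_one_le_exp x])
  rw [hd, mul_div_assoc]
  gcongr
  calc x / (1 + x) = 1 - 1 / (1 + x) := by field_simp; ring
    _ ≤ _ := by linarith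

lemma tendsto_mul_one_sub_expNeg {d : ℕ → ℝ≥0∞} {D : ℝ≥0∞} (hD : D ≠ ∞)
    (h : Tendsto d atTop (𝓝 D)) :
    Tendsto (fun m : ℕ => ((m + 1 : ℕ) : ℝ≥0∞) * (1 - expNeg (d m / ((m + 1 : ℕ) : ℝ≥0∞))))
      atTop (𝓝 D) := by
  lift D to ℝ≥0 using hD
  have hfin : ∀ᶠ m in atTop, d m ≠ ∞ := (h.eventually_lt_const ENNReal.coe_lt_top).mono
    fun m hm => hm.ne
  have ht : Tendsto (fun m => ((d m).toNNReal : ℝ)) atTop (𝓝 (D : ℝ)) :=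
    NNReal.tendsto_coe.2 ((ENNReal.tendsto_toNNReal ENNReal.coe_ne_top).comp h)
  have hlow : Tendsto (fun m : ℕ => ENNReal.ofReal (((d m).toNNReal : ℝ) /
      (1 + (d m).toNNReal / (m + 1 : ℕ)))) atTop (𝓝 (D : ℝ≥0∞)) := by
    have h1 : Tendsto (fun m : ℕ => ((d m).toNNReal : ℝ) / (m + 1 : ℕ)) atTop (𝓝 0) := by
      have := ht.mul (tendsto_one_div_add_atTop_nhds_zero_nat (𝕜 := ℝ))
      simp only [mul_zero, mul_one_div] at this
      exact_mod_cast this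
    have h2 := ht.div (h1.const_add 1) (by simp)
    simp only [add_zero, div_one] at h2
    rw [← ENNReal.ofReal_coe_nnreal]
    exact ENNReal.tendsto_ofReal h2
  refine tendsto_of_tendsto_of_tendsto_of_le_of_le' hlow h ?_
    (Eventually.of_forall fun m => mul_one_sub_expNeg_le m (d m))
  filter_upwards [hfin] with m hm
  have := le_mul_one_sub_expNeg m (d m).toNNReal
  rwa [ENNReal.coe_toNNReal hm] at this

lemma tendsto_mul_one_sub_expNeg_const (D : ℝ≥0∞) :
    Tendsto (fun m : ℕ => ((m + 1 : ℕ) : ℝ≥0∞) * (1 - expNeg (D / ((m + 1 : ℕ) : ℝ≥0∞))))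
      atTop (𝓝 D) := by
  by_cases hD : D = ∞
  · subst hD
    have h : ∀ m : ℕ, ((m + 1 : ℕ) : ℝ≥0∞) * (1 - expNeg (∞ / ((m + 1 : ℕ) : ℝ≥0∞))) =
        ((m + 1 : ℕ) : ℝ≥0∞) := fun m => by
      rw [ENNReal.top_div_of_ne_top (ENNReal.natCast_ne_top _), expNeg_top, tsub_zero, mul_one]
    simp only [h]
    exact ENNReal.tendsto_nat_nhds_top.comp (tendsto_add_atTop_nat 1)
  · exact tendsto_mul_one_sub_expNeg hD tendsto_const_nhds

/-- Fatou's lemma gives the lower bound and the pointwise inequality gives the upper one, so the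
limit may be infinite. -/
lemma tendsto_lintegral_mul_one_sub_expNeg {α : Type*} [MeasurableSpace α] (μ : Measure α)
    {w X : α → ℝ≥0∞} (hw : Measurable w) (hw' : ∀ a, w a ≠ ∞) (hX : Measurable X) :
    Tendsto (fun m : ℕ => ((m + 1 : ℕ) : ℝ≥0∞) *
        ∫⁻ a, w a * (1 - expNeg (X a / ((m + 1 : ℕ) : ℝ≥0∞))) ∂μ)
      atTop (𝓝 (∫⁻ a, w a * X a ∂μ)) := by
  have e : ∀ m : ℕ, ((m + 1 : ℕ) : ℝ≥0∞) *
        ∫⁻ a, w a * (1 - expNeg (X a / ((m + 1 : ℕ) : ℝ≥0∞))) ∂μ =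
      ∫⁻ a, w a * (((m + 1 : ℕ) : ℝ≥0∞) * (1 - expNeg (X a / ((m + 1 : ℕ) : ℝ≥0∞)))) ∂μ := by
    intro m
    rw [← lintegral_const_mul _ (by fun_prop)]
    exact lintegral_congr fun a => by ring
  simp only [e]
  refine tendsto_of_le_liminf_of_limsup_le ?_ ?_
  · refine le_trans (le_of_eq ?_) (lintegral_liminf_le fun m => by fun_prop)
    refine lintegral_congr fun a => ?_
    exact (ENNReal.Tendsto.const_mul (tendsto_mul_one_sub_expNeg_const (X a))
      (Or.inr (hw' a))).liminf_eq.symm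
  · refine limsup_le_of_le (h := Eventually.of_forall fun m => ?_)
    refine lintegral_mono fun a => ?_
    dsimp only
    gcongr
    exact mul_one_sub_expNeg_le m (X a)

namespace IsPoissonProcess

variable {Ω E : Type*} [MeasurableSpace Ω] [MeasurableSpace E] {N : Ω → Measure E}
  {ν : Measure E} {Pr : Measure Ω}

lemma measurable_lintegral (hN : IsPoissonProcess N ν Pr) {f : E → ℝ≥0∞} (hf : Measurable f) :
    Measurable fun ω => ∫⁻ x, f x ∂(N ω) :=
  (Measure.measurable_lintegral hf).comp hN.measurable

lemma lintegral_expNeg (hN : IsPoissonProcess N ν Pr) {ψ : E → ℝ≥0∞} (hψ : Measurable ψ) :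
    ∫⁻ ω, expNeg (∫⁻ x, ψ x ∂(N ω)) ∂Pr = expNeg (∫⁻ x, (1 - expNeg (ψ x)) ∂ν) :=
  hN.laplace ψ hψ

/-- The Mecke formula for exponential functionals. -/
lemma mecke_expNeg (hN : IsPoissonProcess N ν Pr) [IsProbabilityMeasure Pr] {f ψ : E → ℝ≥0∞}
    (hf : Measurable f) (hψ : Measurable ψ) (hfi : ∫⁻ x, f x ∂ν ≠ ∞) :
    ∫⁻ ω, expNeg (∫⁻ x, ψ x ∂(N ω)) * ∫⁻ x, f x ∂(N ω) ∂Pr =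
      (∫⁻ ω, expNeg (∫⁻ x, ψ x ∂(N ω)) ∂Pr) * ∫⁻ x, expNeg (ψ x) * f x ∂ν := by
  have hA := hN.measurable_lintegral hψ
  have hX := hN.measurable_lintegral hf
  set A : Ω → ℝ≥0∞ := fun ω => ∫⁻ x, ψ x ∂(N ω) with hAdef
  set X : Ω → ℝ≥0∞ := fun ω => ∫⁻ x, f x ∂(N ω) with hXdef
  have h1 := tendsto_lintegral_mul_one_sub_expNeg Pr (w := fun ω => expNeg (A ω)) (by fun_prop)
    (fun ω => expNeg_ne_top _) hX
  set D : ℕ → ℝ≥0∞ := fun m =>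
    ∫⁻ x, expNeg (ψ x) * (1 - expNeg (f x / ((m + 1 : ℕ) : ℝ≥0∞))) ∂ν with hD
  have h2 : Tendsto (fun m => ((m + 1 : ℕ) : ℝ≥0∞) * D m) atTop
      (𝓝 (∫⁻ x, expNeg (ψ x) * f x ∂ν)) :=
    tendsto_lintegral_mul_one_sub_expNeg ν (w := fun x => expNeg (ψ x)) (by fun_prop)
      (fun x => expNeg_ne_top _) hf
  have hDtop : ∫⁻ x, expNeg (ψ x) * f x ∂ν ≠ ∞ := by
    refine ne_top_of_le_ne_top hfi (lintegral_mono fun x => ?_)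
    exact mul_le_of_le_one_left zero_le (expNeg_le_one _)
  -- Here `d m = (m + 1) D m`, so division by `m + 1` returns `D m`. This is the derivative of the
  -- outer exponential in the Laplace functional.
  have h3 := tendsto_mul_one_sub_expNeg hDtop h2
  have hdiv : ∀ m : ℕ, (((m + 1 : ℕ) : ℝ≥0∞) * D m) / ((m + 1 : ℕ) : ℝ≥0∞) = D m := fun m => by
    rw [mul_comm, mul_div_assoc, ENNReal.div_self (by simp) (ENNReal.natCast_ne_top _),
      mul_one]
  simp only [hdiv] at h3
  -- The Laplace functional at `ψ` minus the one at `ψ + f/(m + 1)`. Multiplied by `m + 1`, it tends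
  -- to minus the derivative in the direction `f`.
  have hΛ : ∀ m : ℕ, ∫⁻ ω, expNeg (A ω) * (1 - expNeg (X ω / ((m + 1 : ℕ) : ℝ≥0∞))) ∂Pr =
      (∫⁻ ω, expNeg (A ω) ∂Pr) * (1 - expNeg (D m)) := by
    intro m
    set q : ℝ≥0∞ := ((m + 1 : ℕ) : ℝ≥0∞) with hq
    have e1 : ∀ ω, expNeg (A ω) * (1 - expNeg (X ω / q)) =
        expNeg (A ω) - expNeg (∫⁻ x, (ψ x + f x / q) ∂(N ω)) := by
      intro ω
      rw [lintegral_add_left hψ, expNeg_add,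
        ENNReal.mul_sub fun _ _ => expNeg_ne_top _, mul_one]
      simp only [div_eq_mul_inv, hXdef, hAdef]
      rw [lintegral_mul_const _ hf]
    simp only [e1]
    have hle : ∀ ω, expNeg (∫⁻ x, (ψ x + f x / q) ∂(N ω)) ≤ expNeg (A ω) := fun ω => by
      rw [lintegral_add_left hψ, expNeg_add]
      exact mul_le_of_le_one_right zero_le (expNeg_le_one _)
    have hm : Measurable fun ω => expNeg (∫⁻ x, (ψ x + f x / q) ∂(N ω)) :=
      measurable_expNeg.comp (hN.measurable_lintegral (by fun_prop))
    have hfin : ∫⁻ ω, expNeg (∫⁻ x, (ψ x + f x / q) ∂(N ω)) ∂Pr ≠ ∞ := by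
      refine ne_top_of_le_ne_top (b := 1) ENNReal.one_ne_top ?_
      calc _ ≤ ∫⁻ _, 1 ∂Pr := lintegral_mono fun ω => expNeg_le_one _
        _ = 1 := by simp
    rw [lintegral_sub hm hfin (ae_of_all _ hle), hN.lintegral_expNeg hψ,
      hN.lintegral_expNeg (by fun_prop), ENNReal.mul_sub fun _ _ => expNeg_ne_top _, mul_one,
      ← expNeg_add]
    congr 2
    rw [hD, ← lintegral_add_left (by fun_prop)]
    refine lintegral_congr fun x => ?_
    rw [expNeg_add, ENNReal.mul_sub fun _ _ => expNeg_ne_top _, mul_one]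
    refine (tsub_add_tsub_cancel (expNeg_le_one _) ?_).symm
    exact mul_le_of_le_one_right zero_le (expNeg_le_one _)
  simp only [hΛ] at h1
  have h4 : Tendsto (fun m : ℕ => (∫⁻ ω, expNeg (A ω) ∂Pr) *
      (((m + 1 : ℕ) : ℝ≥0∞) * (1 - expNeg (D m)))) atTop
      (𝓝 ((∫⁻ ω, expNeg (A ω) ∂Pr) * ∫⁻ x, expNeg (ψ x) * f x ∂ν)) := by
    refine ENNReal.Tendsto.const_mul h3 (Or.inr ?_)
    rw [hN.lintegral_expNeg hψ]
    exact expNeg_ne_top _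
  refine tendsto_nhds_unique h1 (h4.congr fun m => ?_)
  ring

/-- Campbell's formula. -/
lemma lintegral_lintegral (hN : IsPoissonProcess N ν Pr) [IsProbabilityMeasure Pr]
    {f : E → ℝ≥0∞} (hf : Measurable f) (hfi : ∫⁻ x, f x ∂ν ≠ ∞) :
    ∫⁻ ω, ∫⁻ x, f x ∂(N ω) ∂Pr = ∫⁻ x, f x ∂ν := by
  have h := hN.mecke_expNeg hf (ψ := 0) measurable_zero hfi
  simpa [expNeg_zero] using h

lemma ae_lintegral_lt_top (hN : IsPoissonProcess N ν Pr) [IsProbabilityMeasure Pr]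
    {f : E → ℝ≥0∞} (hf : Measurable f) (hfi : ∫⁻ x, f x ∂ν ≠ ∞) :
    ∀ᵐ ω ∂Pr, ∫⁻ x, f x ∂(N ω) < ∞ := by
  refine ae_lt_top (hN.measurable_lintegral hf) ?_
  rwa [hN.lintegral_lintegral hf hfi]

/-- Campbell's formula for the indicator of a measurable null set containing the exceptional points.
It allows integrands to be modified on `ν`-null sets. -/
lemma ae_ae (hN : IsPoissonProcess N ν Pr) [IsProbabilityMeasure Pr] {p : E → Prop}
    (hp : ∀ᵐ x ∂ν, p x) : ∀ᵐ ω ∂Pr, ∀ᵐ x ∂(N ω), p x := by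
  obtain ⟨s, hs, hsm, hs0⟩ := exists_measurable_superset_of_null (ae_iff.1 hp)
  have h := hN.lintegral_lintegral (f := s.indicator 1) (measurable_one.indicator hsm)
    (by simp [lintegral_indicator_one hsm, hs0])
  simp only [lintegral_indicator_one hsm, hs0] at h
  have hm : Measurable fun ω => N ω s := (Measure.measurable_coe hsm).comp hN.measurable
  rw [lintegral_eq_zero_iff hm] at h
  filter_upwards [h] with ω hω
  exact ae_iff.2 (measure_mono_null hs hω)

end IsPoissonProcess

/-! ### Uniqueness of the Laplace transform and the Mecke formula -/

section Laplace

variable {ι : Type*} [Fintype ι]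

open BoundedContinuousFunction in
/-- The bounded continuous function `z ↦ exp (-∑ c_i z_i)` on the positive orthant. -/
def expBCF (c : ι → ℝ≥0) : (ι → ℝ≥0) →ᵇ ℝ :=
  BoundedContinuousFunction.ofNormedAddCommGroup (fun z => Real.exp (-((∑ i, c i * z i : ℝ≥0) : ℝ)))
    (by fun_prop) 1 (fun z => by
      rw [Real.norm_of_nonneg (Real.exp_pos _).le, Real.exp_le_one_iff]
      simp only [Left.neg_nonpos_iff, NNReal.coe_nonneg])

lemma expBCF_apply (c z : ι → ℝ≥0) : expBCF c z = Real.exp (-((∑ i, c i * z i : ℝ≥0) : ℝ)) := rfl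

open BoundedContinuousFunction in
/-- The multiplicative monoid of the functions `expBCF c`. -/
def expSubmonoid (ι : Type*) [Fintype ι] : Submonoid ((ι → ℝ≥0) →ᵇ ℝ) where
  carrier := Set.range expBCF
  one_mem' := ⟨0, by ext z; simp [expBCF_apply]⟩
  mul_mem' := by
    rintro _ _ ⟨c, rfl⟩ ⟨d, rfl⟩
    refine ⟨c + d, ?_⟩
    ext z
    rw [BoundedContinuousFunction.mul_apply, expBCF_apply, expBCF_apply, expBCF_apply,
      ← Real.exp_add]
    congr 1
    push_cast
    rw [← neg_add, ← Finset.sum_add_distrib]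
    congr 1
    refine Finset.sum_congr rfl fun i _ => ?_
    simp only [Pi.add_apply, NNReal.coe_add]
    ring

open BoundedContinuousFunction in
/-- The algebra generated by the functions `expBCF c`. -/
def expAlgebra (ι : Type*) [Fintype ι] : StarSubalgebra ℝ ((ι → ℝ≥0) →ᵇ ℝ) where
  toSubalgebra := Algebra.adjoin ℝ (expSubmonoid ι : Set ((ι → ℝ≥0) →ᵇ ℝ))
  star_mem' := fun {a} ha => by
    have : star a = a := by ext z; simp
    rwa [this]

/-- The exponentials `e^{-⟨c, z⟩}` are closed under products and separate the points of the orthant,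
so the algebra that they generate determines finite measures on this Polish space. -/
lemma measure_eq_of_laplace {μ ρ : Measure (ι → ℝ≥0)} [IsFiniteMeasure μ] [IsFiniteMeasure ρ]
    (h : ∀ c : ι → ℝ≥0, ∫⁻ z, expNeg ((∑ i, c i * z i : ℝ≥0) : ℝ≥0∞) ∂μ =
      ∫⁻ z, expNeg ((∑ i, c i * z i : ℝ≥0) : ℝ≥0∞) ∂ρ) : μ = ρ := by
  refine ext_of_forall_mem_subalgebra_integral_eq_of_polish (𝕜 := ℝ) (A := expAlgebra ι) ?_ ?_
  · intro x y hxy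
    obtain ⟨i, hi⟩ := Function.ne_iff.1 hxy
    classical
    refine ⟨expBCF (Pi.single i 1), ⟨_, ⟨expBCF (Pi.single i 1),
      Algebra.subset_adjoin ⟨_, rfl⟩, rfl⟩, rfl⟩, ?_⟩
    rw [expBCF_apply, expBCF_apply, Ne, Real.exp_eq_exp, neg_inj, NNReal.coe_inj]
    simpa [Pi.single_apply] using hi
  · intro g hg
    -- The exponentials form a monoid, so the algebra is their linear span and the equality need be
    -- checked on single exponentials only.
    have hg' : g ∈ Submodule.span ℝ (expSubmonoid ι : Set _) := by
      have h1 : g ∈ Subalgebra.toSubmodule (Algebra.adjoin ℝ (expSubmonoid ι : Set _)) := hg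
      rwa [Algebra.adjoin_eq_span, Submonoid.closure_eq] at h1
    clear hg
    induction hg' using Submodule.span_induction with
    | mem g hg =>
      obtain ⟨c, rfl⟩ := hg
      have e : ∀ κ : Measure (ι → ℝ≥0), ∫ z, expBCF c z ∂κ =
          (∫⁻ z, expNeg ((∑ i, c i * z i : ℝ≥0) : ℝ≥0∞) ∂κ).toReal := by
        intro κ
        rw [integral_eq_lintegral_of_nonneg_ae (f := fun z => expBCF c z)
          (ae_of_all _ fun z => (Real.exp_pos _).le) (expBCF c).continuous.aestronglyMeasurable]
        simp only [expNeg_coe, expBCF_apply]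
      rw [e, e, h]
    | zero => simp
    | add f g hf hg hf' hg' =>
      simp only [BoundedContinuousFunction.coe_add, Pi.add_apply]
      rw [integral_add (f.integrable _) (g.integrable _),
        integral_add (f.integrable _) (g.integrable _), hf', hg']
    | smul c f hf hf' =>
      simp only [BoundedContinuousFunction.coe_smul, integral_smul]
      rw [hf']

end Laplace

namespace IsPoissonProcess

variable {Ω E ι : Type*} [MeasurableSpace Ω] [MeasurableSpace E] {N : Ω → Measure E}
  {ν : Measure E} {Pr : Measure Ω}

/-- The vector of the integrals of `g_i` with respect to a random measure. -/
def intVec (N : Ω → Measure E) (g : ι → E → ℝ≥0) (ω : Ω) (i : ι) : ℝ≥0 :=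
  (∫⁻ x, g i x ∂(N ω)).toNNReal

lemma measurable_intVec (hN : IsPoissonProcess N ν Pr) {g : ι → E → ℝ≥0}
    (hg : ∀ i, Measurable (g i)) : Measurable (intVec N g) :=
  measurable_pi_iff.2 fun i => (hN.measurable_lintegral (hg i).coe_nnreal_ennreal).ennreal_toNNReal

/-- The exponential Mecke formula with exponent `∑ c_i g_i` equates the Laplace transforms of the
two sides. As an equality of finite measures it extends to all bounded test functions. -/
lemma mecke_map [Fintype ι] (hN : IsPoissonProcess N ν Pr) [IsProbabilityMeasure Pr] {f : E → ℝ≥0}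
    {g : ι → E → ℝ≥0} (hf : Measurable f) (hg : ∀ i, Measurable (g i))
    (hfi : ∫⁻ x, f x ∂ν ≠ ∞) (hgi : ∀ i, ∫⁻ x, g i x ∂ν ≠ ∞) :
    (Pr.withDensity fun ω => ∫⁻ x, f x ∂(N ω)).map (intVec N g) =
      ((ν.withDensity fun x => (f x : ℝ≥0∞)).prod Pr).map
        (fun z => intVec N g z.2 + fun i => g i z.1) := by
  have hW := hN.measurable_intVec hg
  have hf' : Measurable fun x => (f x : ℝ≥0∞) := hf.coe_nnreal_ennreal
  have hX := hN.measurable_lintegral hf'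
  have hfin1 : IsFiniteMeasure (Pr.withDensity fun ω => ∫⁻ x, f x ∂(N ω)) :=
    isFiniteMeasure_withDensity (by rwa [hN.lintegral_lintegral hf' hfi])
  have hfin2 : IsFiniteMeasure (ν.withDensity fun x => (f x : ℝ≥0∞)) :=
    isFiniteMeasure_withDensity hfi
  have hadd : Measurable fun z : E × Ω => intVec N g z.2 + fun i => g i z.1 := by
    have h1 : Measurable fun z : E × Ω => intVec N g z.2 := hW.comp measurable_snd
    have h2 : Measurable fun z : E × Ω => fun i => g i z.1 :=
      measurable_pi_iff.2 fun i => (hg i).comp measurable_fst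
    exact h1.add h2
  refine measure_eq_of_laplace fun c => ?_
  have hm : Measurable fun z : ι → ℝ≥0 => expNeg ((∑ i, c i * z i : ℝ≥0) : ℝ≥0∞) := by fun_prop
  have hm2 : Measurable fun z : E × Ω =>
      expNeg ((∑ i, c i * (intVec N g z.2 + fun i => g i z.1) i : ℝ≥0) : ℝ≥0∞) := hm.comp hadd
  rw [lintegral_map hm hW, lintegral_map hm hadd,
    lintegral_withDensity_eq_lintegral_mul _ hX (g := fun ω =>
      expNeg ((∑ i, c i * intVec N g ω i : ℝ≥0) : ℝ≥0∞)) (hm.comp hW),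
    lintegral_prod _ hm2.aemeasurable]
  set ψ : E → ℝ≥0∞ := fun x => ((∑ i, c i * g i x : ℝ≥0) : ℝ≥0∞) with hψdef
  have hψ : Measurable ψ := by fun_prop
  -- Passing through `toNNReal` loses nothing almost surely, since the integrals of the `g_i` are
  -- almost surely finite.
  have hae : ∀ᵐ ω ∂Pr, ((∑ i, c i * intVec N g ω i : ℝ≥0) : ℝ≥0∞) = ∫⁻ x, ψ x ∂(N ω) := by
    have h := ae_all_iff.2 fun i => hN.ae_lintegral_lt_top (hg i).coe_nnreal_ennreal (hgi i)
    filter_upwards [h] with ω hω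
    simp only [hψdef, ENNReal.ofNNReal_finsetSum, ENNReal.coe_mul]
    rw [lintegral_finsetSum _ fun i _ => by fun_prop]
    refine Finset.sum_congr rfl fun i _ => ?_
    rw [lintegral_const_mul _ (hg i).coe_nnreal_ennreal, intVec, ENNReal.coe_toNNReal (hω i).ne]
  have e1 : ∫⁻ ω, ((fun ω => ∫⁻ x, f x ∂(N ω)) *
      fun ω => expNeg ((∑ i, c i * intVec N g ω i : ℝ≥0) : ℝ≥0∞)) ω ∂Pr =
      ∫⁻ ω, expNeg (∫⁻ x, ψ x ∂(N ω)) * ∫⁻ x, f x ∂(N ω) ∂Pr := by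
    refine lintegral_congr_ae ?_
    filter_upwards [hae] with ω hω
    simp only [Pi.mul_apply, hω]
    rw [mul_comm]
  have e2 : ∀ x, ∫⁻ ω, expNeg ((∑ i, c i * (intVec N g ω + fun i => g i x) i : ℝ≥0) : ℝ≥0∞) ∂Pr =
      (∫⁻ ω, expNeg (∫⁻ x, ψ x ∂(N ω)) ∂Pr) * expNeg (ψ x) := by
    intro x
    have hm3 : Measurable fun ω => expNeg (∫⁻ x, ψ x ∂(N ω)) :=
      measurable_expNeg.comp (hN.measurable_lintegral hψ)
    rw [← lintegral_mul_const _ hm3]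
    refine lintegral_congr_ae ?_
    filter_upwards [hae] with ω hω
    rw [← hω, ← expNeg_add, hψdef, ← ENNReal.coe_add, ← Finset.sum_add_distrib]
    simp only [Pi.add_apply, mul_add]
  refine (e1.trans (hN.mecke_expNeg hf' hψ hfi)).trans ?_
  simp only [e2]
  rw [lintegral_withDensity_eq_lintegral_mul _ hf' (by fun_prop),
    ← lintegral_const_mul _ (by fun_prop)]
  refine lintegral_congr fun x => ?_
  simp only [Pi.mul_apply]
  ring

/-- The Mecke formula for bounded functions of finitely many integrals. -/
lemma mecke_intVec [Fintype ι] (hN : IsPoissonProcess N ν Pr) [IsProbabilityMeasure Pr] {f : E → ℝ≥0}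
    {g : ι → E → ℝ≥0} (hf : Measurable f) (hg : ∀ i, Measurable (g i))
    (hfi : ∫⁻ x, f x ∂ν ≠ ∞) (hgi : ∀ i, ∫⁻ x, g i x ∂ν ≠ ∞)
    {Φ : (ι → ℝ≥0) → ℝ} (hΦ : Measurable Φ) {C : ℝ} (hC : ∀ z, |Φ z| ≤ C) :
    ∫ ω, (∫⁻ x, f x ∂(N ω)).toReal * Φ (intVec N g ω) ∂Pr =
      ∫ x, f x * ∫ ω, Φ (intVec N g ω + fun i => g i x) ∂Pr ∂ν := by
  have hW := hN.measurable_intVec hg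
  have hf' : Measurable fun x => (f x : ℝ≥0∞) := hf.coe_nnreal_ennreal
  have hX := hN.measurable_lintegral hf'
  have hfin2 : IsFiniteMeasure (ν.withDensity fun x => (f x : ℝ≥0∞)) :=
    isFiniteMeasure_withDensity hfi
  have hadd : Measurable fun z : E × Ω => intVec N g z.2 + fun i => g i z.1 := by
    have h1 : Measurable fun z : E × Ω => intVec N g z.2 := hW.comp measurable_snd
    have h2 : Measurable fun z : E × Ω => fun i => g i z.1 :=
      measurable_pi_iff.2 fun i => (hg i).comp measurable_fst
    exact h1.add h2
  have h := congrArg (fun μ => ∫ z, Φ z ∂μ) (hN.mecke_map hf hg hfi hgi)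
  beta_reduce at h
  have hm2 : Measurable fun z : E × Ω => Φ (intVec N g z.2 + fun i => g i z.1) := hΦ.comp hadd
  rw [integral_map hW.aemeasurable hΦ.aestronglyMeasurable,
    integral_map hadd.aemeasurable hΦ.aestronglyMeasurable,
    integral_withDensity_eq_integral_toReal_smul hX (hN.ae_lintegral_lt_top hf' hfi),
    integral_prod _ (Integrable.of_bound hm2.aestronglyMeasurable C
      (ae_of_all _ fun z => by simpa using hC _)),
    integral_withDensity_eq_integral_toReal_smul hf' (ae_of_all _ fun x => ENNReal.coe_lt_top)] at h
  simpa using h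

end IsPoissonProcess

/-! ### The Stein identity for compensated Poisson integrals -/

namespace IsPoissonProcess

variable {Ω E ι : Type*} [MeasurableSpace Ω] [MeasurableSpace E] {N : Ω → Measure E}
  {ν : Measure E} {Pr : Measure Ω}

/-- Positive and negative parts of a family of functions. -/
def signPart (w : ι → E → ℝ) (i : ι × Bool) (x : E) : ℝ≥0 :=
  if i.2 then (w i.1 x).toNNReal else (-w i.1 x).toNNReal

lemma measurable_signPart {w : ι → E → ℝ} (hw : ∀ k, Measurable (w k)) (i : ι × Bool) :
    Measurable (signPart w i) := by
  unfold signPart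
  split_ifs
  · exact (hw _).real_toNNReal
  · exact (hw _).neg.real_toNNReal

omit [MeasurableSpace E] in
lemma signPart_sub (w : ι → E → ℝ) (k : ι) (x : E) :
    (signPart w (k, true) x : ℝ) - signPart w (k, false) x = w k x := by
  simp only [signPart, if_true, Bool.false_eq_true, if_false, Real.coe_toNNReal']
  rcases le_total 0 (w k x) with h | h
  · rw [max_eq_left h, max_eq_right (by linarith)]; ring
  · rw [max_eq_right h, max_eq_left (by linarith)]; ring

lemma lintegral_signPart_ne_top {w : ι → E → ℝ} (hw : ∀ k, Integrable (w k) ν) (i : ι × Bool) :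
    ∫⁻ x, signPart w i x ∂ν ≠ ∞ := by
  refine ne_top_of_le_ne_top (hw i.1).2.ne (lintegral_mono fun x => ?_)
  rw [← ofReal_norm, Real.norm_eq_abs]
  unfold signPart
  split_ifs
  · exact ENNReal.ofReal_le_ofReal (le_abs_self _)
  · exact ENNReal.ofReal_le_ofReal (neg_le_abs _)

lemma ae_integrable (hN : IsPoissonProcess N ν Pr) [IsProbabilityMeasure Pr] {w : E → ℝ}
    (hw : Measurable w) (hwi : Integrable w ν) : ∀ᵐ ω ∂Pr, Integrable w (N ω) := by
  filter_upwards [hN.ae_lintegral_lt_top hw.enorm hwi.2.ne] with ω hω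
  exact ⟨hw.aestronglyMeasurable, hω⟩

/-- The Bochner integral splits into positive and negative parts where `w k` is integrable for the
random measure, which is almost surely the case. -/
lemma ae_intVec_sub (hN : IsPoissonProcess N ν Pr) [IsProbabilityMeasure Pr] {w : ι → E → ℝ}
    (hw : ∀ k, Measurable (w k)) (hwi : ∀ k, Integrable (w k) ν) (k : ι) :
    ∀ᵐ ω ∂Pr, (intVec N (signPart w) ω (k, true) : ℝ) - intVec N (signPart w) ω (k, false) =
      ∫ x, w k x ∂(N ω) := by
  filter_upwards [hN.ae_integrable (hw k) (hwi k)] with ω hω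
  rw [integral_eq_lintegral_pos_part_sub_lintegral_neg_part hω]
  rfl

/-- The Mecke formula for bounded functions of signed integrals. -/
lemma mecke_integral (hN : IsPoissonProcess N ν Pr) [IsProbabilityMeasure Pr] [Fintype ι]
    {w : ι → E → ℝ} (hw : ∀ k, Measurable (w k)) (hwi : ∀ k, Integrable (w k) ν)
    {K : (ι → ℝ) → ℝ} (hK : Measurable K) {C : ℝ} (hC : ∀ z, |K z| ≤ C) (k : ι) :
    ∫ ω, (∫ x, w k x ∂(N ω)) * K (fun j => ∫ x, w j x ∂(N ω)) ∂Pr =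
      ∫ x, w k x * ∫ ω, K (fun j => ∫ x, w j x ∂(N ω) + w j x) ∂Pr ∂ν := by
  set g := signPart w with hg
  have hgm := measurable_signPart hw
  have hgi := lintegral_signPart_ne_top hwi
  have hW := hN.measurable_intVec hgm
  -- Recombines the integrals of the positive and negative parts, so that signed integrals become
  -- functions on the orthant.
  set pr : (ι × Bool → ℝ≥0) → ι → ℝ := fun z j => (z (j, true) : ℝ) - z (j, false) with hpr
  have hprm : Measurable pr := by fun_prop
  have hΦ : Measurable fun z => K (pr z) := hK.comp hprm
  have hae : ∀ᵐ ω ∂Pr, pr (intVec N g ω) = fun j => ∫ x, w j x ∂(N ω) := by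
    filter_upwards [ae_all_iff.2 fun j => hN.ae_intVec_sub hw hwi j] with ω hω
    exact funext hω
  have hprg : ∀ ω x, pr (intVec N g ω + fun i => g i x) =
      fun j => pr (intVec N g ω) j + w j x := by
    intro ω x
    funext j
    have := signPart_sub w j x
    simp only [hpr, Pi.add_apply, NNReal.coe_add, ← hg] at this ⊢
    linarith
  have h1 := hN.mecke_intVec (hgm (k, true)) hgm (hgi _) hgi hΦ (fun z => hC _)
  have h2 := hN.mecke_intVec (hgm (k, false)) hgm (hgi _) hgi hΦ (fun z => hC _)
  have hint1 : ∀ b, Integrable (fun ω => (∫⁻ x, g (k, b) x ∂(N ω)).toReal * K (pr (intVec N g ω)))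
      Pr := fun b => by
    have hm := hN.measurable_lintegral (hgm (k, b)).coe_nnreal_ennreal
    refine (integrable_toReal_of_lintegral_ne_top hm.aemeasurable ?_).mul_bdd (c := C)
      (hΦ.comp hW).aestronglyMeasurable (ae_of_all _ fun ω => hC _)
    rw [hN.lintegral_lintegral (hgm (k, b)).coe_nnreal_ennreal (hgi _)]
    exact hgi _
  have hmeas : StronglyMeasurable fun x => ∫ ω, K (pr (intVec N g ω + fun i => g i x)) ∂Pr := by
    refine StronglyMeasurable.integral_prod_right ?_
    refine Measurable.stronglyMeasurable ?_
    have h1 : Measurable fun z : E × Ω => intVec N g z.2 := hW.comp measurable_snd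
    have h2 : Measurable fun z : E × Ω => fun i => g i z.1 :=
      measurable_pi_iff.2 fun i => (hgm i).comp measurable_fst
    exact hΦ.comp (h1.add h2)
  have hbd : ∀ x, ‖∫ ω, K (pr (intVec N g ω + fun i => g i x)) ∂Pr‖ ≤ C := fun x => by
    have := norm_integral_le_of_norm_le_const (μ := Pr) (C := C)
      (f := fun ω => K (pr (intVec N g ω + fun i => g i x))) (ae_of_all _ fun ω => hC _)
    simpa using this
  have hint2 : ∀ b, Integrable (fun x => (g (k, b) x : ℝ) *
      ∫ ω, K (pr (intVec N g ω + fun i => g i x)) ∂Pr) ν := fun b => by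
    refine Integrable.mul_bdd (c := C) ?_ hmeas.aestronglyMeasurable (ae_of_all _ hbd)
    exact integrable_toReal_of_lintegral_ne_top
      (hgm (k, b)).coe_nnreal_ennreal.aemeasurable (hgi (k, b))
  have h3 := congrArg₂ (· - ·) h1 h2
  beta_reduce at h3
  rw [← integral_sub (hint1 true) (hint1 false), ← integral_sub (hint2 true) (hint2 false)] at h3
  calc _ = _ := integral_congr_ae ?_
    _ = _ := h3
    _ = _ := integral_congr_ae (ae_of_all _ fun x => ?_)
  · filter_upwards [hae, hN.ae_intVec_sub hw hwi k] with ω h1 h2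
    rw [h1, ← sub_mul, ← h2]
    rfl
  · beta_reduce
    rw [← sub_mul, signPart_sub]
    congr 1
    refine integral_congr_ae ?_
    filter_upwards [hae] with ω hω
    rw [hprg, hω]

lemma aestronglyMeasurable_integral (hN : IsPoissonProcess N ν Pr) [IsProbabilityMeasure Pr]
    {w : E → ℝ} (hw : Measurable w) (hwi : Integrable w ν) :
    AEStronglyMeasurable (fun ω => ∫ x, w x ∂(N ω)) Pr := by
  have h := hN.ae_intVec_sub (w := fun _ : Unit => w) (fun _ => hw) (fun _ => hwi) ()
  have hm := hN.measurable_intVec (measurable_signPart (w := fun _ : Unit => w) fun _ => hw)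
  refine AEStronglyMeasurable.congr (Measurable.aestronglyMeasurable ?_) h
  fun_prop

lemma integrable_integral (hN : IsPoissonProcess N ν Pr) [IsProbabilityMeasure Pr]
    {w : E → ℝ} (hw : Measurable w) (hwi : Integrable w ν) :
    Integrable (fun ω => ∫ x, w x ∂(N ω)) Pr := by
  refine ⟨hN.aestronglyMeasurable_integral hw hwi, ?_⟩
  calc ∫⁻ ω, ‖∫ x, w x ∂(N ω)‖ₑ ∂Pr ≤ ∫⁻ ω, ∫⁻ x, ‖w x‖ₑ ∂(N ω) ∂Pr :=
        lintegral_mono fun ω => enorm_integral_le_lintegral_enorm _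
    _ = ∫⁻ x, ‖w x‖ₑ ∂ν := hN.lintegral_lintegral hw.enorm hwi.2.ne
    _ < ∞ := hwi.2

lemma aestronglyMeasurable_integral_comp_add [IsProbabilityMeasure Pr] [Countable ι]
    {w : ι → E → ℝ} (hw : ∀ k, AEMeasurable (w k) ν) {U : ι → Ω → ℝ}
    (hU : ∀ k, AEMeasurable (U k) Pr) {K : (ι → ℝ) → ℝ} (hK : Measurable K) :
    AEStronglyMeasurable (fun x => ∫ ω, K (fun j => U j ω + w j x) ∂Pr) ν := by
  refine AEStronglyMeasurable.integral_prod_right' (ν := Pr)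
    (f := fun z : E × Ω => K (fun j => U j z.2 + w j z.1)) ?_
  refine (hK.comp_aemeasurable (aemeasurable_pi_lambda _ fun j => ?_)).aestronglyMeasurable
  exact ((hU j).comp_quasiMeasurePreserving Measure.quasiMeasurePreserving_snd).add
    ((hw j).comp_quasiMeasurePreserving Measure.quasiMeasurePreserving_fst)

/-- The Stein identity for compensated integrals of integrable functions. -/
lemma stein_integral (hN : IsPoissonProcess N ν Pr) [IsProbabilityMeasure Pr] [Fintype ι]
    {w : ι → E → ℝ} (hw : ∀ k, Measurable (w k)) (hwi : ∀ k, Integrable (w k) ν)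
    {K : (ι → ℝ) → ℝ} (hK : Measurable K) {C : ℝ} (hC : ∀ z, |K z| ≤ C) {U : ι → Ω → ℝ}
    (hU : ∀ k ω, U k ω = ∫ x, w k x ∂(N ω) - ∫ x, w k x ∂ν) (k : ι) :
    ∫ ω, U k ω * K (fun j => U j ω) ∂Pr =
      ∫ x, w k x * ∫ ω, (K (fun j => U j ω + w j x) - K (fun j => U j ω)) ∂Pr ∂ν := by
  have hV := fun j => hN.integrable_integral (hw j) (hwi j)
  have hUi : ∀ j, Integrable (U j) Pr := fun j =>
    ((hV j).sub (integrable_const (∫ x, w j x ∂ν))).congr (ae_of_all _ fun ω => (hU j ω).symm)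
  have hsh : Measurable fun z : ι → ℝ => fun j => z j - ∫ x, w j x ∂ν := by fun_prop
  have h := hN.mecke_integral hw hwi (hK.comp hsh) (fun z => hC _) k
  simp only [Function.comp_apply, ← hU] at h
  have e1 : ∀ ω x, (fun j => ∫ x, w j x ∂(N ω) + w j x - ∫ x, w j x ∂ν) =
      fun j => U j ω + w j x := fun ω x => funext fun j => by rw [hU]; ring
  simp only [e1] at h
  have hKU : AEStronglyMeasurable (fun ω => K fun j => U j ω) Pr :=
    (hK.comp_aemeasurable (aemeasurable_pi_lambda _ fun j =>
      (hUi j).aemeasurable)).aestronglyMeasurable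
  have hKUi : Integrable (fun ω => K fun j => U j ω) Pr :=
    Integrable.of_bound hKU C (ae_of_all _ fun ω => hC _)
  have hKw : ∀ x, Integrable (fun ω => K fun j => U j ω + w j x) Pr := fun x =>
    Integrable.of_bound (hK.comp_aemeasurable (aemeasurable_pi_lambda _ fun j =>
      (hUi j).aemeasurable.add_const _)).aestronglyMeasurable C (ae_of_all _ fun ω => hC _)
  have hb : ∀ x, ‖∫ ω, K (fun j => U j ω + w j x) ∂Pr‖ ≤ C := fun x => by
    have := norm_integral_le_of_norm_le_const (μ := Pr) (C := C)
      (f := fun ω => K fun j => U j ω + w j x) (ae_of_all _ fun ω => hC _)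
    simpa using this
  have hi1 : Integrable (fun x => w k x * ∫ ω, K (fun j => U j ω + w j x) ∂Pr) ν :=
    (hwi k).mul_bdd (c := C) (aestronglyMeasurable_integral_comp_add
      (fun j => (hw j).aemeasurable) (fun j => (hUi j).aemeasurable) hK) (ae_of_all _ hb)
  have hi2 : Integrable (fun ω => (∫ x, w k x ∂(N ω)) * K fun j => U j ω) Pr :=
    (hV k).mul_bdd (c := C) hKU (ae_of_all _ fun ω => hC _)
  calc ∫ ω, U k ω * K (fun j => U j ω) ∂Pr
      = ∫ ω, ((∫ x, w k x ∂(N ω)) * K (fun j => U j ω) -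
          (∫ x, w k x ∂ν) * K (fun j => U j ω)) ∂Pr :=
        integral_congr_ae (ae_of_all _ fun ω => by beta_reduce; rw [hU k ω]; ring)
    _ = ∫ x, w k x * ∫ ω, K (fun j => U j ω + w j x) ∂Pr ∂ν -
          (∫ x, w k x ∂ν) * ∫ ω, K (fun j => U j ω) ∂Pr := by
        rw [integral_sub hi2 (hKUi.const_mul _), h, integral_const_mul]
    _ = _ := by
        rw [← integral_mul_const, ← integral_sub hi1 ((hwi k).mul_const _)]
        refine integral_congr_ae (ae_of_all _ fun x => ?_)
        beta_reduce
        rw [integral_sub (hKw x) hKUi]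
        ring

lemma ae_integral_congr (hN : IsPoissonProcess N ν Pr) [IsProbabilityMeasure Pr] {w w' : E → ℝ}
    (h : w =ᵐ[ν] w') : ∀ᵐ ω ∂Pr, ∫ x, w x ∂(N ω) - ∫ x, w x ∂ν =
      ∫ x, w' x ∂(N ω) - ∫ x, w' x ∂ν := by
  filter_upwards [hN.ae_ae h] with ω hω
  rw [integral_congr_ae h, integral_congr_ae hω]

lemma aestronglyMeasurable_compensated (hN : IsPoissonProcess N ν Pr) [IsProbabilityMeasure Pr]
    {w : E → ℝ} (hwi : Integrable w ν) :
    AEStronglyMeasurable (fun ω => ∫ x, w x ∂(N ω) - ∫ x, w x ∂ν) Pr := by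
  have h := hwi.aemeasurable.ae_eq_mk
  refine AEStronglyMeasurable.congr ?_ (hN.ae_integral_congr h.symm)
  exact (hN.aestronglyMeasurable_integral hwi.aemeasurable.measurable_mk (hwi.congr h)).sub
    aestronglyMeasurable_const

/-- The integrands are replaced by measurable versions; almost surely this changes neither the
random integrals nor the compensators. -/
lemma stein_compensated (hN : IsPoissonProcess N ν Pr) [IsProbabilityMeasure Pr] [Fintype ι]
    {w : ι → E → ℝ} (hwi : ∀ k, Integrable (w k) ν)
    {K : (ι → ℝ) → ℝ} (hK : Measurable K) {C : ℝ} (hC : ∀ z, |K z| ≤ C) {U : ι → Ω → ℝ}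
    (hU : ∀ k ω, U k ω = ∫ x, w k x ∂(N ω) - ∫ x, w k x ∂ν) (k : ι) :
    ∫ ω, U k ω * K (fun j => U j ω) ∂Pr =
      ∫ x, w k x * ∫ ω, (K (fun j => U j ω + w j x) - K (fun j => U j ω)) ∂Pr ∂ν := by
  have hmk := fun j => (hwi j).aemeasurable.ae_eq_mk
  have h := hN.stein_integral (fun j => (hwi j).aemeasurable.measurable_mk)
    (fun j => (hwi j).congr (hmk j)) hK hC (fun _ _ => rfl) k
  have hUe : ∀ᵐ ω ∂Pr, ∀ j, U j ω = ∫ x, (hwi j).aemeasurable.mk (w j) x ∂(N ω) -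
      ∫ x, (hwi j).aemeasurable.mk (w j) x ∂ν := ae_all_iff.2 fun j => by
    filter_upwards [hN.ae_integral_congr (hmk j)] with ω hω
    rw [hU, hω]
  calc _ = _ := integral_congr_ae ?_
    _ = _ := h
    _ = _ := integral_congr_ae ?_
  · filter_upwards [hUe] with ω hω
    simp only [← hω]
  · filter_upwards [ae_all_iff.2 hmk] with x hx
    simp only [← hx]
    congr 1
    refine integral_congr_ae ?_
    filter_upwards [hUe] with ω hω
    simp only [← hω]

end IsPoissonProcess

/-! ### Continuity estimates for the two sides of the Stein identity. -/

lemma integral_abs_mul_abs_le {X : Type*} [MeasurableSpace X] {μ : Measure X} {f g : X → ℝ}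
    (hf : MemLp f 2 μ) (hg : MemLp g 2 μ) :
    ∫ x, |f x| * |g x| ∂μ ≤ (eLpNorm f 2 μ).toReal * (eLpNorm g 2 μ).toReal := by
  have h := eLpNorm_smul_le_mul_eLpNorm (p := 2) (q := 2) (r := 1) hg.1 hf.1
  have e : ∫ x, |f x| * |g x| ∂μ = (eLpNorm (f • g) 1 μ).toReal := by
    rw [eLpNorm_one_eq_lintegral_enorm, ← integral_norm_eq_lintegral_enorm (hf.1.smul hg.1)]
    simp
  rw [e, ← ENNReal.toReal_mul]
  exact ENNReal.toReal_mono (ENNReal.mul_ne_top hf.2.ne hg.2.ne) h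

lemma integrable_abs_mul_abs {X : Type*} [MeasurableSpace X] {μ : Measure X} {f g : X → ℝ}
    (hf : MemLp f 2 μ) (hg : MemLp g 2 μ) : Integrable (fun x => |f x| * |g x|) μ := by
  have h := (hf.integrable_mul hg).norm
  refine h.congr (ae_of_all _ fun x => ?_)
  simp

lemma integral_abs_le_eLpNorm_two {X : Type*} [MeasurableSpace X] {μ : Measure X}
    [IsProbabilityMeasure μ] {f : X → ℝ} (hf : MemLp f 2 μ) :
    ∫ x, |f x| ∂μ ≤ (eLpNorm f 2 μ).toReal := by
  have h := integral_abs_mul_abs_le hf (memLp_const (μ := μ) (p := 2) (1 : ℝ))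
  have h1 : eLpNorm (fun _ : X => (1 : ℝ)) 2 μ = 1 := by
    rw [eLpNorm_const _ two_ne_zero (IsProbabilityMeasure.ne_zero μ)]
    simp
  simpa [h1] using h

section Lipschitz

variable {Ω E ι : Type*} [MeasurableSpace Ω] [MeasurableSpace E] [Fintype ι]
  {ν : Measure E} {Pr : Measure Ω} {K : (ι → ℝ) → ℝ} {C L : ℝ}

lemma continuous_of_l1_lipschitz (hL : ∀ z z', |K z - K z'| ≤ L * ∑ j, |z j - z' j|) :
    Continuous K := by
  refine continuous_iff_continuousAt.2 fun z => ?_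
  rw [ContinuousAt, tendsto_iff_norm_sub_tendsto_zero]
  refine squeeze_zero (fun _ => norm_nonneg _) (fun y => hL y z) ?_
  have : Continuous fun y : ι → ℝ => L * ∑ j, |y j - z j| := by fun_prop
  simpa using this.tendsto z

variable [IsProbabilityMeasure Pr]

lemma integrable_comp_of_bound (hK : Continuous K) (hC : ∀ z, |K z| ≤ C)
    {U : ι → Ω → ℝ} (hU : ∀ j, AEStronglyMeasurable (U j) Pr) :
    Integrable (fun ω => K fun j => U j ω) Pr :=
  Integrable.of_bound (hK.comp_aestronglyMeasurable (aemeasurable_pi_lambda _ fun j =>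
    (hU j).aemeasurable).aestronglyMeasurable) C (ae_of_all _ fun _ => hC _)

lemma abs_integral_shift_le (hL : ∀ z z', |K z - K z'| ≤ L * ∑ j, |z j - z' j|)
    (U : ι → Ω → ℝ) (v : ι → ℝ) :
    |∫ ω, (K (fun j => U j ω + v j) - K fun j => U j ω) ∂Pr| ≤ L * ∑ j, |v j| := by
  have := norm_integral_le_of_norm_le_const (μ := Pr) (C := L * ∑ j, |v j|)
    (f := fun ω => K (fun j => U j ω + v j) - K fun j => U j ω)
    (ae_of_all _ fun ω => (hL _ _).trans_eq (by simp))
  simpa using this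

lemma integrable_shift (hK : Continuous K) (hC : ∀ z, |K z| ≤ C) {U : ι → Ω → ℝ}
    (hU : ∀ j, AEStronglyMeasurable (U j) Pr) (v : ι → ℝ) :
    Integrable (fun ω => K (fun j => U j ω + v j) - K fun j => U j ω) Pr :=
  Integrable.sub (integrable_comp_of_bound hK hC fun j => (hU j).add aestronglyMeasurable_const)
    (integrable_comp_of_bound hK hC hU)

lemma abs_integral_shift_sub_le (hL : ∀ z z', |K z - K z'| ≤ L * ∑ j, |z j - z' j|)
    (hC : ∀ z, |K z| ≤ C) {U : ι → Ω → ℝ} (hU : ∀ j, AEStronglyMeasurable (U j) Pr)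
    (v v' : ι → ℝ) :
    |∫ ω, (K (fun j => U j ω + v j) - K fun j => U j ω) ∂Pr -
      ∫ ω, (K (fun j => U j ω + v' j) - K fun j => U j ω) ∂Pr| ≤ L * ∑ j, |v j - v' j| := by
  have hK := continuous_of_l1_lipschitz hL
  rw [← integral_sub (integrable_shift hK hC hU v) (integrable_shift hK hC hU v')]
  have := norm_integral_le_of_norm_le_const (μ := Pr) (C := L * ∑ j, |v j - v' j|)
    (f := fun ω => (K (fun j => U j ω + v j) - K fun j => U j ω) -
      (K (fun j => U j ω + v' j) - K fun j => U j ω)) (ae_of_all _ fun ω => by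
        rw [sub_sub_sub_cancel_right]
        exact (hL _ _).trans_eq (by simp))
  simpa using this

/-- The factor `2` counts the two occurrences of `K`. The bound does not involve `v`, and gives
convergence of the inner expectation at each point of the base space. -/
lemma abs_integral_shift_sub_shift_le (hL0 : 0 ≤ L)
    (hL : ∀ z z', |K z - K z'| ≤ L * ∑ j, |z j - z' j|)
    (hC : ∀ z, |K z| ≤ C) {U V : ι → Ω → ℝ} (hU : ∀ j, AEStronglyMeasurable (U j) Pr)
    (hV : ∀ j, AEStronglyMeasurable (V j) Pr)
    (hUV : ∀ j, MemLp (fun ω => U j ω - V j ω) 2 Pr) (v : ι → ℝ) :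
    |∫ ω, (K (fun j => U j ω + v j) - K fun j => U j ω) ∂Pr -
      ∫ ω, (K (fun j => V j ω + v j) - K fun j => V j ω) ∂Pr| ≤
      2 * L * ∑ j, (eLpNorm (fun ω => U j ω - V j ω) 2 Pr).toReal := by
  have hK := continuous_of_l1_lipschitz hL
  have hi : ∀ j, Integrable (fun ω => |U j ω - V j ω|) Pr := fun j =>
    ((hUV j).integrable one_le_two).abs
  rw [← integral_sub (integrable_shift hK hC hU v) (integrable_shift hK hC hV v)]
  have h := norm_integral_le_of_norm_le (μ := Pr) (g := fun ω => 2 * L * ∑ j, |U j ω - V j ω|)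
    (f := fun ω => (K (fun j => U j ω + v j) - K fun j => U j ω) -
      (K (fun j => V j ω + v j) - K fun j => V j ω))
    ((integrable_finsetSum _ fun j _ => hi j).const_mul _) (ae_of_all _ fun ω => by
      have h1 := hL (fun j => U j ω + v j) (fun j => V j ω + v j)
      have h2 := hL (fun j => U j ω) (fun j => V j ω)
      simp only [add_sub_add_right_eq_sub] at h1
      rw [sub_sub_sub_comm, Real.norm_eq_abs]
      refine (abs_sub _ _).trans ?_
      linarith)
  rw [integral_const_mul, integral_finsetSum _ fun j _ => hi j, Real.norm_eq_abs] at h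
  refine h.trans ?_
  gcongr with j
  exact integral_abs_le_eLpNorm_two (hUV j)

/-- The change of the factor `U k` is paid for by the bound on `K`, and the change inside `K` by its
Lipschitz constant and Cauchy-Schwarz. -/
lemma abs_integral_mul_comp_sub_le (hL0 : 0 ≤ L)
    (hL : ∀ z z', |K z - K z'| ≤ L * ∑ j, |z j - z' j|)
    (hC : ∀ z, |K z| ≤ C) {U V : ι → Ω → ℝ} (hV : ∀ j, MemLp (V j) 2 Pr)
    (hUV : ∀ j, MemLp (fun ω => U j ω - V j ω) 2 Pr) (k : ι) :
    |∫ ω, U k ω * K (fun j => U j ω) ∂Pr - ∫ ω, V k ω * K (fun j => V j ω) ∂Pr| ≤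
      C * (eLpNorm (fun ω => U k ω - V k ω) 2 Pr).toReal +
      L * ∑ j, (eLpNorm (V k) 2 Pr).toReal * (eLpNorm (fun ω => U j ω - V j ω) 2 Pr).toReal := by
  have hK := continuous_of_l1_lipschitz hL
  have hC0 : 0 ≤ C := (abs_nonneg _).trans (hC 0)
  have hU2 : ∀ j, MemLp (U j) 2 Pr := fun j => by
    have h := (hUV j).add (hV j)
    exact h.ae_eq (ae_of_all _ fun ω => by simp)
  have hiU : ∀ {W : ι → Ω → ℝ}, (∀ j, MemLp (W j) 2 Pr) →
      Integrable (fun ω => W k ω * K (fun j => W j ω)) Pr := fun {W} hW =>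
    ((hW k).integrable one_le_two).mul_bdd (c := C)
      (integrable_comp_of_bound hK hC fun j => (hW j).1).1 (ae_of_all _ fun ω => hC _)
  have hi := (hUV k).integrable one_le_two |>.abs
  have hi2 : ∀ j, Integrable (fun ω => |V k ω| * |U j ω - V j ω|) Pr := fun j =>
    integrable_abs_mul_abs (hV k) (hUV j)
  rw [← integral_sub (hiU hU2) (hiU hV)]
  have h := norm_integral_le_of_norm_le (μ := Pr)
    (g := fun ω => C * |U k ω - V k ω| + L * ∑ j, |V k ω| * |U j ω - V j ω|)
    (f := fun ω => U k ω * K (fun j => U j ω) - V k ω * K (fun j => V j ω))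
    ((hi.const_mul _).add ((integrable_finsetSum _ fun j _ => hi2 j).const_mul _))
    (ae_of_all _ fun ω => by
      have h2 := hL (fun j => U j ω) (fun j => V j ω)
      have h3 := hC (fun j => U j ω)
      have e : U k ω * K (fun j => U j ω) - V k ω * K (fun j => V j ω) =
        (U k ω - V k ω) * K (fun j => U j ω) +
          V k ω * (K (fun j => U j ω) - K (fun j => V j ω)) := by ring
      rw [e, Real.norm_eq_abs]
      refine (abs_add_le _ _).trans ?_
      rw [abs_mul, abs_mul, ← Finset.mul_sum, mul_left_comm, mul_comm C]
      gcongr)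
  rw [integral_add (hi.const_mul _) ((integrable_finsetSum _ fun j _ => hi2 j).const_mul _),
    integral_const_mul, integral_const_mul, integral_finsetSum _ fun j _ => hi2 j,
    Real.norm_eq_abs] at h
  refine h.trans ?_
  gcongr with j
  · exact integral_abs_le_eLpNorm_two (hUV k)
  · exact integral_abs_mul_abs_le (hV k) (hUV j)

/-- As `ν` may be infinite, boundedness of `K` is not enough. The Lipschitz bound makes the inner
expectation `O(∑ |v_j|)`, so the integrand is dominated by products of `L²` functions. -/
lemma integrable_mul_shift (hL : ∀ z z', |K z - K z'| ≤ L * ∑ j, |z j - z' j|)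
    {U : ι → Ω → ℝ} (hU : ∀ j, AEStronglyMeasurable (U j) Pr) {f : E → ℝ} {v : ι → E → ℝ}
    (hf : MemLp f 2 ν) (hv : ∀ j, MemLp (v j) 2 ν) :
    Integrable (fun x => f x * ∫ ω, (K (fun j => U j ω + v j x) - K fun j => U j ω) ∂Pr) ν := by
  have hK := continuous_of_l1_lipschitz hL
  have hm : AEStronglyMeasurable
      (fun x => ∫ ω, (K (fun j => U j ω + v j x) - K fun j => U j ω) ∂Pr) ν := by
    have hU' : AEMeasurable (fun z : E × Ω => fun j => U j z.2) (ν.prod Pr) :=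
      aemeasurable_pi_lambda _ fun j =>
        (hU j).aemeasurable.comp_quasiMeasurePreserving Measure.quasiMeasurePreserving_snd
    have hv' : AEMeasurable (fun z : E × Ω => fun j => v j z.1) (ν.prod Pr) :=
      aemeasurable_pi_lambda _ fun j =>
        (hv j).1.aemeasurable.comp_quasiMeasurePreserving Measure.quasiMeasurePreserving_fst
    exact AEStronglyMeasurable.integral_prod_right' (ν := Pr)
      (f := fun z : E × Ω => K (fun j => U j z.2 + v j z.1) - K fun j => U j z.2)
      ((hK.measurable.comp_aemeasurable (hU'.add hv')).sub
        (hK.measurable.comp_aemeasurable hU')).aestronglyMeasurable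
  refine Integrable.mono' (g := fun x => L * ∑ j, |f x| * |v j x|)
    ((integrable_finsetSum _ fun j _ => integrable_abs_mul_abs hf (hv j)).const_mul _)
    (hf.1.mul hm) (ae_of_all _ fun x => ?_)
  rw [norm_mul, ← Finset.mul_sum, mul_left_comm]
  exact mul_le_mul_of_nonneg_left (abs_integral_shift_le hL _ _) (norm_nonneg _)

/-- The right-hand side does not depend on `U`, so `w` can be replaced by `u` uniformly along the
approximating random vectors. -/
lemma abs_integral_mul_shift_sub_le (hL0 : 0 ≤ L)
    (hL : ∀ z z', |K z - K z'| ≤ L * ∑ j, |z j - z' j|) (hC : ∀ z, |K z| ≤ C)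
    {U : ι → Ω → ℝ} (hU : ∀ j, AEStronglyMeasurable (U j) Pr) {w u : ι → E → ℝ}
    (hw : ∀ j, MemLp (w j) 2 ν) (hu : ∀ j, MemLp (u j) 2 ν) (k : ι) :
    |∫ x, w k x * ∫ ω, (K (fun j => U j ω + w j x) - K fun j => U j ω) ∂Pr ∂ν -
      ∫ x, u k x * ∫ ω, (K (fun j => U j ω + u j x) - K fun j => U j ω) ∂Pr ∂ν| ≤
      L * ∑ j, ((eLpNorm (fun x => w k x - u k x) 2 ν).toReal * (eLpNorm (w j) 2 ν).toReal +
        (eLpNorm (u k) 2 ν).toReal * (eLpNorm (fun x => w j x - u j x) 2 ν).toReal) := by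
  have hwu : ∀ j, MemLp (fun x => w j x - u j x) 2 ν := fun j => (hw j).sub (hu j)
  have hi1 := fun j => integrable_abs_mul_abs (hwu k) (hw j)
  have hi2 := fun j => integrable_abs_mul_abs (hu k) (hwu j)
  have hi : ∀ j, Integrable (fun x => |w k x - u k x| * |w j x| + |u k x| * |w j x - u j x|) ν :=
    fun j => (hi1 j).add (hi2 j)
  rw [← integral_sub (integrable_mul_shift hL hU (hw k) hw)
    (integrable_mul_shift hL hU (hu k) hu)]
  have h := norm_integral_le_of_norm_le (μ := ν)
    (g := fun x => L * ∑ j, (|w k x - u k x| * |w j x| + |u k x| * |w j x - u j x|))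
    (f := fun x => w k x * ∫ ω, (K (fun j => U j ω + w j x) - K fun j => U j ω) ∂Pr -
      u k x * ∫ ω, (K (fun j => U j ω + u j x) - K fun j => U j ω) ∂Pr)
    ((integrable_finsetSum _ fun j _ => hi j).const_mul _)
    (ae_of_all _ fun x => by
      have h1 := abs_integral_shift_le (Pr := Pr) hL U fun j => w j x
      have h2 := abs_integral_shift_sub_le hL hC hU (fun j => w j x) fun j => u j x
      rw [Real.norm_eq_abs]
      generalize ∫ ω, (K (fun j => U j ω + w j x) - K fun j => U j ω) ∂Pr = a at h1 h2 ⊢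
      generalize ∫ ω, (K (fun j => U j ω + u j x) - K fun j => U j ω) ∂Pr = b at h2 ⊢
      have e : w k x * a - u k x * b = (w k x - u k x) * a + u k x * (a - b) := by ring
      rw [e, Finset.sum_add_distrib, ← Finset.mul_sum, ← Finset.mul_sum, mul_add,
        mul_left_comm, mul_left_comm L]
      refine (abs_add_le _ _).trans ?_
      rw [abs_mul, abs_mul]
      gcongr)
  rw [integral_const_mul, integral_finsetSum _ fun j _ => hi j,
    Real.norm_eq_abs] at h
  refine h.trans ?_
  gcongr with j
  rw [integral_add (hi1 j) (hi2 j)]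
  exact add_le_add (integral_abs_mul_abs_le (hwu k) (hw j)) (integral_abs_mul_abs_le (hu k) (hwu j))

end Lipschitz

/-- The Stein identity for compensated Poisson integrals. -/
lemma IsPoissonProcess.stein {Ω E ι : Type*} [MeasurableSpace Ω] [MeasurableSpace E] [Fintype ι]
    {N : Ω → Measure E} {ν : Measure E} {Pr : Measure Ω} [IsProbabilityMeasure Pr]
    (hN : IsPoissonProcess N ν Pr) {u : ι → E → ℝ} {δ : ι → Ω → ℝ}
    (hδ : ∀ j, IsCompensatedIntegral N ν Pr (u j) (δ j)) {K : (ι → ℝ) → ℝ} {C L : ℝ}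
    (hL0 : 0 ≤ L) (hL : ∀ z z', |K z - K z'| ≤ L * ∑ j, |z j - z' j|) (hC : ∀ z, |K z| ≤ C)
    (k : ι) :
    ∫ ω, δ k ω * K (fun j => δ j ω) ∂Pr =
      ∫ x, u k x * ∫ ω, (K (fun j => δ j ω + u j x) - K fun j => δ j ω) ∂Pr ∂ν := by
  have hK := continuous_of_l1_lipschitz hL
  have hu := fun j => (hδ j).1
  have hδ2 := fun j => (hδ j).2.1
  choose w hw hwu hwδ using fun j => (hδ j).2.2
  set Z : ℕ → ι → Ω → ℝ := fun m j ω => ∫ x, w j m x ∂(N ω) - ∫ x, w j m x ∂ν with hZ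
  have hZm : ∀ m j, AEStronglyMeasurable (Z m j) Pr := fun m j =>
    hN.aestronglyMeasurable_compensated (memLp_one_iff_integrable.1 (hw j m).1)
  have ha : ∀ j, Tendsto (fun m => (eLpNorm (fun ω => Z m j ω - δ j ω) 2 Pr).toReal) atTop (𝓝 0) :=
    fun j => (ENNReal.tendsto_toReal ENNReal.zero_ne_top).comp (hwδ j)
  have hb : ∀ j, Tendsto (fun m => (eLpNorm (fun x => w j m x - u j x) 2 ν).toReal) atTop (𝓝 0) :=
    fun j => (ENNReal.tendsto_toReal ENNReal.zero_ne_top).comp (hwu j)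
  -- Square integrability of `Z m j - δ j` is guaranteed only for large `m`, once its `L²` seminorm
  -- is finite.
  have hmem : ∀ᶠ m in atTop, ∀ j, MemLp (fun ω => Z m j ω - δ j ω) 2 Pr := by
    refine eventually_all.2 fun j => ?_
    filter_upwards [(hwδ j).eventually_lt_const ENNReal.zero_lt_top] with m hm
    exact ⟨(hZm m j).sub (hδ2 j).1, hm⟩
  have hlhs : Tendsto (fun m => ∫ ω, Z m k ω * K (fun j => Z m j ω) ∂Pr) atTop
      (𝓝 (∫ ω, δ k ω * K (fun j => δ j ω) ∂Pr)) := by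
    rw [tendsto_iff_norm_sub_tendsto_zero]
    refine squeeze_zero' (Eventually.of_forall fun _ => norm_nonneg _) (hmem.mono fun m hm =>
      abs_integral_mul_comp_sub_le hL0 hL hC hδ2 hm k) ?_
    have := ((ha k).const_mul C).add ((tendsto_finsetSum Finset.univ fun j _ =>
      (ha j).const_mul (eLpNorm (δ k) 2 Pr).toReal).const_mul L)
    simpa using this
  -- Here the integrands `u` are fixed and only the random vector varies, so dominated convergence
  -- over the base space applies.
  have hmid : Tendsto (fun m => ∫ x, u k x *
      ∫ ω, (K (fun j => Z m j ω + u j x) - K fun j => Z m j ω) ∂Pr ∂ν) atTop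
      (𝓝 (∫ x, u k x * ∫ ω, (K (fun j => δ j ω + u j x) - K fun j => δ j ω) ∂Pr ∂ν)) := by
    refine tendsto_integral_of_dominated_convergence (fun x => L * ∑ j, |u k x| * |u j x|)
      (fun m => (integrable_mul_shift hL (hZm m) (hu k) hu).1)
      ((integrable_finsetSum _ fun j _ => integrable_abs_mul_abs (hu k) (hu j)).const_mul _)
      (fun m => ae_of_all _ fun x => ?_) (ae_of_all _ fun x => ?_)
    · rw [norm_mul, ← Finset.mul_sum, mul_left_comm]
      exact mul_le_mul_of_nonneg_left (abs_integral_shift_le hL _ _) (norm_nonneg _)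
    · refine Tendsto.const_mul _ ?_
      rw [tendsto_iff_norm_sub_tendsto_zero]
      refine squeeze_zero' (Eventually.of_forall fun _ => norm_nonneg _) (hmem.mono fun m hm =>
        abs_integral_shift_sub_shift_le hL0 hL hC (hZm m) (fun j => (hδ2 j).1) hm _) ?_
      simpa using (tendsto_finsetSum Finset.univ fun j _ => ha j).const_mul (2 * L)
  have hdiff : Tendsto (fun m => ∫ x, w k m x *
        ∫ ω, (K (fun j => Z m j ω + w j m x) - K fun j => Z m j ω) ∂Pr ∂ν -
      ∫ x, u k x * ∫ ω, (K (fun j => Z m j ω + u j x) - K fun j => Z m j ω) ∂Pr ∂ν) atTop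
      (𝓝 0) := by
    rw [tendsto_zero_iff_norm_tendsto_zero]
    have hle : ∀ m j, (eLpNorm (w j m) 2 ν).toReal ≤
        (eLpNorm (fun x => w j m x - u j x) 2 ν).toReal + (eLpNorm (u j) 2 ν).toReal := by
      intro m j
      have hs : MemLp (fun x => w j m x - u j x) 2 ν := (hw j m).2.sub (hu j)
      rw [← ENNReal.toReal_add hs.2.ne (hu j).2.ne]
      refine ENNReal.toReal_mono (ENNReal.add_ne_top.2 ⟨hs.2.ne, (hu j).2.ne⟩) ?_
      have := eLpNorm_add_le hs.1 (hu j).1 one_le_two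
      rwa [show (fun x => w j m x - u j x) + u j = w j m from sub_add_cancel _ _] at this
    refine squeeze_zero (fun _ => norm_nonneg _) (fun m => (abs_integral_mul_shift_sub_le hL0 hL hC
      (hZm m) (fun j => (hw j m).2) hu k).trans (mul_le_mul_of_nonneg_left (Finset.sum_le_sum
        fun j _ => add_le_add_left (mul_le_mul_of_nonneg_left (hle m j) ENNReal.toReal_nonneg) _)
        hL0)) ?_
    have := (tendsto_finsetSum Finset.univ fun j _ =>
      ((hb k).mul ((hb j).add_const (eLpNorm (u j) 2 ν).toReal)).add
        ((hb j).const_mul (eLpNorm (u k) 2 ν).toReal)).const_mul L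
    simpa using this
  have hst : ∀ m, ∫ ω, Z m k ω * K (fun j => Z m j ω) ∂Pr = ∫ x, w k m x *
      ∫ ω, (K (fun j => Z m j ω + w j m x) - K fun j => Z m j ω) ∂Pr ∂ν := fun m =>
    hN.stein_compensated (fun j => memLp_one_iff_integrable.1 (hw j m).1) hK.measurable hC
      (fun _ _ => rfl) k
  have hfin := hdiff.add hmid
  simp only [sub_add_cancel, zero_add, ← hst] at hfin
  exact tendsto_nhds_unique hlhs hfin

/-! ### Partial derivatives and mollification -/

section Mollify

variable {ι : Type*} [Fintype ι] [DecidableEq ι]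

/-- The partial derivative in the coordinate `k`. -/
def pd (f : (ι → ℝ) → ℝ) (k : ι) (z : ι → ℝ) : ℝ := fderiv ℝ f z (Pi.single k 1)

lemma contDiff_pd {f : (ι → ℝ) → ℝ} {m k : ℕ} (hf : ContDiff ℝ m f) (hk : k + 1 ≤ m) (j : ι) :
    ContDiff ℝ k (pd f j) := by
  unfold pd
  exact (hf.fderiv_right (by exact_mod_cast hk)).clm_apply contDiff_const

lemma fderiv_eq_sum_pd (f : (ι → ℝ) → ℝ) (z v : ι → ℝ) : fderiv ℝ f z v = ∑ j, v j * pd f j z := by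
  conv_lhs => rw [← Finset.univ_sum_single v]
  rw [map_sum]
  refine Finset.sum_congr rfl fun j _ => ?_
  rw [pd, ← smul_eq_mul, ← map_smul, ← Pi.single_smul, smul_eq_mul, mul_one]

lemma hasDerivAt_pd {f : (ι → ℝ) → ℝ} (hf : Differentiable ℝ f) (z : ι → ℝ) (k : ι) :
    HasDerivAt (fun s : ℝ => f (z + Pi.single k s)) (pd f k z) 0 := by
  have h1 : HasDerivAt (fun s : ℝ => z + Pi.single k s) (Pi.single k (1 : ℝ)) 0 :=
    ((ContinuousLinearMap.single ℝ (fun _ : ι => ℝ) k).hasDerivAt (x := 0)).const_add z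
  have h2 : HasFDerivAt f (fderiv ℝ f z) (z + Pi.single k (0 : ℝ)) := by
    simpa using (hf z).hasFDerivAt
  exact h2.comp_hasDerivAt 0 h1

lemma hasDerivAt_pd_add {f : (ι → ℝ) → ℝ} (hf : Differentiable ℝ f) (z : ι → ℝ) (k : ι) (t : ℝ) :
    HasDerivAt (fun s : ℝ => f (z + Pi.single k s)) (pd f k (z + Pi.single k t)) t := by
  have h := hasDerivAt_pd hf (z + Pi.single k t) k
  have e : (fun s : ℝ => f (z + Pi.single k t + Pi.single k s)) =
      fun s => (fun s => f (z + Pi.single k s)) (t + s) := by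
    funext s
    rw [add_assoc, ← Pi.single_add]
  rw [e] at h
  have h2 := HasDerivAt.comp_sub_const (x := t) (a := t) (f := fun s => f (z + Pi.single k (t + s)))
    (f' := pd f k (z + Pi.single k t)) (by simpa using h)
  simpa using h2

lemma abs_pd_le {f : (ι → ℝ) → ℝ} (hf : Differentiable ℝ f) {M : ℝ} (hM : 0 ≤ M)
    (h : ∀ z z', |f z - f z'| ≤ M * ∑ j, |z j - z' j|) (k : ι) (z : ι → ℝ) : |pd f k z| ≤ M := by
  refine (hasDerivAt_pd hf z k).le_of_lip' hM (Eventually.of_forall fun s => ?_)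
  refine (h _ _).trans_eq ?_
  simp [Pi.single_apply, apply_ite abs]

/-- Dividing the third difference by `s` and letting `s → 0` gives a mixed difference of `pd f k`;
the same with `t` gives the increment of the second partial derivative. -/
lemma abs_pd_pd_sub_le {f : (ι → ℝ) → ℝ} (hf : ContDiff ℝ 2 f) {C : ℝ} (hC : 0 ≤ C)
    (h : ∀ (z g : ι → ℝ) (k l : ι) (s t : ℝ),
      |delta3 f z (Pi.single k s) (Pi.single l t) g| ≤ C * |s| * |t| * ∑ j, |g j|)
    (k l : ι) (z g : ι → ℝ) :
    |pd (pd f k) l (z + g) - pd (pd f k) l z| ≤ C * ∑ j, |g j| := by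
  have hd : Differentiable ℝ f := hf.differentiable two_ne_zero
  have hd1 : Differentiable ℝ (pd f k) :=
    (contDiff_pd (m := 2) (k := 1) (by exact_mod_cast hf) le_rfl k).differentiable (by simp)
  have hS : 0 ≤ ∑ j, |g j| := Finset.sum_nonneg fun _ _ => abs_nonneg _
  have h1 : ∀ t : ℝ, |(pd f k (z + g + Pi.single l t) - pd f k (z + g)) -
      (pd f k (z + Pi.single l t) - pd f k z)| ≤ C * (∑ j, |g j|) * |t| := by
    intro t
    have hD := ((hasDerivAt_pd hd (z + g + Pi.single l t) k).sub
      (hasDerivAt_pd hd (z + g) k)).sub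
      ((hasDerivAt_pd hd (z + Pi.single l t) k).sub (hasDerivAt_pd hd z k))
    refine hD.le_of_lip' (by positivity) (Eventually.of_forall fun s => ?_)
    have := h z g k l s t
    simp only [Pi.sub_apply, Pi.single_zero, add_zero, sub_zero, Real.norm_eq_abs, delta3] at this ⊢
    refine le_trans (le_of_eq ?_) (this.trans_eq (by ring))
    have e1 : z + g + Pi.single l t + Pi.single k s = z + (g + Pi.single k s + Pi.single l t) := by
      abel
    have e2 : z + g + Pi.single l t = z + (g + Pi.single l t) := by abel
    have e3 : z + g + Pi.single k s = z + (g + Pi.single k s) := by abel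
    have e4 : z + Pi.single l t + Pi.single k s = z + (Pi.single k s + Pi.single l t) := by abel
    rw [e1, e2, e3, e4]
    congr 1
    ring
  have hD := ((hasDerivAt_pd hd1 (z + g) l).sub (hasDerivAt_pd hd1 z l))
  refine hD.le_of_lip' (by positivity) (Eventually.of_forall fun t => ?_)
  have := h1 t
  simp only [Pi.sub_apply, Pi.single_zero, add_zero, sub_zero, Real.norm_eq_abs] at this ⊢
  refine le_trans (le_of_eq ?_) this
  congr 1
  ring

/-- On a unit segment the mean value theorem finds a point where the partial derivative is at most
`2 * M`, and the Lipschitz property brings the bound back to `z`. It serves to make second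
derivatives bounded, and leaves no trace in the final constant. -/
lemma abs_pd_le_of_bound {f : (ι → ℝ) → ℝ} (hf : ContDiff ℝ 1 f) {M C : ℝ} {k : ι}
    (hM : ∀ z, |f z| ≤ M) (hC : ∀ z g, |pd f k (z + g) - pd f k z| ≤ C * ∑ j, |g j|)
    (z : ι → ℝ) : |pd f k z| ≤ 2 * M + C := by
  have hd : Differentiable ℝ f := hf.differentiable one_ne_zero
  obtain ⟨c, hc, hc'⟩ := exists_hasDerivAt_eq_slope (fun s : ℝ => f (z + Pi.single k s))
    (fun s => pd f k (z + Pi.single k s)) (zero_lt_one)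
    (fun s _ => (hasDerivAt_pd_add hd z k s).continuousAt.continuousWithinAt)
    (fun s _ => hasDerivAt_pd_add hd z k s)
  have h1 := hC z (Pi.single k c)
  have h2 : ∑ j, |(Pi.single k c : ι → ℝ) j| = c := by
    simp [Pi.single_apply, apply_ite abs, abs_of_pos hc.1]
  rw [h2] at h1
  have hC0 : 0 ≤ C := by
    have := (abs_nonneg _).trans h1
    exact nonneg_of_mul_nonneg_left this hc.1
  simp only [Pi.single_zero, add_zero, sub_zero, div_one] at hc'
  have h3 := hM (z + Pi.single k 1)
  have h4 := hM z
  have h5 : C * c ≤ C := mul_le_of_le_one_right hC0 hc.2.le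
  rw [hc'] at h1
  rw [abs_le] at *
  constructor <;> linarith [h1.1, h1.2, h3.1, h3.2, h4.1, h4.2]

lemma abs_sub_le_of_abs_pd_le {f : (ι → ℝ) → ℝ} (hf : ContDiff ℝ 1 f) {L : ℝ}
    (h : ∀ j z, |pd f j z| ≤ L) (z z' : ι → ℝ) : |f z - f z'| ≤ L * ∑ j, |z j - z' j| := by
  have h1 := integral_fderiv_line hf z' (z - z')
  rw [add_sub_cancel] at h1
  rw [← h1, ← Real.norm_eq_abs]
  refine (intervalIntegral.norm_integral_le_of_norm_le_const
    (C := L * ∑ j, |z j - z' j|) fun s _ => ?_).trans_eq (by simp)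
  rw [fderiv_eq_sum_pd, Finset.mul_sum]
  refine (norm_sum_le _ _).trans (Finset.sum_le_sum fun j _ => ?_)
  rw [norm_mul, mul_comm]
  exact mul_le_mul_of_nonneg_right (h _ _) (abs_nonneg _)

/-- A Taylor estimate for functions with Lipschitz partial derivatives. -/
lemma abs_taylor_le {f : (ι → ℝ) → ℝ} (hf : ContDiff ℝ 1 f) {C : ℝ}
    (hC : ∀ j z g, |pd f j (z + g) - pd f j z| ≤ C * ∑ i, |g i|) (z v : ι → ℝ) :
    |f (z + v) - f z - ∑ j, v j * pd f j z| ≤ 1 / 2 * C * (∑ j, |v j|) ^ 2 := by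
  have hc : ∀ j, Continuous (pd f j) := fun j =>
    (contDiff_pd (m := 1) (k := 0) (by exact_mod_cast hf) le_rfl j).continuous
  have h1 : ∫ s in (0 : ℝ)..1, ∑ j, v j * (pd f j (z + s • v) - pd f j z) =
      f (z + v) - f z - ∑ j, v j * pd f j z := by
    rw [← integral_fderiv_line hf z v]
    simp only [mul_sub, Finset.sum_sub_distrib]
    rw [intervalIntegral.integral_sub]
    · simp only [fderiv_eq_sum_pd, intervalIntegral.integral_const, sub_zero, one_smul]
    · refine Continuous.intervalIntegrable ?_ _ _
      refine continuous_finsetSum _ fun j _ => ?_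
      exact continuous_const.mul ((hc j).comp (by fun_prop))
    · exact intervalIntegrable_const
  rw [← h1, ← Real.norm_eq_abs]
  have h2 : ‖∫ s in (0 : ℝ)..1, ∑ j, v j * (pd f j (z + s • v) - pd f j z)‖ ≤
      ∫ s in (0 : ℝ)..1, C * (∑ j, |v j|) ^ 2 * s := by
    refine intervalIntegral.norm_integral_le_of_norm_le zero_le_one
      (ae_of_all _ fun s hs => ?_)
      (Continuous.intervalIntegrable (by fun_prop) _ _)
    refine (norm_sum_le _ _).trans ?_
    have h3 : ∀ j, ‖v j * (pd f j (z + s • v) - pd f j z)‖ ≤ |v j| * (C * (s * ∑ i, |v i|)) := by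
      intro j
      rw [norm_mul, Real.norm_eq_abs, Real.norm_eq_abs]
      refine mul_le_mul_of_nonneg_left ((hC j z (s • v)).trans_eq ?_) (abs_nonneg _)
      simp [abs_mul, abs_of_pos hs.1, Finset.mul_sum]
    refine (Finset.sum_le_sum fun j _ => h3 j).trans_eq ?_
    rw [← Finset.sum_mul]
    ring
  refine h2.trans_eq ?_
  rw [intervalIntegral.integral_const_mul, integral_id]
  ring

/-- Functions with an `ℓ¹` Lipschitz bound `M` and a third difference bound `C` are uniform limits
of smooth functions with the same bounds. -/
lemma exists_smooth_approx {G : (ι → ℝ) → ℝ} {M C : ℝ} (hM : 0 ≤ M)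
    (hG : ∀ z z', |G z - G z'| ≤ M * ∑ j, |z j - z' j|)
    (hG3 : ∀ (z g : ι → ℝ) (k l : ι) (s t : ℝ),
      |delta3 G z (Pi.single k s) (Pi.single l t) g| ≤ C * |s| * |t| * ∑ j, |g j|)
    {ε : ℝ} (hε : 0 < ε) :
    ∃ H : (ι → ℝ) → ℝ, ContDiff ℝ 2 H ∧ (∀ z, |H z - G z| ≤ ε) ∧
      (∀ z z', |H z - H z'| ≤ M * ∑ j, |z j - z' j|) ∧
      ∀ (z g : ι → ℝ) (k l : ι) (s t : ℝ),
        |delta3 H z (Pi.single k s) (Pi.single l t) g| ≤ C * |s| * |t| * ∑ j, |g j| := by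
  have hGc : Continuous G := continuous_of_l1_lipschitz hG
  -- With this radius, averaging moves `G` by at most `M * card ι * r ≤ ε`; the `+ 1` avoids
  -- division by zero.
  set r : ℝ := ε / (M * Fintype.card ι + 1) with hr
  have hr0 : 0 < r := by positivity
  let φ : ContDiffBump (0 : ι → ℝ) := ⟨r / 2, r, by positivity, by linarith⟩
  set ρ : (ι → ℝ) → ℝ := φ.normed volume with hρ
  have hρ0 : ∀ t, 0 ≤ ρ t := fun t => φ.nonneg_normed t
  have hρ1 : ∫ t, ρ t = 1 := φ.integral_normed
  have hρi : Integrable ρ := φ.integrable_normed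
  set H : (ι → ℝ) → ℝ := fun z => ∫ t, ρ t * G (z - t) with hH
  have hHconv : H = convolution ρ G (ContinuousLinearMap.lsmul ℝ ℝ) volume := by
    funext z
    simp [hH, convolution]
  have hint : ∀ z, Integrable fun t => ρ t * G (z - t) := fun z => by
    refine Continuous.integrable_of_hasCompactSupport ?_ ?_
    · exact φ.continuous_normed.mul (hGc.comp (by fun_prop))
    · exact φ.hasCompactSupport_normed.mul_right
  have hbd : ∀ (q : (ι → ℝ) → ℝ) (B : ℝ), (∀ t, ρ t ≠ 0 → |q t| ≤ B) →
      |∫ t, ρ t * q t| ≤ B := by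
    intro q B hq
    rw [← Real.norm_eq_abs]
    refine (norm_integral_le_of_norm_le (hρi.mul_const B) (ae_of_all _ fun t => ?_)).trans_eq ?_
    · rw [norm_mul, Real.norm_of_nonneg (hρ0 t)]
      rcases eq_or_ne (ρ t) 0 with h0 | h0
      · simp [h0]
      · exact mul_le_mul_of_nonneg_left (hq t h0) (hρ0 t)
    · rw [integral_mul_const, hρ1, one_mul]
  refine ⟨H, ?_, fun z => ?_, fun z z' => ?_, fun z g k l s t => ?_⟩
  · rw [hHconv]
    exact φ.hasCompactSupport_normed.contDiff_convolution_left _ φ.contDiff_normed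
      hGc.locallyIntegrable
  · have e : H z - G z = ∫ t, ρ t * (G (z - t) - G z) := by
      simp only [mul_sub]
      rw [integral_sub (hint z) (hρi.mul_const _), integral_mul_const, hρ1, one_mul]
    rw [e]
    refine hbd _ _ fun t ht => (hG _ _).trans ?_
    have ht' : t ∈ Metric.ball (0 : ι → ℝ) r := by
      have : t ∈ Function.support (φ.normed volume) := ht
      rwa [φ.support_normed_eq] at this
    rw [mem_ball_zero_iff] at ht'
    have h1 : ∑ j, |(z - t) j - z j| ≤ Fintype.card ι * r := by
      have : ∀ j ∈ Finset.univ, |(z - t) j - z j| ≤ r := fun j _ => by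
        have := (norm_le_pi_norm t j).trans ht'.le
        simpa using this
      simpa using Finset.sum_le_card_nsmul _ _ _ this
    calc M * ∑ j, |(z - t) j - z j| ≤ M * (Fintype.card ι * r) := by gcongr
      _ = ε * (M * Fintype.card ι / (M * Fintype.card ι + 1)) := by rw [hr]; ring
      _ ≤ ε * 1 := by
        gcongr
        rw [div_le_one (by positivity)]
        linarith
      _ = ε := mul_one _
  · have e : H z - H z' = ∫ t, ρ t * (G (z - t) - G (z' - t)) := by
      simp only [mul_sub]
      rw [integral_sub (hint z) (hint z')]
    rw [e]
    exact hbd _ _ fun t _ => (hG _ _).trans_eq (by simp)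
  · have hz : ∀ x, H (z + x) = ∫ r, ρ r * G (z - r + x) := fun x => by
      simp only [hH, add_sub_right_comm]
    have hz0 : H z = ∫ r, ρ r * G (z - r) := rfl
    have hi : ∀ x, Integrable fun r => ρ r * G (z - r + x) := fun x => by
      simpa only [add_sub_right_comm] using hint (z + x)
    have four : ∀ {a b c d : (ι → ℝ) → ℝ}, Integrable a → Integrable b → Integrable c →
        Integrable d → Integrable (fun r => a r - b r - c r + d r) ∧
          ∫ r, (a r - b r - c r + d r) = (∫ r, a r) - (∫ r, b r) - (∫ r, c r) + ∫ r, d r := by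
      intro a b c d ha hb hc hd
      have h1 : Integrable (fun r => a r - b r) := ha.sub hb
      have h2 : Integrable (fun r => a r - b r - c r) := h1.sub hc
      exact ⟨h2.add hd, by rw [integral_add h2 hd, integral_sub h1 hc, integral_sub ha hb]⟩
    -- Third differences commute with translations and with averages, so the convolution inherits
    -- the bound with the same constant.
    have e : delta3 H z (Pi.single k s) (Pi.single l t) g =
        ∫ r, ρ r * delta3 G (z - r) (Pi.single k s) (Pi.single l t) g := by
      simp only [delta3, mul_sub, mul_add]
      obtain ⟨h1, h1'⟩ := four (hi (g + Pi.single k s + Pi.single l t)) (hi (g + Pi.single k s))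
        (hi (g + Pi.single l t)) (hi g)
      obtain ⟨h2, h2'⟩ := four (hi (Pi.single k s + Pi.single l t)) (hi (Pi.single k s))
        (hi (Pi.single l t)) (hint z)
      rw [integral_sub h1 h2, h1', h2', hz0]
      simp only [hz]
    rw [e]
    exact hbd _ _ fun r _ => hG3 _ _ _ _ _ _

end Mollify

/-! ### Gaussian integration by parts -/

lemma hasDerivAt_gaussianPDFReal {v : ℝ≥0} (hv : v ≠ 0) (x : ℝ) :
    HasDerivAt (gaussianPDFReal 0 v) (-(x / v) * gaussianPDFReal 0 v x) x := by
  have hv' : (v : ℝ) ≠ 0 := by exact_mod_cast hv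
  rw [gaussianPDFReal_def]
  have h1 : HasDerivAt (fun x : ℝ => -(x - 0) ^ 2 / (2 * v)) (-(x / v)) x := by
    have h := ((((hasDerivAt_id x).sub_const 0).pow 2).neg).div_const (2 * (v : ℝ))
    refine h.congr_deriv ?_
    simp only [id]
    field_simp
    simp [mul_comm]
  refine (h1.exp.const_mul _).congr_deriv ?_
  ring

/-- Integration by parts against the density, whose derivative is `-(x / v)` times itself. For zero
variance the law is a point mass at `0` and both sides vanish. -/
lemma integral_mul_gaussianReal {v : ℝ≥0} {g g' : ℝ → ℝ} (hg : ∀ x, HasDerivAt g (g' x) x)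
    (hg'm : Continuous g') {A B : ℝ} (hA : ∀ x, |g x| ≤ A) (hB : ∀ x, |g' x| ≤ B) :
    ∫ x, x * g x ∂(gaussianReal 0 v) = v * ∫ x, g' x ∂(gaussianReal 0 v) := by
  rcases eq_or_ne v 0 with rfl | hv
  · simp [gaussianReal_zero_var]
  have hv' : (v : ℝ) ≠ 0 := by exact_mod_cast hv
  have hgc : Continuous g := continuous_iff_continuousAt.2 fun x => (hg x).continuousAt
  have hpdf := integrable_gaussianPDFReal 0 v
  have hxp : Integrable fun x => gaussianPDFReal 0 v x * x := by
    have h : Integrable id (gaussianReal 0 v) :=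
      (memLp_id_gaussianReal (μ := 0) (v := v) 1).integrable le_rfl
    rw [gaussianReal_of_var_ne_zero _ hv, integrable_withDensity_iff_integrable_smul'
      (measurable_gaussianPDF 0 v) (ae_of_all _ fun x => ENNReal.ofReal_lt_top)] at h
    simpa [toReal_gaussianPDF] using h
  rw [integral_gaussianReal_eq_integral_smul hv, integral_gaussianReal_eq_integral_smul hv]
  have h := integral_mul_deriv_eq_deriv_mul_of_integrable (u := g) (u' := g')
    (v := gaussianPDFReal 0 v) (v' := fun x => -(x / v) * gaussianPDFReal 0 v x)
    (fun x _ => hg x) (fun x _ => hasDerivAt_gaussianPDFReal hv x) ?_ ?_ ?_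
  · simp only [smul_eq_mul]
    have e1 : ∀ x, g x * (-(x / v) * gaussianPDFReal 0 v x) =
        -(v : ℝ)⁻¹ * (gaussianPDFReal 0 v x * (x * g x)) := fun x => by
      field_simp
    simp only [e1] at h
    rw [integral_const_mul] at h
    have e2 : ∀ x, g' x * gaussianPDFReal 0 v x = gaussianPDFReal 0 v x * g' x := fun x =>
      mul_comm _ _
    simp only [e2] at h
    have h3 := congrArg (fun a => -(v : ℝ) * a) h
    beta_reduce at h3
    rw [← mul_assoc, neg_mul_neg, mul_inv_cancel₀ hv', one_mul, neg_mul_neg] at h3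
    exact h3
  · refine ((hxp.const_mul (-(v : ℝ)⁻¹)).bdd_mul (c := A) hgc.aestronglyMeasurable
      (ae_of_all _ hA)).congr (ae_of_all _ fun x => ?_)
    simp only [Pi.mul_apply]
    field_simp
  · exact hpdf.bdd_mul hg'm.aestronglyMeasurable (ae_of_all _ hB)
  · exact hpdf.bdd_mul hgc.aestronglyMeasurable (ae_of_all _ hA)

/-- Fubini isolates the coordinate `k` and reduces to dimension one with the other coordinates
frozen. -/
lemma integral_mul_pi_gaussianReal {n : ℕ} (v : Fin n → ℝ≥0) {K : (Fin n → ℝ) → ℝ}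
    (hK : ContDiff ℝ 1 K) {A B : ℝ} (hA : ∀ z, |K z| ≤ A) (k : Fin n) (hB : ∀ z, |pd K k z| ≤ B) :
    ∫ y, y k * K y ∂(Measure.pi fun j => gaussianReal 0 (v j)) =
      v k * ∫ y, pd K k y ∂(Measure.pi fun j => gaussianReal 0 (v j)) := by
  obtain _ | n := n
  · exact k.elim0
  have hmp := measurePreserving_piFinSuccAbove (fun j => gaussianReal 0 (v j)) k
  set μ := Measure.pi fun j => gaussianReal 0 (v j) with hμ
  set μ' := Measure.pi fun j => gaussianReal 0 (v (k.succAbove j)) with hμ'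
  have hd : Differentiable ℝ K := hK.differentiable one_ne_zero
  have hpc : Continuous (pd K k) :=
    (contDiff_pd (m := 1) (k := 0) (by exact_mod_cast hK) le_rfl k).continuous
  have hins : ∀ (t : ℝ) (y : Fin n → ℝ),
      k.insertNth t y = (k.insertNth 0 y : Fin (n + 1) → ℝ) + Pi.single k t := by
    intro t y
    funext j
    refine Fin.succAboveCases k ?_ (fun i => ?_) j
    · simp
    · simp [Fin.succAbove_ne]
  have hcont : Continuous fun q : ℝ × (Fin n → ℝ) => (k.insertNth q.1 q.2 : Fin (n + 1) → ℝ) := by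
    fun_prop
  have hid : Integrable (fun t : ℝ => t) (gaussianReal 0 (v k)) :=
    (memLp_id_gaussianReal (μ := 0) (v := v k) 1).integrable le_rfl
  have e1 : ∫ y, y k * K y ∂μ =
      ∫ q : ℝ × (Fin n → ℝ), q.1 * K (k.insertNth q.1 q.2) ∂((gaussianReal 0 (v k)).prod μ') := by
    rw [← hmp.integral_comp']
    refine integral_congr_ae (ae_of_all _ fun y => ?_)
    have : k.insertNth (y k) (k.removeNth y) = y := Fin.insertNth_self_removeNth k y
    show y k * K y = y k * K (k.insertNth (y k) (k.removeNth y))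
    rw [this]
  have e2 : ∫ y, pd K k y ∂μ =
      ∫ q : ℝ × (Fin n → ℝ), pd K k (k.insertNth q.1 q.2) ∂((gaussianReal 0 (v k)).prod μ') := by
    rw [← hmp.integral_comp']
    refine integral_congr_ae (ae_of_all _ fun y => ?_)
    have : k.insertNth (y k) (k.removeNth y) = y := Fin.insertNth_self_removeNth k y
    show pd K k y = pd K k (k.insertNth (y k) (k.removeNth y))
    rw [this]
  have hi1 : Integrable (fun q : ℝ × (Fin n → ℝ) => q.1 * K (k.insertNth q.1 q.2))
      ((gaussianReal 0 (v k)).prod μ') :=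
    (hid.comp_fst μ').mul_bdd (c := A) (hK.continuous.comp hcont).aestronglyMeasurable
      (ae_of_all _ fun q => hA _)
  have hi2 : Integrable (fun q : ℝ × (Fin n → ℝ) => pd K k (k.insertNth q.1 q.2))
      ((gaussianReal 0 (v k)).prod μ') :=
    Integrable.of_bound (hpc.comp hcont).aestronglyMeasurable B (ae_of_all _ fun q => hB _)
  rw [e1, e2, integral_prod_symm _ hi1, integral_prod_symm _ hi2, ← integral_const_mul]
  refine integral_congr_ae (ae_of_all _ fun y => ?_)
  refine integral_mul_gaussianReal (g := fun t => K (k.insertNth t y)) (fun t => ?_)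
    (hpc.comp (by fun_prop)) (fun t => hA _) (fun t => hB _)
  have e3 : (fun t => K (k.insertNth t y)) =
      fun t => K ((k.insertNth 0 y : Fin (n + 1) → ℝ) + Pi.single k t) :=
    funext fun t => congrArg K (hins t y)
  rw [e3, hins t y]
  exact hasDerivAt_pd_add hd _ k t

/-- Gaussian integration by parts for independent centred Gaussian variables. -/
lemma integral_mul_comp_gaussian {n : ℕ} {Ω' : Type*} [MeasurableSpace Ω'] {Qr : Measure Ω'}
    [IsProbabilityMeasure Qr] {Y : Fin n → Ω' → ℝ} (hY : iIndepFun Y Qr) {v : Fin n → ℝ≥0}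
    (hlaw : ∀ k, HasLaw (Y k) (gaussianReal 0 (v k)) Qr) {K : (Fin n → ℝ) → ℝ}
    (hK : ContDiff ℝ 1 K) {A B : ℝ} (hA : ∀ z, |K z| ≤ A) (k : Fin n) (hB : ∀ z, |pd K k z| ≤ B) :
    ∫ ω, Y k ω * K (fun j => Y j ω) ∂Qr = v k * ∫ ω, pd K k (fun j => Y j ω) ∂Qr := by
  have hm : ∀ j, AEMeasurable (Y j) Qr := fun j => (hlaw j).aemeasurable
  have hmap := (iIndepFun_iff_map_fun_eq_pi_map hm).1 hY
  simp only [fun j => (hlaw j).map_eq] at hmap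
  have hmv : AEMeasurable (fun ω j => Y j ω) Qr := aemeasurable_pi_lambda _ hm
  have hpc : Continuous (pd K k) :=
    (contDiff_pd (m := 1) (k := 0) (by exact_mod_cast hK) le_rfl k).continuous
  have h := integral_mul_pi_gaussianReal v hK hA k hB
  have hc : Continuous fun y : Fin n → ℝ => y k * K y := (continuous_apply k).mul hK.continuous
  rw [← hmap, integral_map hmv hc.aestronglyMeasurable,
    integral_map hmv hpc.aestronglyMeasurable] at h
  exact h

/-! ### The approximate integration by parts for Poisson integrals -/

/-- The Stein identity produces the increment `K(δ + u) - K(δ)`. Subtracting its linear part leaves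
a quadratic Taylor remainder, which `|u k|` multiplies into the cubic integral. -/
lemma IsPoissonProcess.abs_integral_mul_comp_sub_le {Ω E ι : Type*} [MeasurableSpace Ω]
    [MeasurableSpace E] [Fintype ι] [DecidableEq ι] {N : Ω → Measure E} {ν : Measure E}
    {Pr : Measure Ω} [IsProbabilityMeasure Pr] (hN : IsPoissonProcess N ν Pr)
    {u : ι → E → ℝ} {δ : ι → Ω → ℝ} (hδ : ∀ j, IsCompensatedIntegral N ν Pr (u j) (δ j))
    {K : (ι → ℝ) → ℝ} (hK : ContDiff ℝ 1 K) {A B C : ℝ} (hA : ∀ z, |K z| ≤ A) (hB0 : 0 ≤ B)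
    (hB : ∀ j z, |pd K j z| ≤ B)
    (hC : ∀ j z g, |pd K j (z + g) - pd K j z| ≤ C * ∑ i, |g i|) (k : ι)
    (hS : Integrable (fun x => |u k x| * (∑ l, |u l x|) ^ 2) ν) :
    |∫ ω, δ k ω * K (fun j => δ j ω) ∂Pr -
      ∑ l, (∫ x, u k x * u l x ∂ν) * ∫ ω, pd K l (fun j => δ j ω) ∂Pr| ≤
      1 / 2 * C * ∫ x, |u k x| * (∑ l, |u l x|) ^ 2 ∂ν := by
  have hL := abs_sub_le_of_abs_pd_le hK hB
  have hu := fun j => (hδ j).1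
  have hδm : ∀ j, AEStronglyMeasurable (δ j) Pr := fun j => (hδ j).2.1.1
  have hpi : ∀ l, Integrable (fun ω => pd K l fun j => δ j ω) Pr := fun l =>
    integrable_comp_of_bound (contDiff_pd (m := 1) (k := 0) (by exact_mod_cast hK) le_rfl l).continuous
      (hB l) hδm
  have hm1 := integrable_mul_shift hL hδm (hu k) hu
  have hm2 : ∀ l, Integrable (fun x => u k x * u l x * ∫ ω, pd K l (fun j => δ j ω) ∂Pr) ν :=
    fun l => ((hu k).integrable_mul (hu l)).mul_const _
  rw [hN.stein hδ hB0 hL hA k]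
  have e : ∑ l, (∫ x, u k x * u l x ∂ν) * ∫ ω, pd K l (fun j => δ j ω) ∂Pr =
      ∫ x, ∑ l, u k x * u l x * ∫ ω, pd K l (fun j => δ j ω) ∂Pr ∂ν := by
    rw [integral_finsetSum _ fun l _ => hm2 l]
    simp only [integral_mul_const]
  rw [e, ← integral_sub hm1 (integrable_finsetSum _ fun l _ => hm2 l), ← integral_const_mul]
  rw [← Real.norm_eq_abs]
  refine norm_integral_le_of_norm_le (hS.const_mul _) (ae_of_all _ fun x => ?_)
  have h1 := integrable_shift hK.continuous hA hδm fun j => u j x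
  have h2 : ∀ l, Integrable (fun ω => u l x * pd K l fun j => δ j ω) Pr := fun l =>
    (hpi l).const_mul _
  have e2 : u k x * ∫ ω, (K (fun j => δ j ω + u j x) - K fun j => δ j ω) ∂Pr -
      ∑ l, u k x * u l x * ∫ ω, pd K l (fun j => δ j ω) ∂Pr =
      u k x * ∫ ω, ((K (fun j => δ j ω + u j x) - K fun j => δ j ω) -
        ∑ l, u l x * pd K l fun j => δ j ω) ∂Pr := by
    rw [integral_sub h1 (integrable_finsetSum _ fun l _ => h2 l),
      integral_finsetSum _ fun l _ => h2 l, mul_sub, Finset.mul_sum]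
    simp only [integral_const_mul, mul_assoc]
  rw [e2, norm_mul, mul_left_comm]
  refine mul_le_mul_of_nonneg_left ?_ (norm_nonneg (u k x))
  have := norm_integral_le_of_norm_le_const (μ := Pr) (C := 1 / 2 * C * (∑ l, |u l x|) ^ 2)
    (f := fun ω => (K (fun j => δ j ω + u j x) - K fun j => δ j ω) -
        ∑ l, u l x * pd K l fun j => δ j ω) (ae_of_all _ fun ω =>
      abs_taylor_le hK hC (fun j => δ j ω) fun j => u j x)
  simpa using this

/-! ### Interpolation between the Gaussian and the Poisson vectors -/

lemma pd_comp_affine {ι : Type*} [Fintype ι] [DecidableEq ι] {f : (ι → ℝ) → ℝ}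
    (hf : Differentiable ℝ f) (s : ℝ) (b : ι → ℝ) (l : ι) (z : ι → ℝ) :
    pd (fun z => f (s • z + b)) l z = s * pd f l (s • z + b) := by
  have h1 : HasFDerivAt (fun z : ι → ℝ => s • z + b)
      (s • ContinuousLinearMap.id ℝ (ι → ℝ)) z :=
    ((hasFDerivAt_id z).const_smul s).add_const b
  have h2 := (hf (s • z + b)).hasFDerivAt.comp z h1
  have h3 : fderiv ℝ (fun z => f (s • z + b)) z =
      (fderiv ℝ f (s • z + b)).comp (s • ContinuousLinearMap.id ℝ (ι → ℝ)) := h2.fderiv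
  rw [pd, h3, pd]
  simp

lemma integrable_of_hasLaw_gaussianReal {Ω' : Type*} [MeasurableSpace Ω'] {Qr : Measure Ω'}
    {X : Ω' → ℝ} {v : ℝ≥0} (h : HasLaw X (gaussianReal 0 v) Qr) : Integrable X Qr := by
  have hid : Integrable (fun t : ℝ => t) (gaussianReal 0 v) :=
    (memLp_id_gaussianReal (μ := 0) (v := v) 1).integrable le_rfl
  rw [← h.map_eq] at hid
  exact (integrable_map_measure aestronglyMeasurable_id h.aemeasurable).1 hid

section Path

variable {Ω Ω' : Type*} [MeasurableSpace Ω] [MeasurableSpace Ω'] {Pr : Measure Ω} {Qr : Measure Ω'}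
  [IsProbabilityMeasure Pr] [IsProbabilityMeasure Qr] {n : ℕ}

/-- The interpolation `s Z + c Y` on the product space. -/
def interp (Z : Fin n → Ω → ℝ) (Y : Fin n → Ω' → ℝ) (s c : ℝ) (q : Ω × Ω') : Fin n → ℝ :=
  s • (fun j => Z j q.1) + c • fun j => Y j q.2

omit [IsProbabilityMeasure Pr] [IsProbabilityMeasure Qr] in
lemma aemeasurable_interp {Z : Fin n → Ω → ℝ} {Y : Fin n → Ω' → ℝ}
    (hZ : ∀ j, AEMeasurable (Z j) Pr) (hY : ∀ j, AEMeasurable (Y j) Qr) (s c : ℝ) :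
    AEMeasurable (interp Z Y s c) (Pr.prod Qr) := by
  have h1 : AEMeasurable (fun q : Ω × Ω' => fun j => Z j q.1) (Pr.prod Qr) :=
    aemeasurable_pi_lambda _ fun j =>
      (hZ j).comp_quasiMeasurePreserving Measure.quasiMeasurePreserving_fst
  have h2 : AEMeasurable (fun q : Ω × Ω' => fun j => Y j q.2) (Pr.prod Qr) :=
    aemeasurable_pi_lambda _ fun j =>
      (hY j).comp_quasiMeasurePreserving Measure.quasiMeasurePreserving_snd
  exact (h1.const_smul s).add (h2.const_smul c)

lemma integrable_comp_interp {Z : Fin n → Ω → ℝ} {Y : Fin n → Ω' → ℝ}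
    (hZ : ∀ j, AEMeasurable (Z j) Pr) (hY : ∀ j, AEMeasurable (Y j) Qr) (s c : ℝ)
    {f : (Fin n → ℝ) → ℝ} (hf : Continuous f) {A : ℝ} (hA : ∀ z, |f z| ≤ A) :
    Integrable (fun q => f (interp Z Y s c q)) (Pr.prod Qr) :=
  Integrable.of_bound (hf.measurable.comp_aemeasurable
    (aemeasurable_interp hZ hY s c)).aestronglyMeasurable A (ae_of_all _ fun _ => hA _)

/-- With `Y` frozen, `z ↦ f (s • z + b)` has partial derivatives scaled by `s` and their Lipschitz
constants by `s ^ 2`. Orthogonality leaves only the term `l = k` of the first order sum. -/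
lemma abs_integral_interp_poisson_le {E : Type*} [MeasurableSpace E] {N : Ω → Measure E}
    {ν : Measure E} (hN : IsPoissonProcess N ν Pr) {u : Fin n → E → ℝ} {δ : Fin n → Ω → ℝ}
    (hδ : ∀ j, IsCompensatedIntegral N ν Pr (u j) (δ j))
    (horth : ∀ j k, j ≠ k → ∫ x, u j x * u k x ∂ν = 0)
    {Y : Fin n → Ω' → ℝ} (hY : ∀ j, AEMeasurable (Y j) Qr)
    {f : (Fin n → ℝ) → ℝ} (hf : ContDiff ℝ 1 f) {A B C : ℝ} (hA : ∀ z, |f z| ≤ A) (hB0 : 0 ≤ B)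
    (hB : ∀ j z, |pd f j z| ≤ B)
    (hC : ∀ j z g, |pd f j (z + g) - pd f j z| ≤ C * ∑ i, |g i|) (k : Fin n)
    (hS : Integrable (fun x => |u k x| * (∑ l, |u l x|) ^ 2) ν) {s : ℝ} (hs : 0 ≤ s) (c : ℝ) :
    |∫ q, δ k q.1 * f (interp δ Y s c q) ∂(Pr.prod Qr) -
      s * (∫ x, u k x ^ 2 ∂ν) * ∫ q, pd f k (interp δ Y s c q) ∂(Pr.prod Qr)| ≤
      1 / 2 * (s ^ 2 * C) * ∫ x, |u k x| * (∑ l, |u l x|) ^ 2 ∂ν := by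
  have hδ2 := fun j => (hδ j).2.1
  have hδm := fun j => (hδ2 j).1.aemeasurable
  have hd : Differentiable ℝ f := hf.differentiable one_ne_zero
  have hpc : Continuous (pd f k) :=
    (contDiff_pd (m := 1) (k := 0) (by exact_mod_cast hf) le_rfl k).continuous
  have hi1 : Integrable (fun q => δ k q.1 * f (interp δ Y s c q)) (Pr.prod Qr) :=
    (((hδ2 k).integrable one_le_two).comp_fst Qr).mul_bdd (c := A)
      (integrable_comp_interp hδm hY s c hf.continuous hA).1 (ae_of_all _ fun q => hA _)
  have hi2 := integrable_comp_interp hδm hY s c hpc (hB k)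
  rw [integral_prod_symm _ hi1, integral_prod_symm _ hi2, ← integral_const_mul,
    ← integral_sub hi1.integral_prod_right (hi2.integral_prod_right.const_mul _)]
  have key : ∀ ω', ‖∫ ω, δ k ω * f (interp δ Y s c (ω, ω')) ∂Pr -
      s * (∫ x, u k x ^ 2 ∂ν) * ∫ ω, pd f k (interp δ Y s c (ω, ω')) ∂Pr‖ ≤
      1 / 2 * (s ^ 2 * C) * ∫ x, |u k x| * (∑ l, |u l x|) ^ 2 ∂ν := by
    intro ω'
    set b : Fin n → ℝ := c • fun j => Y j ω' with hb
    have hpd := pd_comp_affine hd s b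
    have hK : ContDiff ℝ 1 fun z => f (s • z + b) := hf.comp (by fun_prop)
    have h := hN.abs_integral_mul_comp_sub_le hδ hK (B := s * B) (C := s ^ 2 * C) (fun z => hA _)
      (by positivity) (fun j z => by
        rw [hpd, abs_mul, abs_of_nonneg hs]
        exact mul_le_mul_of_nonneg_left (hB _ _) hs) (fun j z g => by
        rw [hpd, hpd, ← mul_sub, abs_mul, abs_of_nonneg hs]
        have h1 := hC j (s • z + b) (s • g)
        have e : s • (z + g) + b = s • z + b + s • g := by rw [smul_add]; abel
        rw [e]
        refine (mul_le_mul_of_nonneg_left h1 hs).trans_eq ?_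
        simp only [Pi.smul_apply, smul_eq_mul, abs_mul, abs_of_nonneg hs, ← Finset.mul_sum]
        ring) k hS
    rw [Finset.sum_eq_single k (fun l _ hl => by rw [horth k l hl.symm, zero_mul]) (by simp)] at h
    simp only [hpd, ← pow_two] at h
    rw [integral_const_mul, ← mul_assoc, mul_comm (∫ x, u k x ^ 2 ∂ν)] at h
    exact h
  have := norm_integral_le_of_norm_le_const (μ := Qr) (ae_of_all _ key)
  simpa using this

lemma integral_interp_gaussian {Z : Fin n → Ω → ℝ} (hZ : ∀ j, AEMeasurable (Z j) Pr)
    {Y : Fin n → Ω' → ℝ} (hY : iIndepFun Y Qr) {v : Fin n → ℝ≥0}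
    (hlaw : ∀ k, HasLaw (Y k) (gaussianReal 0 (v k)) Qr) {f : (Fin n → ℝ) → ℝ}
    (hf : ContDiff ℝ 1 f) {A B : ℝ} (hA : ∀ z, |f z| ≤ A) (k : Fin n) (hB : ∀ z, |pd f k z| ≤ B)
    (s c : ℝ) :
    ∫ q, Y k q.2 * f (interp Z Y s c q) ∂(Pr.prod Qr) =
      c * v k * ∫ q, pd f k (interp Z Y s c q) ∂(Pr.prod Qr) := by
  have hYm := fun j => (hlaw j).aemeasurable
  have hd : Differentiable ℝ f := hf.differentiable one_ne_zero
  have hpc : Continuous (pd f k) :=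
    (contDiff_pd (m := 1) (k := 0) (by exact_mod_cast hf) le_rfl k).continuous
  have hi1 : Integrable (fun q => Y k q.2 * f (interp Z Y s c q)) (Pr.prod Qr) :=
    ((integrable_of_hasLaw_gaussianReal (hlaw k)).comp_snd Pr).mul_bdd (c := A)
      (integrable_comp_interp hZ hYm s c hf.continuous hA).1 (ae_of_all _ fun q => hA _)
  have hi2 := integrable_comp_interp hZ hYm s c hpc hB
  rw [integral_prod _ hi1, integral_prod _ hi2, ← integral_const_mul]
  refine integral_congr_ae (ae_of_all _ fun ω => ?_)
  beta_reduce
  have hpd := pd_comp_affine hd c (s • fun j => Z j ω) k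
  have hK : ContDiff ℝ 1 fun z => f (c • z + s • fun j => Z j ω) := hf.comp (by fun_prop)
  have h := integral_mul_comp_gaussian hY hlaw hK (fun z => hA _) k (B := |c| * B) (fun z => by
    rw [hpd, abs_mul]
    exact mul_le_mul_of_nonneg_left (hB _) (abs_nonneg _))
  simp only [hpd] at h
  rw [integral_const_mul, ← mul_assoc, mul_comm (v k : ℝ)] at h
  simp only [interp, add_comm (s • _)]
  exact h

/-- Since the sine and the cosine are bounded by `1`, the derivative in `α` is dominated by `M ∑
(|Z_k| + |Y_k|)`, which is integrable and free of `α`. -/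
lemma hasDerivAt_integral_interp {Z : Fin n → Ω → ℝ} {Y : Fin n → Ω' → ℝ}
    (hZ : ∀ j, Integrable (Z j) Pr) (hY : ∀ j, Integrable (Y j) Qr) {H : (Fin n → ℝ) → ℝ}
    (hH : ContDiff ℝ 1 H) {M : ℝ} (hM0 : 0 ≤ M) (hM : ∀ z z', |H z - H z'| ≤ M * ∑ j, |z j - z' j|)
    (α : ℝ) :
    HasDerivAt (fun α => ∫ q, H (interp Z Y (Real.sin α) (Real.cos α) q) ∂(Pr.prod Qr))
      (∑ k, (Real.cos α * ∫ q, Z k q.1 * pd H k (interp Z Y (Real.sin α) (Real.cos α) q)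
          ∂(Pr.prod Qr) -
        Real.sin α * ∫ q, Y k q.2 * pd H k (interp Z Y (Real.sin α) (Real.cos α) q)
          ∂(Pr.prod Qr))) α := by
  have hd : Differentiable ℝ H := hH.differentiable one_ne_zero
  have hpM := abs_pd_le hd hM0 hM
  have hpc : ∀ k, Continuous (pd H k) := fun k =>
    (contDiff_pd (m := 1) (k := 0) (by exact_mod_cast hH) le_rfl k).continuous
  have hZm := fun j => (hZ j).aemeasurable
  have hYm := fun j => (hY j).aemeasurable
  have hZi : ∀ k s c, Integrable (fun q => Z k q.1 * pd H k (interp Z Y s c q)) (Pr.prod Qr) :=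
    fun k s c => ((hZ k).comp_fst Qr).mul_bdd (c := M)
      (integrable_comp_interp hZm hYm s c (hpc k) (hpM k)).1 (ae_of_all _ fun q => hpM _ _)
  have hYi : ∀ k s c, Integrable (fun q => Y k q.2 * pd H k (interp Z Y s c q)) (Pr.prod Qr) :=
    fun k s c => ((hY k).comp_snd Pr).mul_bdd (c := M)
      (integrable_comp_interp hZm hYm s c (hpc k) (hpM k)).1 (ae_of_all _ fun q => hpM _ _)
  set F' : ℝ → Ω × Ω' → ℝ := fun α q => ∑ k,
    (Real.cos α * (Z k q.1 * pd H k (interp Z Y (Real.sin α) (Real.cos α) q)) -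
      Real.sin α * (Y k q.2 * pd H k (interp Z Y (Real.sin α) (Real.cos α) q))) with hF'
  have hFi : ∀ k, Integrable (fun q =>
      Real.cos α * (Z k q.1 * pd H k (interp Z Y (Real.sin α) (Real.cos α) q)) -
      Real.sin α * (Y k q.2 * pd H k (interp Z Y (Real.sin α) (Real.cos α) q))) (Pr.prod Qr) :=
    fun k => ((hZi k _ _).const_mul _).sub ((hYi k _ _).const_mul _)
  have hbound : Integrable (fun q : Ω × Ω' => ∑ k, (|Z k q.1| + |Y k q.2|)) (Pr.prod Qr) :=
    integrable_finsetSum _ fun k _ => ((hZ k).comp_fst Qr).abs.add ((hY k).comp_snd Pr).abs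
  have hHm : ∀ α, AEStronglyMeasurable
      (fun q => H (interp Z Y (Real.sin α) (Real.cos α) q)) (Pr.prod Qr) := fun α =>
    (hH.continuous.measurable.comp_aemeasurable
      (aemeasurable_interp hZm hYm _ _)).aestronglyMeasurable
  have hHi : Integrable (fun q => H (interp Z Y (Real.sin α) (Real.cos α) q)) (Pr.prod Qr) := by
    refine Integrable.mono' ((integrable_const |H 0|).add (hbound.const_mul M)) (hHm α)
      (ae_of_all _ fun q => ?_)
    have h1 := hM (interp Z Y (Real.sin α) (Real.cos α) q) 0
    have h2 : ∑ j, |interp Z Y (Real.sin α) (Real.cos α) q j - (0 : Fin n → ℝ) j| ≤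
        ∑ k, (|Z k q.1| + |Y k q.2|) := by
      refine Finset.sum_le_sum fun j _ => ?_
      simp only [interp, Pi.add_apply, Pi.smul_apply, smul_eq_mul, Pi.zero_apply, sub_zero]
      refine (abs_add_le _ _).trans (add_le_add ?_ ?_)
      · rw [abs_mul]
        exact mul_le_of_le_one_left (abs_nonneg _) (Real.abs_sin_le_one _)
      · rw [abs_mul]
        exact mul_le_of_le_one_left (abs_nonneg _) (Real.abs_cos_le_one _)
    have h3 := mul_le_mul_of_nonneg_left h2 hM0
    have h4 := abs_sub_abs_le_abs_sub (H (interp Z Y (Real.sin α) (Real.cos α) q)) (H 0)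
    simp only [Pi.add_apply, Real.norm_eq_abs]
    linarith
  have h := (hasDerivAt_integral_of_dominated_loc_of_deriv_le (μ := Pr.prod Qr) (x₀ := α)
    (F := fun α q => H (interp Z Y (Real.sin α) (Real.cos α) q)) (F' := F') (s := Set.univ)
    (bound := fun q => M * ∑ k, (|Z k q.1| + |Y k q.2|)) univ_mem
    (Eventually.of_forall hHm) hHi
    (integrable_finsetSum _ fun k _ => hFi k).1
    (ae_of_all _ fun q α _ => ?_) (hbound.const_mul M) (ae_of_all _ fun q α _ => ?_)).2
  · refine h.congr_deriv ?_
    rw [hF', integral_finsetSum _ fun k _ => hFi k]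
    refine Finset.sum_congr rfl fun k _ => ?_
    rw [integral_sub ((hZi k _ _).const_mul _) ((hYi k _ _).const_mul _), integral_const_mul,
      integral_const_mul]
  · rw [hF', Finset.mul_sum]
    refine (norm_sum_le _ _).trans (Finset.sum_le_sum fun k _ => ?_)
    rw [Real.norm_eq_abs, mul_add]
    refine (abs_sub _ _).trans (add_le_add ?_ ?_)
    · rw [abs_mul, abs_mul, mul_comm M]
      refine (mul_le_of_le_one_left (by positivity) (Real.abs_cos_le_one _)).trans ?_
      exact mul_le_mul_of_nonneg_left (hpM _ _) (abs_nonneg _)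
    · rw [abs_mul, abs_mul, mul_comm M]
      refine (mul_le_of_le_one_left (by positivity) (Real.abs_sin_le_one _)).trans ?_
      exact mul_le_mul_of_nonneg_left (hpM _ _) (abs_nonneg _)
  · have h1 : HasDerivAt (fun α => interp Z Y (Real.sin α) (Real.cos α) q)
        (Real.cos α • (fun j => Z j q.1) + (-Real.sin α) • fun j => Y j q.2) α :=
      ((Real.hasDerivAt_sin α).smul_const _).add ((Real.hasDerivAt_cos α).smul_const _)
    have h2 := (hd _).hasFDerivAt.comp_hasDerivAt α h1
    refine h2.congr_deriv ?_
    rw [fderiv_eq_sum_pd]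
    refine Finset.sum_congr rfl fun k _ => ?_
    simp only [Pi.add_apply, Pi.smul_apply, smul_eq_mul]
    ring

/-- Comparison of the Gaussian and Poisson vectors for smooth test functions. -/
lemma abs_integral_poisson_sub_gaussian_le {E : Type*} [MeasurableSpace E] {N : Ω → Measure E}
    {ν : Measure E} (hN : IsPoissonProcess N ν Pr) {u : Fin n → E → ℝ} {δ : Fin n → Ω → ℝ}
    (hδ : ∀ j, IsCompensatedIntegral N ν Pr (u j) (δ j))
    (horth : ∀ j k, j ≠ k → ∫ x, u j x * u k x ∂ν = 0)
    {Y : Fin n → Ω' → ℝ} (hY : iIndepFun Y Qr) {v : Fin n → ℝ≥0}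
    (hlaw : ∀ k, HasLaw (Y k) (gaussianReal 0 (v k)) Qr) (hv : ∀ k, v k = ∫ x, u k x ^ 2 ∂ν)
    {H : (Fin n → ℝ) → ℝ} (hH : ContDiff ℝ 2 H) {M C : ℝ} (hM0 : 0 ≤ M) (hC0 : 0 ≤ C)
    (hM : ∀ z z', |H z - H z'| ≤ M * ∑ j, |z j - z' j|)
    (hC : ∀ (k l : Fin n) (z g : Fin n → ℝ),
      |pd (pd H k) l (z + g) - pd (pd H k) l z| ≤ C * ∑ j, |g j|)
    (hS : ∀ k, Integrable (fun x => |u k x| * (∑ l, |u l x|) ^ 2) ν) :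
    |∫ ω, H (fun j => δ j ω) ∂Pr - ∫ ω, H (fun j => Y j ω) ∂Qr| ≤
      1 / 6 * C * ∑ k, ∫ x, |u k x| * (∑ l, |u l x|) ^ 2 ∂ν := by
  have hδi := fun j => (hδ j).2.1.integrable one_le_two
  have hYi := fun j => integrable_of_hasLaw_gaussianReal (hlaw j)
  have hH1 : ContDiff ℝ 1 H := hH.of_le one_le_two
  have hpM := abs_pd_le (hH1.differentiable one_ne_zero) hM0 hM
  have hp1 : ∀ k, ContDiff ℝ 1 (pd H k) := fun k =>
    contDiff_pd (m := 2) (k := 1) (by exact_mod_cast hH) le_rfl k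
  have hB : ∀ k l z, |pd (pd H k) l z| ≤ 2 * M + C := fun k l z =>
    abs_pd_le_of_bound (hp1 k) (hpM k) (hC k l) z
  set R : ℝ := ∑ k, ∫ x, |u k x| * (∑ l, |u l x|) ^ 2 ∂ν with hR
  set Q : ℝ → ℝ := fun α => ∫ q, H (interp δ Y (Real.sin α) (Real.cos α) q) ∂(Pr.prod Qr) with hQ
  have hderiv := hasDerivAt_integral_interp hδi hYi hH1 hM0 hM
  -- Comparison with the barrier `1/6 C R sin³ α`, whose derivative is the pointwise bound. This
  -- integrates the estimate without requiring integrability of the derivative of `Q`.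
  have hbd := image_norm_le_of_norm_deriv_right_le_deriv_boundary (f := fun α => Q α - Q 0)
    (a := 0) (b := Real.pi / 2) (B := fun α => 1 / 6 * C * R * Real.sin α ^ 3)
    (B' := fun α => 1 / 2 * C * R * (Real.sin α ^ 2 * Real.cos α))
    (fun α _ => ((hderiv α).continuousAt.sub continuousAt_const).continuousWithinAt)
    (fun α _ => ((hderiv α).sub_const (Q 0)).hasDerivWithinAt) (by simp)
    (fun α => (((Real.hasDerivAt_sin α).pow 3).const_mul _).congr_deriv (by simp; ring))
    (fun α hα => ?_) (Set.right_mem_Icc.2 (by positivity))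
  · have e1 : Q (Real.pi / 2) = ∫ ω, H (fun j => δ j ω) ∂Pr := by
      simp only [hQ, Real.sin_pi_div_two, Real.cos_pi_div_two, interp, one_smul, zero_smul,
        add_zero]
      rw [integral_fun_fst (μ := Pr) (ν := Qr) fun ω => H fun j => δ j ω]
      simp
    have e0 : Q 0 = ∫ ω, H (fun j => Y j ω) ∂Qr := by
      simp only [hQ, Real.sin_zero, Real.cos_zero, interp, one_smul, zero_smul, zero_add]
      rw [integral_fun_snd (μ := Pr) (ν := Qr) fun ω => H fun j => Y j ω]
      simp
    simpa [e1, e0] using hbd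
  · have hs : 0 ≤ Real.sin α := Real.sin_nonneg_of_nonneg_of_le_pi hα.1
      (by linarith [hα.2, Real.pi_pos])
    have hc : 0 ≤ Real.cos α := Real.cos_nonneg_of_neg_pi_div_two_le_of_le
      (by linarith [hα.1, Real.pi_pos]) hα.2.le
    have e : 1 / 2 * C * R * (Real.sin α ^ 2 * Real.cos α) =
        ∑ k, Real.cos α * (1 / 2 * (Real.sin α ^ 2 * C) *
          ∫ x, |u k x| * (∑ l, |u l x|) ^ 2 ∂ν) := by
      rw [← Finset.mul_sum, ← Finset.mul_sum, ← hR]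
      ring
    rw [e]
    refine (norm_sum_le _ _).trans (Finset.sum_le_sum fun k _ => ?_)
    -- The Gaussian term is `sin α cos α ξ_k²` times the expectation of the second derivative in the
    -- coordinate `k`. It equals the main term on the Poisson side, so only the Taylor remainder
    -- survives.
    rw [integral_interp_gaussian (fun j => (hδi j).aemeasurable) hY hlaw (hp1 k) (hpM k) k
      (hB k k), hv k]
    have h := abs_integral_interp_poisson_le hN hδ horth (fun j => (hYi j).aemeasurable) (hp1 k)
      (hpM k) (by positivity) (hB k) (hC k) k (hS k) hs (Real.cos α)
    rw [Real.norm_eq_abs]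
    refine le_trans (le_of_eq ?_) (mul_le_mul_of_nonneg_left h hc)
    rw [← abs_of_nonneg hc, ← abs_mul, abs_of_nonneg hc]
    congr 1
    ring

end Path

/-! ### Bounds for `y ↦ F (comb y)` and the main theorem -/

variable {T η p : ℝ} {n : ℕ}

lemma sobNorm_comb_le (hT : 0 < T) (hp : 1 ≤ p) (hηp : 1 / p < η) (hη : η < 1 / 2) (hn : 0 < n)
    (y : Fin n → ℝ) :
    sobNorm η p (comb T y) ≤
      ENNReal.ofReal (3 * max 1 T * (n : ℝ) ^ (-(1 / 2 : ℝ) + η) * ∑ j, |y j|) := by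
  refine (sobNorm_sum_le hp _ _).trans ?_
  rw [Finset.mul_sum, ENNReal.ofReal_sum_of_nonneg fun j _ => by positivity]
  refine Finset.sum_le_sum fun j _ => ?_
  rw [sobNorm_smul hp, mul_comm (3 * max 1 T * _), ENNReal.ofReal_mul (abs_nonneg _)]
  gcongr
  exact sobNorm_hFun_le hT hp hηp hη hn j

/-- The supremum `√(T/n)` times the `L²` norm `√T` of the constant `1`. -/
lemma eLpNorm_comb_single_le (hT : 0 < T) (hn : 0 < n) (k : Fin n) (s : ℝ) :
    eLpNorm (comb T (Pi.single k s)) 2 volume ≤ ENNReal.ofReal (|s| * (T / √n)) := by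
  have hn' : (0 : ℝ) < n := by exact_mod_cast hn
  have h := eLpNorm_le_of_ae_bound (p := 2) (μ := (volume : Measure (TimeI T)))
    (f := comb T (Pi.single k s)) (C := |s| * √(T / n)) (ae_of_all _ fun t => by
      rw [comb_single, ContinuousMap.smul_apply, norm_smul]
      exact mul_le_mul_of_nonneg_left (abs_hFun_le hT hn k t) (norm_nonneg _))
  refine h.trans (le_of_eq ?_)
  rw [volume_timeI_univ, ENNReal.ofReal_rpow_of_pos hT, ← ENNReal.ofReal_mul (by positivity)]
  congr 1
  rw [Real.sqrt_div hT.le, show ((2 : ℝ≥0∞).toReal)⁻¹ = (1 / 2 : ℝ) by norm_num,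
    ← Real.sqrt_eq_rpow]
  field_simp
  rw [Real.sq_sqrt hT.le, mul_comm]

lemma abs_comb_sub_le {P : Measure (Path T)} (hT : 0 < T) (hp : 1 ≤ p) (hηp : 1 / p < η)
    (hη : η < 1 / 2) (hn : 0 < n) {F : Path T → ℝ} (hF : F ∈ SigmaClass T η p P)
    (y z : Fin n → ℝ) :
    |F (comb T y) - F (comb T z)| ≤
      3 * max 1 T * (n : ℝ) ^ (-(1 / 2 : ℝ) + η) * ∑ j, |y j - z j| := by
  have h := hF.1 _ (comb_mem_sobSpace hT hp hηp hη hn y) _ (comb_mem_sobSpace hT hp hηp hη hn z)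
  rw [← comb_sub] at h
  exact (ENNReal.ofReal_le_ofReal_iff (by positivity)).1
    (h.trans (sobNorm_comb_le hT hp hηp hη hn (y - z)))

/-- One Sobolev norm in the direction `g`, and two `L²` norms whose product supplies `T² / n`: this
is the constant `C` of the comparison. -/
lemma abs_delta3_comb_single_le {P : Measure (Path T)} (hP : IsWienerMeasure P) (hT : 0 < T)
    (hp : 1 ≤ p) (hηp : 1 / p < η) (hη : η < 1 / 2) (hn : 0 < n) {F : Path T → ℝ}
    (hF : F ∈ SigmaClass T η p P) (y g : Fin n → ℝ) (k l : Fin n) (s t : ℝ) :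
    |delta3 (fun z => F (comb T z)) y (Pi.single k s) (Pi.single l t) g| ≤
      3 * max 1 T * (n : ℝ) ^ (-(1 / 2 : ℝ) + η) * (T ^ 2 / n) * |s| * |t| * ∑ j, |g j| := by
  have hn' : (0 : ℝ) < n := by exact_mod_cast hn
  have h := ofReal_abs_delta3_comb_le hP hT hp hηp hη hn hF y (Pi.single k s) (Pi.single l t) g
  refine (ENNReal.ofReal_le_ofReal_iff (by positivity)).1 (h.trans ?_)
  refine (mul_le_mul' (mul_le_mul' (sobNorm_comb_le hT hp hηp hη hn g)
    (eLpNorm_comb_single_le hT hn k s)) (eLpNorm_comb_single_le hT hn l t)).trans (le_of_eq ?_)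
  rw [← ENNReal.ofReal_mul (by positivity), ← ENNReal.ofReal_mul (by positivity)]
  congr 1
  have e : T ^ 2 / n = (T / √n) * (T / √n) := by
    rw [div_mul_div_comm, Real.mul_self_sqrt hn'.le, pow_two]
  rw [e]
  ring

lemma integrable_comp_of_l1_lipschitz {X ι : Type*} [MeasurableSpace X] [Fintype ι] {μ : Measure X}
    [IsFiniteMeasure μ] {G : (ι → ℝ) → ℝ} {M : ℝ} (hG : ∀ z z', |G z - G z'| ≤ M * ∑ j, |z j - z' j|)
    {Z : ι → X → ℝ} (hZ : ∀ j, Integrable (Z j) μ) : Integrable (fun x => G fun j => Z j x) μ := by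
  refine Integrable.mono' (g := fun x => |G 0| + M * ∑ j, |Z j x|) ((integrable_const _).add
    ((integrable_finsetSum _ fun j _ => (hZ j).abs).const_mul M))
    ((continuous_of_l1_lipschitz hG).measurable.comp_aemeasurable (aemeasurable_pi_lambda _ fun j =>
      (hZ j).aemeasurable)).aestronglyMeasurable (ae_of_all _ fun x => ?_)
  have h1 := hG (fun j => Z j x) 0
  have h2 := abs_sub_abs_le_abs_sub (G fun j => Z j x) (G 0)
  simp only [Pi.zero_apply, sub_zero] at h1
  rw [Real.norm_eq_abs]
  linarith

/-- Summing over `k` and `l` pointwise produces the square that the Taylor remainder yields. The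
identity stays in `[0, ∞]`, so it also covers divergent integrals. -/
lemma sum_sum_sum_lintegral {E : Type*} [MeasurableSpace E] {ν : Measure E} {u : Fin n → E → ℝ}
    (hu : ∀ k, AEMeasurable (u k) ν) :
    ∑ j, ∑ k, ∑ l, ∫⁻ x, ENNReal.ofReal (|u j x * u k x| * |u l x|) ∂ν =
      ∑ j, ∫⁻ x, ENNReal.ofReal (|u j x| * (∑ l, |u l x|) ^ 2) ∂ν := by
  have hm : ∀ j k l, AEMeasurable (fun x => ENNReal.ofReal (|u j x * u k x| * |u l x|)) ν :=
    fun j k l => by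
      have h1 := hu j
      have h2 := hu k
      have h3 := hu l
      fun_prop
  refine Finset.sum_congr rfl fun j _ => ?_
  have e : ∀ k, ∑ l, ∫⁻ x, ENNReal.ofReal (|u j x * u k x| * |u l x|) ∂ν =
      ∫⁻ x, ∑ l, ENNReal.ofReal (|u j x * u k x| * |u l x|) ∂ν := fun k =>
    (lintegral_finsetSum' _ fun l _ => hm j k l).symm
  simp only [e]
  rw [← lintegral_finsetSum' _ fun k _ => Finset.aemeasurable_fun_sum _ fun l _ => hm j k l]
  refine lintegral_congr fun x => ?_
  simp only [← ENNReal.ofReal_sum_of_nonneg fun (i : Fin n) (_ : i ∈ Finset.univ) =>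
    mul_nonneg (abs_nonneg (u j x * u _ x)) (abs_nonneg (u i x))]
  rw [← ENNReal.ofReal_sum_of_nonneg fun k _ => Finset.sum_nonneg fun l _ => by positivity]
  congr 1
  simp only [abs_mul, ← Finset.mul_sum]
  rw [← Finset.sum_mul, ← Finset.mul_sum]
  ring

lemma abs_integral_sub_le_of_close {X ι : Type*} [MeasurableSpace X] [Fintype ι] {μ : Measure X}
    [IsProbabilityMeasure μ] {Z : ι → X → ℝ} (hZ : ∀ j, Integrable (Z j) μ) {G H : (ι → ℝ) → ℝ}
    {M ε : ℝ} (hG : ∀ z z', |G z - G z'| ≤ M * ∑ j, |z j - z' j|)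
    (hH : ∀ z z', |H z - H z'| ≤ M * ∑ j, |z j - z' j|) (h : ∀ z, |H z - G z| ≤ ε) :
    |∫ x, H (fun j => Z j x) ∂μ - ∫ x, G (fun j => Z j x) ∂μ| ≤ ε := by
  rw [← integral_sub (integrable_comp_of_l1_lipschitz hH hZ) (integrable_comp_of_l1_lipschitz hG hZ)]
  have := norm_integral_le_of_norm_le_const (μ := μ) (C := ε)
    (f := fun x => H (fun j => Z j x) - G fun j => Z j x) (ae_of_all _ fun x => h _)
  simpa using this

/-- Comparison of the Gaussian and Poisson vectors for test functions with Lipschitz second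
differences. -/
lemma abs_integral_gaussian_sub_poisson_le {Ω Ω' E : Type*} [MeasurableSpace Ω]
    [MeasurableSpace Ω'] [MeasurableSpace E] {Pr : Measure Ω} {Qr : Measure Ω'}
    [IsProbabilityMeasure Pr] [IsProbabilityMeasure Qr] {N : Ω → Measure E}
    {ν : Measure E} (hN : IsPoissonProcess N ν Pr) {u : Fin n → E → ℝ} {δ : Fin n → Ω → ℝ}
    (hδ : ∀ j, IsCompensatedIntegral N ν Pr (u j) (δ j))
    (horth : ∀ j k, j ≠ k → ∫ x, u j x * u k x ∂ν = 0)
    {Y : Fin n → Ω' → ℝ} (hY : iIndepFun Y Qr) {v : Fin n → ℝ≥0}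
    (hlaw : ∀ k, HasLaw (Y k) (gaussianReal 0 (v k)) Qr) (hv : ∀ k, v k = ∫ x, u k x ^ 2 ∂ν)
    {G : (Fin n → ℝ) → ℝ} {M C : ℝ} (hM0 : 0 ≤ M) (hC0 : 0 ≤ C)
    (hG : ∀ z z', |G z - G z'| ≤ M * ∑ j, |z j - z' j|)
    (hG3 : ∀ (z g : Fin n → ℝ) (k l : Fin n) (s t : ℝ),
      |delta3 G z (Pi.single k s) (Pi.single l t) g| ≤ C * |s| * |t| * ∑ j, |g j|)
    (hS : ∀ k, Integrable (fun x => |u k x| * (∑ l, |u l x|) ^ 2) ν) :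
    |∫ ω, G (fun j => Y j ω) ∂Qr - ∫ ω, G (fun j => δ j ω) ∂Pr| ≤
      1 / 6 * C * ∑ k, ∫ x, |u k x| * (∑ l, |u l x|) ^ 2 ∂ν := by
  have hδi := fun j => (hδ j).2.1.integrable one_le_two
  have hYi := fun j => integrable_of_hasLaw_gaussianReal (hlaw j)
  refine le_of_forall_pos_le_add fun ε hε => ?_
  -- A uniform error `ε / 2` is paid once for each of the two expectations.
  obtain ⟨H, hH2, hHG, hHM, hH3⟩ := exists_smooth_approx hM0 hG hG3 (half_pos hε)
  have h := abs_integral_poisson_sub_gaussian_le hN hδ horth hY hlaw hv hH2 hM0 hC0 hHM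
    (fun k l z g => abs_pd_pd_sub_le hH2 hC0 hH3 k l z g) hS
  have h1 := abs_integral_sub_le_of_close (fun j => (hYi j)) hG hHM hHG
  have h2 := abs_integral_sub_le_of_close (fun j => (hδi j)) hG hHM hHG
  rw [abs_le] at *
  constructor <;> linarith [h.1, h.2, h1.1, h1.2, h2.1, h2.2]

end DiffusiveStein

end

theorem mainTheorem3
    (T η p : ℝ) (hT : 0 < T) (hp : 1 ≤ p) (hηp : 1 / p < η) (hη : η < 1 / 2)
    (P : Measure (DiffusiveStein.Path T)) (hP : DiffusiveStein.IsWienerMeasure P)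
    {E : Type*} [MetricSpace E] [CompleteSpace E] [TopologicalSpace.SeparableSpace E]
    [MeasurableSpace E] [BorelSpace E] (ν : Measure E) [SigmaFinite ν]
    {Ω : Type*} [MeasurableSpace Ω] (Pr : Measure Ω) [IsProbabilityMeasure Pr]
    (N : Ω → Measure E) (hN : DiffusiveStein.IsPoissonProcess N ν Pr)
    (n : ℕ) (hn : 0 < n)
    (u : Fin n → E → ℝ) (hu : ∀ k, MemLp (u k) 2 ν)
    (horth : ∀ j k, j ≠ k → ∫ x, u j x * u k x ∂ν = 0)
    (ξ : Fin n → ℝ) (hξ : ∀ k, ξ k ^ 2 = ∫ x, u k x ^ 2 ∂ν)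
    (δu : Fin n → Ω → ℝ)
    (hδu : ∀ k, DiffusiveStein.IsCompensatedIntegral N ν Pr (u k) (δu k))
    {Ω' : Type*} [MeasurableSpace Ω'] (Qr : Measure Ω') [IsProbabilityMeasure Qr]
    (Y : Fin n → Ω' → ℝ) (hYindep : iIndepFun Y Qr)
    (hYlaw : ∀ k, HasLaw (Y k) (gaussianReal 0 (Real.toNNReal (ξ k ^ 2))) Qr)
    (F : DiffusiveStein.Path T → ℝ) (hF : F ∈ DiffusiveStein.SigmaClass T η p P) :
    Integrable (fun ω => F (DiffusiveStein.comb T (fun j => Y j ω))) Qr ∧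
    Integrable (fun ω => F (DiffusiveStein.comb T (fun j => δu j ω))) Pr ∧
    ENNReal.ofReal
      |∫ ω, F (DiffusiveStein.comb T (fun j => Y j ω)) ∂Qr -
        ∫ ω, F (DiffusiveStein.comb T (fun j => δu j ω)) ∂Pr| ≤
      ENNReal.ofReal (1 / 2 * max 1 T ^ 3 * (n : ℝ) ^ (-(3 / 2 : ℝ) + η)) *
        ∑ j, ∑ k, ∑ l, ∫⁻ x, ENNReal.ofReal (|u j x * u k x| * |u l x|) ∂ν := by
  have hn' : (0 : ℝ) < n := by exact_mod_cast hn
  have hT1 : 0 < max 1 T := lt_max_of_lt_left one_pos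
  have hG := DiffusiveStein.abs_comb_sub_le hT hp hηp hη hn hF
  refine ⟨DiffusiveStein.integrable_comp_of_l1_lipschitz hG fun j =>
      DiffusiveStein.integrable_of_hasLaw_gaussianReal (hYlaw j),
    DiffusiveStein.integrable_comp_of_l1_lipschitz hG fun j =>
      (hδu j).2.1.integrable one_le_two, ?_⟩
  have hum := fun k => (hu k).1.aemeasurable
  rw [DiffusiveStein.sum_sum_sum_lintegral hum]
  have hτm : ∀ k, AEStronglyMeasurable (fun x => |u k x| * (∑ l, |u l x|) ^ 2) ν := fun k => by
    have h1 := hum k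
    have h2 : AEMeasurable (fun x => ∑ l, |u l x|) ν :=
      Finset.aemeasurable_fun_sum _ fun l _ => measurable_norm.comp_aemeasurable (hum l)
    exact ((measurable_norm.comp_aemeasurable h1).mul (h2.pow_const 2)).aestronglyMeasurable
  have hτ0 : ∀ k x, 0 ≤ |u k x| * (∑ l, |u l x|) ^ 2 := fun k x => by positivity
  by_cases hfin : ∀ k, ∫⁻ x, ENNReal.ofReal (|u k x| * (∑ l, |u l x|) ^ 2) ∂ν ≠ ∞
  · have hS : ∀ k, Integrable (fun x => |u k x| * (∑ l, |u l x|) ^ 2) ν := fun k =>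
      (lintegral_ofReal_ne_top_iff_integrable (hτm k) (ae_of_all _ (hτ0 k))).1 (hfin k)
    simp only [← fun k => ofReal_integral_eq_lintegral_ofReal (hS k) (ae_of_all _ (hτ0 k))]
    have hR0 : ∀ k, 0 ≤ ∫ x, |u k x| * (∑ l, |u l x|) ^ 2 ∂ν := fun k => integral_nonneg (hτ0 k)
    rw [← ENNReal.ofReal_sum_of_nonneg fun k _ => hR0 k, ← ENNReal.ofReal_mul (by positivity)]
    refine ENNReal.ofReal_le_ofReal ?_
    refine (DiffusiveStein.abs_integral_gaussian_sub_poisson_le hN hδu horth hYindep hYlaw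
      (fun k => by rw [Real.coe_toNNReal _ (sq_nonneg _), hξ]) (by positivity) (by positivity) hG
      (DiffusiveStein.abs_delta3_comb_single_le hP hT hp hηp hη hn hF) hS).trans ?_
    refine mul_le_mul_of_nonneg_right ?_ (Finset.sum_nonneg fun k _ => hR0 k)
    have e : (n : ℝ) ^ (-(3 / 2 : ℝ) + η) = (n : ℝ) ^ (-(1 / 2 : ℝ) + η) / n := by
      rw [← Real.rpow_sub_one hn'.ne']
      congr 1
      ring
    have hpow : 0 < (n : ℝ) ^ (-(1 / 2 : ℝ) + η) := by positivity
    have hT2 : T ^ 2 ≤ max 1 T ^ 2 := by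
      gcongr
      exact le_max_right 1 T
    rw [e]
    -- The `1/6` of the interpolation meets the `3` of the Sobolev bound, and `T²` is absorbed into
    -- `max 1 T ^ 2`.
    calc 1 / 6 * (3 * max 1 T * (n : ℝ) ^ (-(1 / 2 : ℝ) + η) * (T ^ 2 / n))
        = 1 / 2 * (max 1 T * T ^ 2) * ((n : ℝ) ^ (-(1 / 2 : ℝ) + η) / n) := by ring
      _ ≤ 1 / 2 * (max 1 T * max 1 T ^ 2) * ((n : ℝ) ^ (-(1 / 2 : ℝ) + η) / n) := by gcongr
      _ = _ := by ring
  -- If one of the integrals diverges, the positive prefactor makes the right-hand side infinite.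
  · push Not at hfin
    obtain ⟨k, hk⟩ := hfin
    rw [ENNReal.sum_eq_top.2 ⟨k, Finset.mem_univ k, hk⟩, ENNReal.mul_top]
    · exact le_top
    · rw [Ne, ENNReal.ofReal_eq_zero, not_le]
      positivity
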